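/- Let $X$ be a non-empty Stone space (a totally disconnected compact Hausdorff space) and let $\varphi\colon X\to X$ be a homeomorphism. The suspension of $(X,\varphi)$ is the quotient space $Y^\varphi=(X\times\mathbb R)/\mathbb Z$, where $\mathbb Z$ acts by $n\cdot(x,t)=(\varphi^n(x),t-n)$; write $[x,t]$ for the class of $(x,t)$. A dyadic rational is a real number of the form $p/2^q$ with $p,q\in\mathbb Z$. A dyadic PL homeomorphism between two bounded open intervals $I,J\subset\mathbb R$ with dyadic endpoints is a homeomorphism $f\colon I\to J$ which is piecewise affine with finitely many breakpoints, all dyadic, and whose restriction to every piece has the form $t\mapsto 2^m t+b$ with $m\in\mathbb Z$ and $b$ a dyadic rational. A dyadic chart is given by a pair $(C,J)$, where $C\subset X$ is clopen and $J\subset\mathbb R$ is a bounded open interval with dyadic endpoints whose length is less than $\min\{n\ge 1 : \exists x\in C,\ \varphi^n(x)\in C\}\in\mathbb N\cup\{\infty\}$; then $(x,t)\mapsto[x,t]$ is injective on $C\times J$, and we denote its image by $U_{C\times J}\subset Y^\varphi$. Let $\mathsf T(\varphi)$ be the group of all homeomorphisms $g$ of $Y^\varphi$ such that 1. $g$ is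 isotopic to the identity, and 2. for every $y\in Y^\varphi$ there are a dyadic chart $(C,J)$ with $y\in U_{C\times J}$ and a dyadic PL homeomorphism $f\colon J\to f(J)\subset\mathbb R$ such that $(C,f(J))$ is again a dyadic chart and $g([x,t])=[x,f(t)]$ for all $(x,t)\in C\times J$. **Theorem.** If $(X,\varphi)$ is minimal, that is, if the orbit $\{\varphi^n(x): n\in\mathbb Z\}$ of every $x\in X$ is dense in $X$, then the group $\mathsf T(\varphi)$ is simple. -/

import Mathlib

/-! ### Dyadic rationals and dyadic piecewise linear homeomorphisms -/

/-- A dyadic rational: a real number of the form `p / 2 ^ q` with `p, q ∈ ℤ`. -/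
def IsDyadic (r : ℝ) : Prop := ∃ p q : ℤ, r = (p : ℝ) / (2 : ℝ) ^ q

/-- `f` is a dyadic piecewise linear homeomorphism from the open interval `(a, b)` onto the open
interval `(c, d)`: it is a homeomorphism between these intervals, their endpoints are dyadic, and
there is a finite set `S` of dyadic rationals (containing the breakpoints) such that on every
interval of `(a, b)` that does not meet `S` the map is of the form `t ↦ 2 ^ m * t + β` with
`m ∈ ℤ` and `β` dyadic. (Only the values of `f` on its source `(a, b)` matter.) -/
structure IsDyadicPL (f : OpenPartialHomeomorph ℝ ℝ) (a b c d : ℝ) : Prop where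
  source_eq : f.source = Set.Ioo a b
  target_eq : f.target = Set.Ioo c d
  dyadic_a : IsDyadic a
  dyadic_b : IsDyadic b
  dyadic_c : IsDyadic c
  dyadic_d : IsDyadic d
  pieces : ∃ S : Finset ℝ, (∀ s ∈ S, IsDyadic s) ∧
    ∀ u v : ℝ, Set.Ioo u v ⊆ Set.Ioo a b \ (S : Set ℝ) →
      ∃ (m : ℤ) (β : ℝ), IsDyadic β ∧ ∀ t ∈ Set.Ioo u v, f t = (2 : ℝ) ^ m * t + β

/-! ### The suspension -/

/-- The orbit relation of the `ℤ`-action `n • (x, t) = (φ ^ n x, t - n)` on `X × ℝ`. -/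
def suspensionSetoid {X : Type*} [TopologicalSpace X] (φ : X ≃ₜ X) : Setoid (X × ℝ) where
  r p q := ∃ n : ℤ, q = ((φ ^ n) p.1, p.2 - (n : ℝ))
  iseqv :=
    { refl := fun p => ⟨0, by simp⟩
      symm := by
        rintro ⟨x, t⟩ q ⟨n, rfl⟩
        refine ⟨-n, ?_⟩
        rw [← Homeomorph.mul_apply, ← zpow_add]
        simp
      trans := by
        rintro ⟨x, t⟩ q r ⟨n, rfl⟩ ⟨k, rfl⟩
        refine ⟨k + n, ?_⟩
        rw [zpow_add, Homeomorph.mul_apply]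
        simp only [Prod.mk.injEq, true_and]
        push_cast
        ring }

/-- The suspension (mapping torus) `(X × ℝ) / ℤ` of `(X, φ)`. -/
def Suspension {X : Type*} [TopologicalSpace X] (φ : X ≃ₜ X) : Type _ :=
  Quotient (suspensionSetoid φ)

/-- The suspension carries the quotient topology. -/
instance {X : Type*} [TopologicalSpace X] (φ : X ≃ₜ X) : TopologicalSpace (Suspension φ) :=
  inferInstanceAs (TopologicalSpace (Quotient (suspensionSetoid φ)))

/-- The class `[x, t]` of `(x, t)` in the suspension. -/
def Suspension.mk {X : Type*} [TopologicalSpace X] (φ : X ≃ₜ X) (x : X) (t : ℝ) : Suspension φ :=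
  Quotient.mk (suspensionSetoid φ) (x, t)

/-- `C × (a, b)` defines a dyadic chart of the suspension: `C` is clopen, `a` and `b` are dyadic,
and the length `b - a` is less than the first return time
`min {n ≥ 1 | ∃ x ∈ C, φ ^ n x ∈ C}` of `C` (which is `∞` if there is no such `n`). -/
structure IsDyadicChart {X : Type*} [TopologicalSpace X] (φ : X ≃ₜ X) (C : Set X) (a b : ℝ) :
    Prop where
  isClopen : IsClopen C
  dyadic_left : IsDyadic a
  dyadic_right : IsDyadic b
  length_lt : ∀ n : ℕ, 1 ≤ n → (∃ x ∈ C, (φ ^ n) x ∈ C) → b - a < n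

/-- The domain in the suspension associated with `C × (a, b)`. -/
def Suspension.domain {X : Type*} [TopologicalSpace X] (φ : X ≃ₜ X) (C : Set X) (a b : ℝ) :
    Set (Suspension φ) :=
  {y | ∃ x ∈ C, ∃ t ∈ Set.Ioo a b, y = Suspension.mk φ x t}

/-! ### The groups of homeomorphisms -/

/-- The group of self-homeomorphisms of `Y` that are isotopic to the identity, that is, joined to
the identity by a jointly continuous path `H` of homeomorphisms. -/
def isotopicToId (Y : Type*) [TopologicalSpace Y] : Subgroup (Y ≃ₜ Y) where
  carrier := {g | ∃ H : unitInterval → (Y ≃ₜ Y),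
    Continuous (fun p : unitInterval × Y => H p.1 p.2) ∧ H 0 = 1 ∧ H 1 = g}
  one_mem' := ⟨fun _ => 1, continuous_snd, rfl, rfl⟩
  mul_mem' := by
    rintro g k ⟨H, hH, hH0, hH1⟩ ⟨K, hK, hK0, hK1⟩
    refine ⟨fun s => H s * K s, ?_, by simp [hH0, hK0], by simp [hH1, hK1]⟩
    exact hH.comp (continuous_fst.prodMk hK)
  inv_mem' := by
    rintro g ⟨H, hH, hH0, hH1⟩
    refine ⟨fun s => g⁻¹ * H (unitInterval.symm s), ?_, by simp [hH1], by simp [hH0]⟩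
    exact g⁻¹.continuous.comp
      (hH.comp ((unitInterval.continuous_symm.comp continuous_fst).prodMk continuous_snd))

/-- The local condition defining dyadic piecewise linear homeomorphisms of the suspension: every
point has a dyadic chart domain `C × (a, b)` around it, on which `g` is given in coordinates by
`(x, t) ↦ (x, f t)`, from the chart `C × (a, b)` onto the chart `C × (c, d)`, for a dyadic piecewise
linear homeomorphism `f` of `(a, b)` onto `(c, d)`. -/
def IsLocallyDyadicPL {X : Type*} [TopologicalSpace X] (φ : X ≃ₜ X)
    (g : Suspension φ ≃ₜ Suspension φ) : Prop :=
  ∀ y : Suspension φ, ∃ (C : Set X) (a b c d : ℝ) (f : OpenPartialHomeomorph ℝ ℝ),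
    IsDyadicChart φ C a b ∧ IsDyadicChart φ C c d ∧ IsDyadicPL f a b c d ∧
    y ∈ Suspension.domain φ C a b ∧
    ∀ x ∈ C, ∀ t ∈ Set.Ioo a b, g (Suspension.mk φ x t) = Suspension.mk φ x (f t)

/-! ### Auxiliary facts: these homeomorphisms form a group -/

theorem IsDyadic.intCast (n : ℤ) : IsDyadic (n : ℝ) := ⟨n, 0, by simp⟩

theorem IsDyadic.neg {r : ℝ} (hr : IsDyadic r) : IsDyadic (-r) := by
  obtain ⟨p, q, rfl⟩ := hr
  exact ⟨-p, q, by push_cast; ring⟩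

theorem IsDyadic.zpow_mul {r : ℝ} (m : ℤ) (hr : IsDyadic r) : IsDyadic ((2 : ℝ) ^ m * r) := by
  obtain ⟨p, q, rfl⟩ := hr
  refine ⟨p, q - m, ?_⟩
  rw [zpow_sub₀ (by norm_num)]
  field_simp

theorem IsDyadic.exists_nat {r : ℝ} (hr : IsDyadic r) :
    ∃ N : ℕ, ∀ k : ℕ, N ≤ k → ∃ p : ℤ, r = (p : ℝ) / (2 : ℝ) ^ k := by
  obtain ⟨p, q, rfl⟩ := hr
  refine ⟨q.toNat, fun k hk => ?_⟩
  obtain ⟨j, hj⟩ : ∃ j : ℕ, (k : ℤ) = q + j := ⟨((k : ℤ) - q).toNat, by omega⟩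
  refine ⟨p * 2 ^ j, ?_⟩
  rw [← zpow_natCast (2 : ℝ) k, hj, zpow_add₀ (by norm_num)]
  push_cast
  field_simp
  simp

theorem IsDyadic.add {r s : ℝ} (hr : IsDyadic r) (hs : IsDyadic s) : IsDyadic (r + s) := by
  obtain ⟨N, hN⟩ := hr.exists_nat
  obtain ⟨M, hM⟩ := hs.exists_nat
  obtain ⟨p, hp⟩ := hN (max N M) (le_max_left _ _)
  obtain ⟨q, hq⟩ := hM (max N M) (le_max_right _ _)
  exact ⟨p + q, ((max N M : ℕ) : ℤ), by rw [hp, hq, zpow_natCast]; push_cast; ring⟩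

theorem IsDyadic.sub {r s : ℝ} (hr : IsDyadic r) (hs : IsDyadic s) : IsDyadic (r - s) := by
  rw [sub_eq_add_neg]
  exact hr.add hs.neg

theorem exists_isDyadic_between {u v : ℝ} (h : u < v) : ∃ r, IsDyadic r ∧ u < r ∧ r < v := by
  obtain ⟨n, hn⟩ := exists_pow_lt_of_lt_one (sub_pos.2 h) (by norm_num : (1 / 2 : ℝ) < 1)
  have h2 : (0 : ℝ) < 2 ^ n := by positivity
  have hn' : 1 < (v - u) * 2 ^ n := by
    rw [one_div, inv_pow] at hn
    calc (1 : ℝ) = ((2 : ℝ) ^ n)⁻¹ * 2 ^ n := by field_simp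
      _ < _ := mul_lt_mul_of_pos_right hn h2
  refine ⟨((⌊u * 2 ^ n⌋ + 1 : ℤ) : ℝ) / 2 ^ n, ⟨_, (n : ℤ), by rw [zpow_natCast]⟩, ?_, ?_⟩
  · rw [lt_div_iff₀ h2]
    push_cast
    exact Int.lt_floor_add_one _
  · rw [div_lt_iff₀ h2]
    push_cast
    have := Int.floor_le (u * 2 ^ n)
    linarith

theorem exists_isDyadic_Icc_subset {V : Set ℝ} (hV : IsOpen V) {t : ℝ} (ht : t ∈ V) :
    ∃ p q, IsDyadic p ∧ IsDyadic q ∧ p < t ∧ t < q ∧ Set.Icc p q ⊆ V := by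
  obtain ⟨l, u, ⟨hl, hu⟩, hlu⟩ := mem_nhds_iff_exists_Ioo_subset.1 (hV.mem_nhds ht)
  obtain ⟨p, hp, hlp, hpt⟩ := exists_isDyadic_between hl
  obtain ⟨q, hq, htq, hqu⟩ := exists_isDyadic_between hu
  exact ⟨p, q, hp, hq, hpt, htq, fun s hs => hlu ⟨hlp.trans_le hs.1, hs.2.trans_lt hqu⟩⟩

theorem IsDyadicPL.exists_left {f : OpenPartialHomeomorph ℝ ℝ} {a b c d : ℝ}
    (hf : IsDyadicPL f a b c d) {t : ℝ} (ht : t ∈ Set.Ioo a b) :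
    ∃ u < t, ∃ (m : ℤ) (β : ℝ), IsDyadic β ∧ ∀ s ∈ Set.Ioc u t, f s = (2 : ℝ) ^ m * s + β := by
  obtain ⟨S, -, hS⟩ := hf.pieces
  have h1 : Set.Ioo a b \ ((S : Set ℝ) \ {t}) ∈ nhds t := by
    refine IsOpen.mem_nhds ?_ ⟨ht, by simp⟩
    exact isOpen_Ioo.sdiff (S.finite_toSet.subset Set.sdiff_subset).isClosed
  obtain ⟨u, v, ⟨hu, hv⟩, huv⟩ := mem_nhds_iff_exists_Ioo_subset.1 h1
  obtain ⟨m, β, hβ, h⟩ := hS u t (fun s hs => by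
    have h2 := huv ⟨hs.1, hs.2.trans hv⟩
    exact ⟨h2.1, fun h3 => h2.2 ⟨h3, hs.2.ne⟩⟩)
  refine ⟨u, hu, m, β, hβ, fun s hs => ?_⟩
  rcases hs.2.lt_or_eq with hst | rfl
  · exact h s ⟨hs.1, hst⟩
  · have hc : Filter.Tendsto f (nhdsWithin s (Set.Iio s)) (nhds (f s)) :=
      (f.continuousAt (by rw [hf.source_eq]; exact ht)).tendsto.mono_left nhdsWithin_le_nhds
    have hc' : Filter.Tendsto (fun r : ℝ => (2 : ℝ) ^ m * r + β) (nhdsWithin s (Set.Iio s))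
        (nhds ((2 : ℝ) ^ m * s + β)) :=
      (Continuous.tendsto (by fun_prop) s).mono_left nhdsWithin_le_nhds
    refine tendsto_nhds_unique hc (hc'.congr' ?_)
    filter_upwards [Ioo_mem_nhdsLT hs.1] with r hr
    exact (h r hr).symm

theorem IsDyadicPL.isDyadic_apply {f : OpenPartialHomeomorph ℝ ℝ} {a b c d : ℝ}
    (hf : IsDyadicPL f a b c d) {t : ℝ} (ht : t ∈ Set.Ioo a b) : IsDyadic (f t) ↔ IsDyadic t := by
  obtain ⟨u, hu, m, β, hβ, h⟩ := hf.exists_left ht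
  rw [h t ⟨hu, le_rfl⟩]
  refine ⟨fun h1 => ?_, fun h1 => (h1.zpow_mul m).add hβ⟩
  have h2 := (h1.sub hβ).zpow_mul (-m)
  rwa [add_sub_cancel_right, ← mul_assoc, ← zpow_add₀ (by norm_num), neg_add_cancel, zpow_zero,
    one_mul] at h2

theorem IsDyadicPL.strictMonoOn {f : OpenPartialHomeomorph ℝ ℝ} {a b c d : ℝ}
    (hf : IsDyadicPL f a b c d) : StrictMonoOn f (Set.Ioo a b) := by
  intro u hu v hv huv
  have hsub : Set.Icc u v ⊆ f.source := by
    rw [hf.source_eq]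
    exact fun s hs => ⟨hu.1.trans_le hs.1, hs.2.trans_lt hv.2⟩
  rcases ContinuousOn.strictMonoOn_of_injOn_Icc' huv.le (f.continuousOn.mono hsub)
    (f.injOn.mono hsub) with h | h
  · exact h ⟨le_rfl, huv.le⟩ ⟨huv.le, le_rfl⟩ huv
  · obtain ⟨w, hw, m, β, -, hm⟩ := hf.exists_left hv
    obtain ⟨s, hs1, hs2⟩ := exists_between (max_lt huv hw)
    have h1 := h (a := s) (b := v) ⟨(le_max_left _ _).trans hs1.le, hs2.le⟩ ⟨huv.le, le_rfl⟩ hs2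
    rw [hm s ⟨(le_max_right _ _).trans_lt hs1, hs2.le⟩, hm v ⟨hw, le_rfl⟩] at h1
    have : (0 : ℝ) < (2 : ℝ) ^ m := by positivity
    nlinarith

theorem IsDyadicPL.symm {f : OpenPartialHomeomorph ℝ ℝ} {a b c d : ℝ}
    (hf : IsDyadicPL f a b c d) : IsDyadicPL f.symm c d a b where
  source_eq := hf.target_eq
  target_eq := hf.source_eq
  dyadic_a := hf.dyadic_c
  dyadic_b := hf.dyadic_d
  dyadic_c := hf.dyadic_a
  dyadic_d := hf.dyadic_b
  pieces := by
    classical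
    obtain ⟨S, hSd, hS⟩ := hf.pieces
    refine ⟨(S.filter (· ∈ Set.Ioo a b)).image f, ?_, fun u v huv => ?_⟩
    · intro s hs
      obtain ⟨r, hr, rfl⟩ := Finset.mem_image.1 hs
      rw [Finset.mem_filter] at hr
      exact (hf.isDyadic_apply hr.2).2 (hSd r hr.1)
    rcases le_or_gt v u with hvu | huv'
    · exact ⟨0, 0, by simpa using IsDyadic.intCast 0, by simp [Set.Ioo_eq_empty (not_lt.2 hvu)]⟩
    have hsub : Set.Ioo u v ⊆ f.symm.source := by
      intro s hs
      have := (huv hs).1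
      rwa [← hf.target_eq] at this
    set P : Set ℝ := f.symm '' Set.Ioo u v with hP
    have hPs : P ⊆ Set.Ioo a b := by
      rintro _ ⟨s, hs, rfl⟩
      rw [← hf.source_eq]
      exact f.map_target (hsub hs)
    have hPo : IsOpen P := f.symm.isOpen_image_of_subset_source isOpen_Ioo hsub
    have hPc : IsConnected P :=
      (isConnected_Ioo huv').image _ (f.symm.continuousOn.mono hsub)
    have hbb : BddBelow P := ⟨a, fun s hs => (hPs hs).1.le⟩
    have hba : BddAbove P := ⟨b, fun s hs => (hPs hs).2.le⟩
    have hIoo : Set.Ioo (sInf P) (sSup P) ⊆ P := hPc.Ioo_csInf_csSup_subset hbb hba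
    have hIoo' : P ⊆ Set.Ioo (sInf P) (sSup P) := by
      intro s hs
      obtain ⟨l, r, ⟨hl, hr⟩, hlr⟩ := mem_nhds_iff_exists_Ioo_subset.1 (hPo.mem_nhds hs)
      obtain ⟨l', hl1, hl2⟩ := exists_between hl
      obtain ⟨r', hr1, hr2⟩ := exists_between hr
      exact ⟨(csInf_le hbb (hlr ⟨hl1, hl2.trans hr⟩)).trans_lt hl2,
        hr1.trans_le (le_csSup hba (hlr ⟨hl.trans hr1, hr2⟩))⟩
    obtain ⟨m, β, hβ, h⟩ := hS (sInf P) (sSup P) (by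
      intro s hs
      refine ⟨hPs (hIoo hs), fun hsS => ?_⟩
      obtain ⟨r, hr, hrs⟩ := hIoo hs
      refine (huv hr).2 ?_
      rw [Finset.mem_coe, Finset.mem_image]
      exact ⟨s, Finset.mem_filter.2 ⟨hsS, hPs (hIoo hs)⟩, by rw [← hrs]; exact f.right_inv (hsub hr)⟩)
    refine ⟨-m, -((2 : ℝ) ^ (-m) * β), (hβ.zpow_mul _).neg, fun t ht => ?_⟩
    have h1 := h (f.symm t) (hIoo' ⟨t, ht, rfl⟩)
    rw [f.right_inv (hsub ht)] at h1
    have h2 : (2 : ℝ) ^ (-m) * (2 : ℝ) ^ m = 1 := by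
      rw [← zpow_add₀ (by norm_num), neg_add_cancel, zpow_zero]
    linear_combination (-(2 : ℝ) ^ (-m)) * h1 - (f.symm t) * h2

theorem IsDyadicPL.trans {f h : OpenPartialHomeomorph ℝ ℝ} {a b c d p q : ℝ}
    (hf : IsDyadicPL f a b c d) (hh : IsDyadicPL h c d p q) :
    IsDyadicPL (f.trans' h (hf.target_eq.trans hh.source_eq.symm)) a b p q where
  source_eq := hf.source_eq
  target_eq := hh.target_eq
  dyadic_a := hf.dyadic_a
  dyadic_b := hf.dyadic_b
  dyadic_c := hh.dyadic_c
  dyadic_d := hh.dyadic_d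
  pieces := by
    classical
    obtain ⟨S, hSd, hS⟩ := hf.pieces
    obtain ⟨R, hRd, hR⟩ := hh.pieces
    have hmap : ∀ t ∈ Set.Ioo a b, f t ∈ Set.Ioo c d := fun t ht => by
      rw [← hf.target_eq]
      exact f.map_source (by rw [hf.source_eq]; exact ht)
    refine ⟨S ∪ (R.filter (· ∈ Set.Ioo c d)).image f.symm, ?_, fun u v huv => ?_⟩
    · intro s hs
      rcases Finset.mem_union.1 hs with hs | hs
      · exact hSd s hs
      · obtain ⟨r, hr, rfl⟩ := Finset.mem_image.1 hs
        rw [Finset.mem_filter] at hr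
        exact (hf.symm.isDyadic_apply hr.2).2 (hRd r hr.1)
    · obtain ⟨m, β, hβ, h1⟩ := hS u v (fun s hs => ⟨(huv hs).1, fun h3 => (huv hs).2 (by
        rw [Finset.mem_coe, Finset.mem_union]; exact Or.inl h3)⟩)
      have h2 : (0 : ℝ) < (2 : ℝ) ^ m := by positivity
      obtain ⟨k, γ, hγ, h3⟩ := hR ((2 : ℝ) ^ m * u + β) ((2 : ℝ) ^ m * v + β) (by
        intro w hw
        obtain ⟨s, rfl⟩ : ∃ s, w = (2 : ℝ) ^ m * s + β := ⟨(w - β) / (2 : ℝ) ^ m, by field_simp; ring⟩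
        have hs : s ∈ Set.Ioo u v := by
          constructor
          · have := hw.1; nlinarith
          · have := hw.2; nlinarith
        have hs' := (huv hs).1
        rw [← h1 s hs]
        refine ⟨hmap s hs', fun hsR => (huv hs).2 ?_⟩
        rw [Finset.mem_coe, Finset.mem_union]
        exact Or.inr (Finset.mem_image.2 ⟨f s, Finset.mem_filter.2 ⟨hsR, hmap s hs'⟩,
          f.left_inv (by rw [hf.source_eq]; exact hs')⟩))
      refine ⟨k + m, (2 : ℝ) ^ k * β + γ, (hβ.zpow_mul k).add hγ, fun t ht => ?_⟩
      change h (f t) = _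
      rw [h1 t ht, h3 _ ⟨by have := ht.1; nlinarith, by have := ht.2; nlinarith⟩,
        zpow_add₀ (by norm_num)]
      ring

theorem IsDyadicPL.restr {f : OpenPartialHomeomorph ℝ ℝ} {a b c d : ℝ}
    (hf : IsDyadicPL f a b c d) {p q : ℝ} (hp : p ∈ Set.Ioo a b) (hq : q ∈ Set.Ioo a b)
    (hpd : IsDyadic p) (hqd : IsDyadic q) :
    IsDyadicPL (f.restrOpen (Set.Ioo p q) isOpen_Ioo) p q (f p) (f q) where
  source_eq := by
    rw [OpenPartialHomeomorph.restrOpen_source, hf.source_eq]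
    exact Set.inter_eq_right.2 fun s hs => ⟨hp.1.trans hs.1, hs.2.trans hq.2⟩
  target_eq := by
    have hmap : ∀ t ∈ Set.Ioo c d, f.symm t ∈ Set.Ioo a b := fun t ht => by
      rw [← hf.source_eq]
      exact f.map_target (by rw [hf.target_eq]; exact ht)
    have hmap' : ∀ t ∈ Set.Ioo a b, f t ∈ Set.Ioo c d := fun t ht => by
      rw [← hf.target_eq]
      exact f.map_source (by rw [hf.source_eq]; exact ht)
    have htgt : (f.restrOpen (Set.Ioo p q) isOpen_Ioo).target
        = f.target ∩ f.symm ⁻¹' Set.Ioo p q := rfl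
    rw [htgt, hf.target_eq]
    ext t
    constructor
    · rintro ⟨ht, h1, h2⟩
      rw [← f.right_inv (x := t) (by rw [hf.target_eq]; exact ht)]
      exact ⟨hf.strictMonoOn hp (hmap t ht) h1, hf.strictMonoOn (hmap t ht) hq h2⟩
    · rintro ⟨h1, h2⟩
      have ht : t ∈ Set.Ioo c d := ⟨(hmap' p hp).1.trans h1, h2.trans (hmap' q hq).2⟩
      rw [← f.right_inv (x := t) (by rw [hf.target_eq]; exact ht)] at h1 h2
      exact ⟨ht, (hf.strictMonoOn.lt_iff_lt hp (hmap t ht)).1 h1,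
        (hf.strictMonoOn.lt_iff_lt (hmap t ht) hq).1 h2⟩
  dyadic_a := hpd
  dyadic_b := hqd
  dyadic_c := (hf.isDyadic_apply hp).2 hpd
  dyadic_d := (hf.isDyadic_apply hq).2 hqd
  pieces := by
    obtain ⟨S, hSd, hS⟩ := hf.pieces
    refine ⟨S, hSd, fun u v huv => hS u v fun s hs => ?_⟩
    exact ⟨⟨hp.1.trans (huv hs).1.1, (huv hs).1.2.trans hq.2⟩, (huv hs).2⟩

/-- The translation by the integer `n`, restricted to `(a, b)`. -/
def intTranslation (n : ℤ) (a b : ℝ) : OpenPartialHomeomorph ℝ ℝ :=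
  ((Homeomorph.addRight (n : ℝ)).toOpenPartialHomeomorph).restrOpen (Set.Ioo a b) isOpen_Ioo

theorem isDyadicPL_intTranslation (n : ℤ) {a b : ℝ} (ha : IsDyadic a) (hb : IsDyadic b) :
    IsDyadicPL (intTranslation n a b) a b (a + n) (b + n) where
  source_eq := by
    rw [intTranslation, OpenPartialHomeomorph.restrOpen_source]
    simp
  target_eq := by
    have : (intTranslation n a b).target
        = Set.univ ∩ (fun s : ℝ => s + -(n : ℝ)) ⁻¹' Set.Ioo a b := rfl
    rw [this]
    ext s
    simp only [Set.univ_inter, Set.mem_preimage, Set.mem_Ioo]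
    constructor <;> rintro ⟨h1, h2⟩ <;> constructor <;> linarith
  dyadic_a := ha
  dyadic_b := hb
  dyadic_c := ha.add (IsDyadic.intCast n)
  dyadic_d := hb.add (IsDyadic.intCast n)
  pieces := by
    refine ⟨∅, by simp, fun u v _ => ⟨0, n, IsDyadic.intCast n, fun t _ => ?_⟩⟩
    change t + (n : ℝ) = _
    simp

theorem Suspension.mk_eq_mk {X : Type*} [TopologicalSpace X] (φ : X ≃ₜ X) (x x' : X) (t t' : ℝ) :
    Suspension.mk φ x t = Suspension.mk φ x' t' ↔ ∃ n : ℤ, x' = (φ ^ n) x ∧ t' = t - n := by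
  refine (Quotient.eq (r := suspensionSetoid φ)).trans ?_
  change (∃ n : ℤ, (x', t') = ((φ ^ n) x, t - (n : ℝ))) ↔ _
  simp only [Prod.mk.injEq]

theorem Suspension.exists_mk {X : Type*} [TopologicalSpace X] (φ : X ≃ₜ X) (y : Suspension φ) :
    ∃ x t, y = Suspension.mk φ x t := by
  induction y using Quotient.inductionOn with
  | h p => exact ⟨p.1, p.2, rfl⟩

theorem IsDyadicChart.mono {X : Type*} [TopologicalSpace X] {φ : X ≃ₜ X} {C D : Set X}
    {a b p q : ℝ} (h : IsDyadicChart φ C a b) (hD : IsClopen D) (hDC : D ⊆ C) (hp : IsDyadic p)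
    (hq : IsDyadic q) (hlen : q - p ≤ b - a) : IsDyadicChart φ D p q :=
  ⟨hD, hp, hq, fun n hn ⟨x, hx, hx'⟩ =>
    hlen.trans_lt (h.length_lt n hn ⟨x, hDC hx, hDC hx'⟩)⟩

theorem IsDyadicChart.preimage {X : Type*} [TopologicalSpace X] {φ : X ≃ₜ X} {C : Set X}
    {a b : ℝ} (h : IsDyadicChart φ C a b) (n : ℤ) : IsDyadicChart φ ((φ ^ n) ⁻¹' C) a b := by
  refine ⟨h.isClopen.preimage (φ ^ n).continuous, h.dyadic_left, h.dyadic_right, ?_⟩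
  rintro k hk ⟨x, hx, hx'⟩
  refine h.length_lt k hk ⟨(φ ^ n) x, hx, ?_⟩
  have h1 : (φ ^ k) ((φ ^ n) x) = (φ ^ n) ((φ ^ k) x) := by
    rw [← Homeomorph.mul_apply, ← Homeomorph.mul_apply, ((Commute.refl φ).pow_left k).zpow_right n]
  rw [h1]
  exact hx'

theorem IsLocallyDyadicPL.one {X : Type*} [TopologicalSpace X] (φ : X ≃ₜ X) :
    IsLocallyDyadicPL φ 1 := by
  intro y
  obtain ⟨x, t, rfl⟩ := Suspension.exists_mk φ y
  obtain ⟨p, q, hp, hq, hpt, htq, hsub⟩ :=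
    exists_isDyadic_Icc_subset (t := t) (isOpen_Ioo (a := t - 1 / 4) (b := t + 1 / 4))
      ⟨by linarith, by linarith⟩
  have hlen : q - p < 1 := by
    have h1 := (hsub ⟨le_rfl, (hpt.trans htq).le⟩).1
    have h2 := (hsub ⟨(hpt.trans htq).le, le_rfl⟩).2
    linarith
  have hchart : IsDyadicChart φ Set.univ p q :=
    ⟨isClopen_univ, hp, hq, fun n hn _ => hlen.trans_le (by exact_mod_cast hn)⟩
  refine ⟨Set.univ, p, q, p, q, intTranslation 0 p q, hchart, hchart, ?_,
    ⟨x, Set.mem_univ x, t, ⟨hpt, htq⟩, rfl⟩, ?_⟩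
  · simpa using isDyadicPL_intTranslation 0 hp hq
  · intro x' _ t' _
    change _ = Suspension.mk φ x' (t' + ((0 : ℤ) : ℝ))
    simp

theorem IsLocallyDyadicPL.inv {X : Type*} [TopologicalSpace X] {φ : X ≃ₜ X}
    {g : Suspension φ ≃ₜ Suspension φ} (hg : IsLocallyDyadicPL φ g) :
    IsLocallyDyadicPL φ g⁻¹ := by
  intro y
  obtain ⟨C, a, b, c, d, f, hC, hC', hf, ⟨x, hx, t, ht, hy⟩, hgf⟩ := hg (g⁻¹ y)
  have hy' : y = Suspension.mk φ x (f t) := by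
    rw [← hgf x hx t ht, ← hy]
    exact (g.apply_symm_apply y).symm
  refine ⟨C, c, d, a, b, f.symm, hC', hC, hf.symm, ⟨x, hx, f t, ?_, hy'⟩, fun x' hx' t' ht' => ?_⟩
  · rw [← hf.target_eq]
    exact f.map_source (by rw [hf.source_eq]; exact ht)
  · have ht'' : t' ∈ f.target := by rw [hf.target_eq]; exact ht'
    have h1 : f.symm t' ∈ Set.Ioo a b := by
      rw [← hf.source_eq]
      exact f.map_target ht''
    have h2 := hgf x' hx' _ h1
    rw [f.right_inv ht''] at h2
    rw [← h2]
    exact g.symm_apply_apply _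

theorem IsLocallyDyadicPL.mul {X : Type*} [TopologicalSpace X] {φ : X ≃ₜ X}
    {g k : Suspension φ ≃ₜ Suspension φ} (hg : IsLocallyDyadicPL φ g)
    (hk : IsLocallyDyadicPL φ k) : IsLocallyDyadicPL φ (g * k) := by
  intro y
  obtain ⟨C, a, b, c, d, f, hC, hC', hf, ⟨x, hx, t, ht, rfl⟩, hkf⟩ := hk y
  obtain ⟨D, a', b', c', d', h, hD, hD', hh, ⟨z, hz, s, hs, hzs⟩, hgh⟩ :=
    hg (k (Suspension.mk φ x t))
  rw [hkf x hx t ht, Suspension.mk_eq_mk] at hzs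
  obtain ⟨n, rfl, rfl⟩ := hzs
  have hmapf : ∀ t ∈ Set.Ioo a b, f t ∈ Set.Ioo c d := fun t ht => by
    rw [← hf.target_eq]
    exact f.map_source (by rw [hf.source_eq]; exact ht)
  have hmaph : ∀ t ∈ Set.Ioo a' b', h t ∈ Set.Ioo c' d' := fun t ht => by
    rw [← hh.target_eq]
    exact h.map_source (by rw [hh.source_eq]; exact ht)
  have hV : IsOpen (f.source ∩ f ⁻¹' Set.Ioo (a' + n) (b' + n)) := f.isOpen_inter_preimage isOpen_Ioo
  obtain ⟨p, q, hpd, hqd, hpt, htq, hsub⟩ := exists_isDyadic_Icc_subset (t := t) hV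
    ⟨by rw [hf.source_eq]; exact ht, by have := hs.1; linarith, by have := hs.2; linarith⟩
  have hpq := (hpt.trans htq).le
  rw [hf.source_eq] at hsub
  obtain ⟨hp, hp1, hp2⟩ := hsub ⟨le_rfl, hpq⟩
  obtain ⟨hq, hq1, hq2⟩ := hsub ⟨hpq, le_rfl⟩
  have hfr := hf.restr hp hq hpd hqd
  have hp' : f p + ((-n : ℤ) : ℝ) ∈ Set.Ioo a' b' := by
    push_cast
    exact ⟨by linarith, by linarith⟩
  have hq' : f q + ((-n : ℤ) : ℝ) ∈ Set.Ioo a' b' := by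
    push_cast
    exact ⟨by linarith, by linarith⟩
  have ht1 := isDyadicPL_intTranslation (-n) hfr.dyadic_c hfr.dyadic_d
  have hhr := hh.restr hp' hq' ht1.dyadic_c ht1.dyadic_d
  have ht2 := isDyadicPL_intTranslation n hhr.dyadic_c hhr.dyadic_d
  have hall := ((hfr.trans ht1).trans hhr).trans ht2
  have hclopen : IsClopen (C ∩ (φ ^ n) ⁻¹' D) :=
    hC.isClopen.inter (hD.isClopen.preimage (φ ^ n).continuous)
  refine ⟨C ∩ (φ ^ n) ⁻¹' D, p, q, _, _, _, ?_, ?_, hall,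
    ⟨x, ⟨hx, hz⟩, t, ⟨hpt, htq⟩, rfl⟩, ?_⟩
  · exact hC.mono hclopen Set.inter_subset_left hpd hqd (by linarith [hp.1, hq.2])
  · refine (hD'.preimage n).mono hclopen Set.inter_subset_right hall.dyadic_c hall.dyadic_d ?_
    have h1 := (hmaph _ hp').1
    have h2 := (hmaph _ hq').2
    linarith
  · rintro x' ⟨hx', hz'⟩ t' ht'
    obtain ⟨ht'1, ht'2, ht'3⟩ := hsub ⟨ht'.1.le, ht'.2.le⟩
    change g (k (Suspension.mk φ x' t'))
      = Suspension.mk φ x' (h (f t' + ((-n : ℤ) : ℝ)) + (n : ℝ))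
    have h1 : Suspension.mk φ x' (f t') = Suspension.mk φ ((φ ^ n) x') (f t' + ((-n : ℤ) : ℝ)) :=
      (Suspension.mk_eq_mk φ _ _ _ _).2 ⟨n, rfl, by push_cast; ring⟩
    rw [hkf x' hx' t' ht'1, h1, hgh _ hz' _ (by push_cast; exact ⟨by linarith, by linarith⟩)]
    exact ((Suspension.mk_eq_mk φ _ _ _ _).2 ⟨n, rfl, by ring⟩).symm

/-- The group `T(φ)`: all homeomorphisms of the suspension of `(X, φ)` that are isotopic to the
identity and are locally given, in dyadic charts, by dyadic piecewise linear homeomorphisms in the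
direction of the flow. -/
def groupT {X : Type*} [TopologicalSpace X] (φ : X ≃ₜ X) :
    Subgroup (Suspension φ ≃ₜ Suspension φ) where
  carrier := {g | g ∈ isotopicToId (Suspension φ) ∧ IsLocallyDyadicPL φ g}
  one_mem' := ⟨one_mem _, IsLocallyDyadicPL.one φ⟩
  mul_mem' := fun hg hk => ⟨mul_mem hg.1 hk.1, hg.2.mul hk.2⟩
  inv_mem' := fun hg => ⟨inv_mem hg.1, hg.2.inv⟩

/-- The dynamical system `(X, φ)` is minimal: every orbit is dense. -/
def IsMinimalSystem {X : Type*} [TopologicalSpace X] (φ : X ≃ₜ X) : Prop :=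
  ∀ x : X, Dense (Set.range fun n : ℤ => (φ ^ n) x)

/-! The projection of `X × ℝ` onto the suspension is a covering, so an isotopy starting at the
identity lifts. Since `X` is totally disconnected, the lift cannot change the `X`-coordinate. Hence
every element of `T(φ)` comes from an equivariant family `G x` of increasing dyadic piecewise linear
bijections of the line, locally constant in `x` on compact intervals
(`exists_liftPL_of_mem_groupT`). Conversely, linear interpolation with the identity shows that every
such family induces an element of `T(φ)`. So `T(φ)` is a quotient of the group `liftPL φ`, and it
suffices that a normal subgroup `N` of `liftPL φ` is everything as soon as it contains some `G` that
moves a point of the suspension (`liftPL_le_of_normal`).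

Such a `G` displaces a whole cylinder `C₀ × (a₀, b₀)`. If `R₁` and `R₂` are supported in this
cylinder, then `G R₁⁻¹ G⁻¹` commutes with `R₂`, so `⁅R₁, R₂⁆ = ⁅⁅R₁, G⁆, R₂⁆` lies in `N`
(`commutator_cylMap_mem`). Three facts spread this over the whole group.

Perfectness: a dyadic piecewise linear map supported in `(a, b)` is a product of commutators of maps
supported in any larger open dyadic interval (`suppPL_le_commutator`). This is the argument for the
commutator subgroup of Thompson's group `F`: modulo commutators of compactly supported maps all
elementary maps of one scale coincide, and the exponent that remains is read off near `+∞`.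

Fragmentation: `liftPL φ` is generated by maps supported in cylinders over clopen sets
(`liftPL_le_of_cylGens`). The zero section is carried to its image in small steps along a straight
line, and what remains splits over `[0, 1/2]` and `[1/2, 1]`.

Minimality: the translates of `C₀` under the powers of `φ` cover `X`. After cutting a clopen base
into small pieces, the dyadic flow followed by a dyadic piecewise linear map of the line conjugates
every generator into `C₀ × (a₀, b₀)`, where perfectness and the commutator identity apply. -/

open Filter Topology
open scoped commutatorElement

/-! ### Germs of dyadic piecewise linear maps of the line -/

/-- `f` agrees along the filter `l` with an affine map `t ↦ 2 ^ m * t + β`, `β` dyadic. -/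
def IsDyadicAffineAlong (f : ℝ → ℝ) (l : Filter ℝ) : Prop :=
  ∃ (m : ℤ) (β : ℝ), IsDyadic β ∧ ∀ᶠ s in l, f s = (2 : ℝ) ^ m * s + β

namespace IsDyadicAffineAlong

theorem mono {f : ℝ → ℝ} {l l' : Filter ℝ} (h : IsDyadicAffineAlong f l) (hl : l' ≤ l) :
    IsDyadicAffineAlong f l' := by
  obtain ⟨m, β, hβ, h⟩ := h
  exact ⟨m, β, hβ, hl h⟩

theorem congr {f g : ℝ → ℝ} {l : Filter ℝ} (h : IsDyadicAffineAlong f l) (hfg : f =ᶠ[l] g) :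
    IsDyadicAffineAlong g l := by
  obtain ⟨m, β, hβ, h⟩ := h
  exact ⟨m, β, hβ, by filter_upwards [h, hfg] with s h1 h2; rw [← h2, h1]⟩

theorem comp {f g : ℝ → ℝ} {l l' : Filter ℝ} (hf : IsDyadicAffineAlong f l')
    (hg : IsDyadicAffineAlong g l) (ht : Tendsto g l l') : IsDyadicAffineAlong (f ∘ g) l := by
  obtain ⟨m, β, hβ, h⟩ := hf
  obtain ⟨k, γ, hγ, h'⟩ := hg
  refine ⟨m + k, (2 : ℝ) ^ m * γ + β, (hγ.zpow_mul m).add hβ, ?_⟩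
  filter_upwards [h', ht.eventually h] with s h1 h2
  rw [Function.comp_apply, h2, h1, zpow_add₀ (by norm_num)]
  ring

theorem inverse {f g : ℝ → ℝ} {l l' : Filter ℝ} (hf : IsDyadicAffineAlong f l')
    (hfg : ∀ s, f (g s) = s) (ht : Tendsto g l l') : IsDyadicAffineAlong g l := by
  obtain ⟨m, β, hβ, h⟩ := hf
  refine ⟨-m, -((2 : ℝ) ^ (-m) * β), (hβ.zpow_mul _).neg, ?_⟩
  filter_upwards [ht.eventually h] with s h1
  rw [hfg] at h1
  have h2 : (2 : ℝ) ^ (-m) * (2 : ℝ) ^ m = 1 := by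
    rw [← zpow_add₀ (by norm_num), neg_add_cancel, zpow_zero]
  linear_combination (-(2 : ℝ) ^ (-m)) * h1 - (g s) * h2

end IsDyadicAffineAlong

/-- An increasing bijection of the line is dyadic piecewise linear if it is so locally. -/
def IsLocDyadicPL (f : ℝ ≃o ℝ) : Prop :=
  ∀ t, IsDyadicAffineAlong f (𝓝[≥] t) ∧ IsDyadicAffineAlong f (𝓝[≤] t) ∧
    (¬ IsDyadic t → IsDyadicAffineAlong f (𝓝 t))

/-- A map `t ↦ 2 ^ m * t + β` with `β` dyadic preserves and reflects dyadic points. This is what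
keeps the breakpoints of products and inverses dyadic: the two-sided germ of `IsLocDyadicPL` is
demanded only at non-dyadic points. -/
theorem IsLocDyadicPL.isDyadic_apply {f : ℝ ≃o ℝ} (hf : IsLocDyadicPL f) {t : ℝ} :
    IsDyadic (f t) ↔ IsDyadic t := by
  obtain ⟨m, β, hβ, h⟩ := (hf t).1
  rw [h.self_of_nhdsWithin (Set.mem_Ici.2 le_rfl)]
  refine ⟨fun h1 => ?_, fun h1 => (h1.zpow_mul m).add hβ⟩
  have h2 := (h1.sub hβ).zpow_mul (-m)
  rwa [add_sub_cancel_right, ← mul_assoc, ← zpow_add₀ (by norm_num), neg_add_cancel, zpow_zero,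
    one_mul] at h2

theorem OrderIso.tendsto_nhdsGE (f : ℝ ≃o ℝ) (t : ℝ) : Tendsto f (𝓝[≥] t) (𝓝[≥] (f t)) :=
  tendsto_nhdsWithin_of_tendsto_nhds_of_eventually_within _
    (f.continuous.continuousWithinAt) (by
      filter_upwards [self_mem_nhdsWithin] with s hs using f.monotone hs)

theorem OrderIso.tendsto_nhdsLE (f : ℝ ≃o ℝ) (t : ℝ) : Tendsto f (𝓝[≤] t) (𝓝[≤] (f t)) :=
  tendsto_nhdsWithin_of_tendsto_nhds_of_eventually_within _
    (f.continuous.continuousWithinAt) (by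
      filter_upwards [self_mem_nhdsWithin] with s hs using f.monotone hs)

/-- The group of dyadic piecewise linear homeomorphisms of the line, with possibly infinitely many
breakpoints. -/
def locPL : Subgroup (ℝ ≃o ℝ) where
  carrier := {f | IsLocDyadicPL f}
  one_mem' := by
    have h : IsDyadicAffineAlong (fun t : ℝ => t) ⊤ :=
      ⟨0, 0, by simpa using IsDyadic.intCast 0, by simp⟩
    exact fun t => ⟨h.mono le_top, h.mono le_top, fun _ => h.mono le_top⟩
  mul_mem' := by
    intro f g hf hg t
    refine ⟨(hf (g t)).1.comp (hg t).1 (g.tendsto_nhdsGE t),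
      (hf (g t)).2.1.comp (hg t).2.1 (g.tendsto_nhdsLE t), fun ht => ?_⟩
    exact ((hf (g t)).2.2 (by rwa [IsLocDyadicPL.isDyadic_apply hg])).comp ((hg t).2.2 ht)
      g.continuous.continuousAt
  inv_mem' := by
    intro f hf t
    have h := hf (f⁻¹ t)
    have h1 : ∀ s, f (f⁻¹ s) = s := fun s => RelIso.apply_inv_self f s
    refine ⟨h.1.inverse h1 ((f⁻¹).tendsto_nhdsGE t), h.2.1.inverse h1 ((f⁻¹).tendsto_nhdsLE t),
      fun ht => (h.2.2 ?_).inverse h1 (f⁻¹).continuous.continuousAt⟩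
    rwa [← IsLocDyadicPL.isDyadic_apply hf, h1]

theorem isDyadic_locPL {f : ℝ ≃o ℝ} (hf : f ∈ locPL) {t : ℝ} : IsDyadic (f t) ↔ IsDyadic t :=
  IsLocDyadicPL.isDyadic_apply hf

theorem IsDyadic.inv_two_pow (k : ℕ) : IsDyadic ((2 : ℝ) ^ k)⁻¹ := ⟨1, k, by simp⟩

theorem IsDyadic.zero : IsDyadic 0 := by simpa using IsDyadic.intCast 0

theorem IsDyadic.one : IsDyadic 1 := by simpa using IsDyadic.intCast 1

theorem IsDyadic.mul {r s : ℝ} (hr : IsDyadic r) (hs : IsDyadic s) : IsDyadic (r * s) := by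
  obtain ⟨p, q, rfl⟩ := hr
  obtain ⟨p', q', rfl⟩ := hs
  exact ⟨p * p', q + q', by rw [zpow_add₀ (by norm_num)]; push_cast; field_simp⟩

/-! ### Affine maps and gluing -/

/-- The affine bijection `t ↦ 2 ^ m * t + β`. -/
noncomputable def affineIso (m : ℤ) (β : ℝ) : ℝ ≃o ℝ :=
  StrictMono.orderIsoOfSurjective (fun t : ℝ => (2 : ℝ) ^ m * t + β)
    (fun s t h => by have : (0 : ℝ) < (2 : ℝ) ^ m := by positivity
                     simp only; nlinarith)
    (fun y => ⟨(y - β) / (2 : ℝ) ^ m, by field_simp; ring⟩)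

theorem affineIso_apply (m : ℤ) (β t : ℝ) : affineIso m β t = (2 : ℝ) ^ m * t + β := rfl

theorem affineIso_mem (m : ℤ) {β : ℝ} (hβ : IsDyadic β) : affineIso m β ∈ locPL := by
  have h : IsDyadicAffineAlong (affineIso m β) ⊤ := ⟨m, β, hβ, by simp [affineIso_apply]⟩
  exact fun t => ⟨h.mono le_top, h.mono le_top, fun _ => h.mono le_top⟩

/-- The translation by `c`. -/
noncomputable def transl (c : ℝ) : ℝ ≃o ℝ := OrderIso.addRight c

theorem transl_apply (c t : ℝ) : transl c t = t + c := rfl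

theorem transl_inv (c : ℝ) : (transl c)⁻¹ = transl (-c) := by
  rw [inv_eq_iff_mul_eq_one]
  ext t
  simp [transl_apply, RelIso.mul_apply]

theorem transl_inv_apply (c t : ℝ) : (transl c)⁻¹ t = t - c := by
  rw [transl_inv, transl_apply, sub_eq_add_neg]

theorem transl_mem {c : ℝ} (hc : IsDyadic c) : transl c ∈ locPL := by
  have : transl c = affineIso 0 c := by ext t; simp [transl_apply, affineIso_apply]
  rw [this]
  exact affineIso_mem 0 hc

/-- The bijection equal to `f` on `(-∞, p]` and to `g` on `[p, ∞)`. -/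
noncomputable def glue (f g : ℝ ≃o ℝ) (p : ℝ) (h : f p = g p) : ℝ ≃o ℝ :=
  StrictMono.orderIsoOfSurjective (fun t : ℝ => if t ≤ p then f t else g t)
    (fun s t hst => by
      simp only
      split_ifs with h1 h2 h2
      · exact f.strictMono hst
      · exact (f.monotone h1).trans_lt (h ▸ g.strictMono (not_le.1 h2))
      · exact absurd (hst.le.trans h2) h1
      · exact g.strictMono hst)
    (fun y => by
      rcases le_or_gt y (f p) with hy | hy
      · refine ⟨f.symm y, ?_⟩
        have : f.symm y ≤ p := by rwa [OrderIso.symm_apply_le]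
        simp [this]
      · refine ⟨g.symm y, ?_⟩
        have : ¬ g.symm y ≤ p := by rwa [OrderIso.symm_apply_le, not_le, ← h]
        simp [this])

theorem glue_apply_of_le {f g : ℝ ≃o ℝ} {p : ℝ} (h : f p = g p) {t : ℝ} (ht : t ≤ p) :
    glue f g p h t = f t := if_pos ht

theorem glue_apply_of_ge {f g : ℝ ≃o ℝ} {p : ℝ} (h : f p = g p) {t : ℝ} (ht : p ≤ t) :
    glue f g p h t = g t := by
  rcases ht.eq_or_lt with rfl | ht
  · rw [glue_apply_of_le h le_rfl, h]
  · exact if_neg (not_le.2 ht)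

/-- A bijection that agrees near every point of each of two closed half-lines with an element of
`locPL` is in `locPL`. -/
theorem IsLocDyadicPL.of_local {f : ℝ ≃o ℝ}
    (h : ∀ t, (∃ g ∈ locPL, f =ᶠ[𝓝 t] g) ∨
      (IsDyadic t ∧ (∃ g ∈ locPL, f =ᶠ[𝓝[≥] t] g) ∧ ∃ g ∈ locPL, f =ᶠ[𝓝[≤] t] g)) :
    IsLocDyadicPL f := by
  intro t
  rcases h t with ⟨g, hg, h⟩ | ⟨ht, ⟨g, hg, h⟩, ⟨k, hk, h'⟩⟩
  · exact ⟨(hg t).1.congr (h.symm.filter_mono nhdsWithin_le_nhds),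
      (hg t).2.1.congr (h.symm.filter_mono nhdsWithin_le_nhds), fun ht => ((hg t).2.2 ht).congr h.symm⟩
  · exact ⟨(hg t).1.congr h.symm, (hk t).2.1.congr h'.symm, fun h => absurd ht h⟩

theorem glue_mem {f g : ℝ ≃o ℝ} {p : ℝ} (h : f p = g p) (hf : f ∈ locPL) (hg : g ∈ locPL)
    (hp : IsDyadic p) : glue f g p h ∈ locPL := by
  refine IsLocDyadicPL.of_local fun t => ?_
  rcases lt_trichotomy t p with ht | rfl | ht
  · refine Or.inl ⟨f, hf, ?_⟩
    filter_upwards [Iio_mem_nhds ht] with s hs using glue_apply_of_le h (le_of_lt hs)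
  · refine Or.inr ⟨hp, ⟨g, hg, ?_⟩, f, hf, ?_⟩
    · filter_upwards [self_mem_nhdsWithin] with s hs using glue_apply_of_ge h hs
    · filter_upwards [self_mem_nhdsWithin] with s hs using glue_apply_of_le h hs
  · refine Or.inl ⟨g, hg, ?_⟩
    filter_upwards [Ioi_mem_nhds ht] with s hs using glue_apply_of_ge h (le_of_lt hs)

/-- The map that is the identity on `(-∞, p]`, has slope `2` on `[p, p + L]`, and is the
translation by `L` on `[p + L, ∞)`. -/
noncomputable def stretch (p L : ℝ) (hL : 0 ≤ L) : ℝ ≃o ℝ :=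
  glue 1 (glue (affineIso 1 (-p)) (transl L) (p + L)
    (by simp [affineIso_apply, transl_apply]; ring)) p
    (by rw [glue_apply_of_le _ (by linarith)]; simp [affineIso_apply]; ring)

/-! ### The elementary maps -/

section stretch
variable {p L : ℝ} (hL : 0 ≤ L) {t : ℝ}

theorem stretch_of_le (ht : t ≤ p) : stretch p L hL t = t := by
  rw [stretch, glue_apply_of_le _ ht]; rfl

theorem stretch_of_mem (h1 : p ≤ t) (h2 : t ≤ p + L) : stretch p L hL t = 2 * t - p := by
  rw [stretch, glue_apply_of_ge _ h1, glue_apply_of_le _ h2, affineIso_apply]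
  simp; ring

theorem stretch_of_ge (ht : p + L ≤ t) : stretch p L hL t = t + L := by
  rw [stretch, glue_apply_of_ge _ (by linarith), glue_apply_of_ge _ ht, transl_apply]

theorem stretch_mem (hp : IsDyadic p) (hLd : IsDyadic L) : stretch p L hL ∈ locPL :=
  glue_mem _ (one_mem _) (glue_mem _ (affineIso_mem _ hp.neg) (transl_mem hLd) (hp.add hLd)) hp

theorem stretch_inv_of_ge (ht : p + 2 * L ≤ t) : (stretch p L hL)⁻¹ t = t - L := by
  have h := stretch_of_ge hL (p := p) (t := t - L) (by linarith)
  rw [sub_add_cancel] at h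
  rw [← h, RelIso.inv_apply_self, h]

theorem stretch_inv_of_le (ht : t ≤ p) : (stretch p L hL)⁻¹ t = t := by
  conv_lhs => rw [← stretch_of_le hL ht]
  rw [RelIso.inv_apply_self]

end stretch

/-! ### Transitivity -/

/-- Stretching the first unit interval by the factor two lengthens the image of `[0, n]` by one;
repeat this, and use inverses to shorten. -/
theorem exists_locPL_natCast_eq {n m : ℕ} (hn : 0 < n) (hm : 0 < m) :
    ∃ f ∈ locPL, f 0 = 0 ∧ f (n : ℝ) = m := by
  have key : ∀ n k : ℕ, 0 < n → ∃ f ∈ locPL, f 0 = 0 ∧ f (n : ℝ) = (n + k : ℕ) := by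
    intro n k hn
    induction k with
    | zero => exact ⟨1, one_mem _, rfl, by simp⟩
    | succ k ih =>
      obtain ⟨f, hf, h0, h1⟩ := ih
      refine ⟨stretch 0 1 zero_le_one * f,
        mul_mem (stretch_mem _ IsDyadic.zero IsDyadic.one) hf, ?_, ?_⟩
      · rw [RelIso.mul_apply, h0, stretch_of_le _ le_rfl]
      · rw [RelIso.mul_apply, h1, stretch_of_ge]
        · push_cast; ring
        · rw [zero_add]
          exact_mod_cast (by omega : 1 ≤ n + k)
  rcases le_total n m with h | h
  · obtain ⟨k, rfl⟩ := Nat.exists_eq_add_of_le h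
    exact key n k hn
  · obtain ⟨k, rfl⟩ := Nat.exists_eq_add_of_le h
    obtain ⟨f, hf, h0, h1⟩ := key m k hm
    refine ⟨f⁻¹, inv_mem hf, ?_, ?_⟩
    · conv_lhs => rw [← h0]
      rw [RelIso.inv_apply_self]
    · rw [← h1, RelIso.inv_apply_self]

/-- Any two dyadic intervals are related by a dyadic piecewise linear homeomorphism. -/
theorem exists_locPL_interval {p q p' q' : ℝ} (hp : IsDyadic p) (hq : IsDyadic q)
    (hp' : IsDyadic p') (hq' : IsDyadic q') (h : p < q) (h' : p' < q') :
    ∃ f ∈ locPL, f p = p' ∧ f q = q' := by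
  obtain ⟨N, hN⟩ := (hq.sub hp).exists_nat
  obtain ⟨M, hM⟩ := (hq'.sub hp').exists_nat
  -- With a common denominator `2 ^ k` the two lengths become `n` and `m` units, and the integral
  -- case is conjugated by the scaling `2 ^ k`.
  obtain ⟨n, hn⟩ := hN (max N M) (le_max_left _ _)
  obtain ⟨m, hm⟩ := hM (max N M) (le_max_right _ _)
  set k := max N M
  have h2 : (0 : ℝ) < 2 ^ k := by positivity
  have hn0 : 0 < n := by
    have : 0 < (n : ℝ) / 2 ^ k := by rw [← hn]; linarith
    have := (div_pos_iff_of_pos_right h2).1 this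
    exact_mod_cast this
  have hm0 : 0 < m := by
    have : 0 < (m : ℝ) / 2 ^ k := by rw [← hm]; linarith
    have := (div_pos_iff_of_pos_right h2).1 this
    exact_mod_cast this
  lift n to ℕ using hn0.le
  lift m to ℕ using hm0.le
  obtain ⟨f, hf, h0, h1⟩ := exists_locPL_natCast_eq (n := n) (m := m) (by exact_mod_cast hn0)
    (by exact_mod_cast hm0)
  have hmul : ∀ t, affineIso k 0 t = 2 ^ k * t := fun t => by simp [affineIso_apply]
  refine ⟨transl p' * (affineIso k 0)⁻¹ * f * affineIso k 0 * transl (-p), ?_, ?_, ?_⟩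
  · exact mul_mem (mul_mem (mul_mem (mul_mem (transl_mem hp')
      (inv_mem (affineIso_mem _ IsDyadic.zero))) hf) (affineIso_mem _ IsDyadic.zero))
      (transl_mem hp.neg)
  · have : (affineIso k 0)⁻¹ 0 = 0 := by
      have h3 : affineIso k 0 0 = 0 := by simp [hmul]
      conv_lhs => arg 2; rw [← h3]
      rw [RelIso.inv_apply_self]
    simp [RelIso.mul_apply, transl_apply, hmul, h0, this]
  · have h3 : affineIso k 0 (q - p) = n := by rw [hmul, hn]; push_cast; field_simp
    have h4 : (affineIso k 0)⁻¹ (m : ℝ) = q' - p' := by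
      have h5 : affineIso k 0 (q' - p') = m := by rw [hmul, hm]; push_cast; field_simp
      rw [← h5, RelIso.inv_apply_self]
    simp only [RelIso.mul_apply, transl_apply, ← sub_eq_add_neg, h3, h1, h4]
    ring

/-- The subgroup of `locPL` of maps supported in `(a, b)`. -/
def suppPL (a b : ℝ) : Subgroup (ℝ ≃o ℝ) where
  carrier := {f | f ∈ locPL ∧ ∀ t, t ∉ Set.Ioo a b → f t = t}
  one_mem' := ⟨one_mem _, fun _ _ => rfl⟩
  mul_mem' := fun hf hg => ⟨mul_mem hf.1 hg.1, fun t ht => by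
    rw [RelIso.mul_apply, hg.2 t ht, hf.2 t ht]⟩
  inv_mem' := fun {f} hf => ⟨inv_mem hf.1, fun t ht => by
    conv_lhs => rw [← hf.2 t ht]
    rw [RelIso.inv_apply_self]⟩

theorem suppPL_mono {a b a' b' : ℝ} (ha : a' ≤ a) (hb : b ≤ b') : suppPL a b ≤ suppPL a' b' :=
  fun _ hf => ⟨hf.1, fun t ht => hf.2 t fun h => ht ⟨ha.trans_lt h.1, h.2.trans_le hb⟩⟩

theorem suppPL_apply_mem {a b : ℝ} {f : ℝ ≃o ℝ} (hf : f ∈ suppPL a b) {t : ℝ}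
    (ht : t ∈ Set.Ioo a b) : f t ∈ Set.Ioo a b := by
  constructor
  · rw [← hf.2 a (by simp)]; exact f.strictMono ht.1
  · rw [← hf.2 b (by simp)]; exact f.strictMono ht.2

/-- A map fixing two dyadic points may be replaced by the identity outside them; the new breakpoints
are dyadic. -/
theorem exists_glue_suppPL {a b : ℝ} (ha : IsDyadic a) (hb : IsDyadic b) (hab : a ≤ b) {f : ℝ ≃o ℝ}
    (hf : f ∈ locPL) (hfa : f a = a) (hfb : f b = b) :
    ∃ g ∈ suppPL a b, ∀ t ∈ Set.Icc a b, g t = f t := by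
  have hfb : f b = (1 : ℝ ≃o ℝ) b := hfb
  have h1 : (1 : ℝ ≃o ℝ) a = glue f 1 b hfb a := by
    rw [glue_apply_of_le hfb hab, hfa]; rfl
  refine ⟨glue 1 (glue f 1 b hfb) a h1, ⟨?_, ?_⟩, ?_⟩
  · exact glue_mem _ (one_mem _) (glue_mem _ hf (one_mem _) hb) ha
  · intro t ht
    rcases le_or_gt t a with h | h
    · rw [glue_apply_of_le _ h]; rfl
    · have : b ≤ t := by
        by_contra h2
        exact ht ⟨h, not_le.1 h2⟩
      rw [glue_apply_of_ge _ h.le, glue_apply_of_ge _ this]; rfl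
  · intro t ht
    rw [glue_apply_of_ge _ ht.1, glue_apply_of_le _ ht.2]

theorem exists_suppPL_apply_eq {a b u u' : ℝ} (ha : IsDyadic a) (hb : IsDyadic b)
    (hu : IsDyadic u) (hu' : IsDyadic u') (h : u ∈ Set.Ioo a b) (h' : u' ∈ Set.Ioo a b) :
    ∃ f ∈ suppPL a b, f u = u' := by
  obtain ⟨f, hf, hfa, hfu⟩ := exists_locPL_interval ha hu ha hu' h.1 h'.1
  obtain ⟨g, hg, hgu, hgb⟩ := exists_locPL_interval hu hb hu' hb h.2 h'.2
  have hfg : f u = g u := hfu.trans hgu.symm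
  obtain ⟨k, hk, hkt⟩ := exists_glue_suppPL ha hb (h.1.trans h.2).le (glue_mem hfg hf hg hu)
    (by rw [glue_apply_of_le hfg h.1.le, hfa]) (by rw [glue_apply_of_ge hfg h.2.le, hgb])
  exact ⟨k, hk, by rw [hkt u ⟨h.1.le, h.2.le⟩, glue_apply_of_le hfg le_rfl, hfu]⟩

theorem exists_suppPL_apply_eq₂ {a b u v u' v' : ℝ} (ha : IsDyadic a) (hb : IsDyadic b)
    (hu : IsDyadic u) (hu' : IsDyadic u') (hv : IsDyadic v) (hv' : IsDyadic v')
    (h1 : a < u) (h2 : u < v) (h3 : v < b) (h1' : a < u') (h2' : u' < v') (h3' : v' < b) :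
    ∃ f ∈ suppPL a b, f u = u' ∧ f v = v' := by
  obtain ⟨f, hf, hfu⟩ := exists_suppPL_apply_eq ha hb hu hu' ⟨h1, h2.trans h3⟩ ⟨h1', h2'.trans h3'⟩
  have hfv : f v ∈ Set.Ioo u' b :=
    ⟨hfu ▸ f.strictMono h2, (suppPL_apply_mem hf ⟨h1.trans h2, h3⟩).2⟩
  obtain ⟨g, hg, hgv⟩ := exists_suppPL_apply_eq hu' hb ((isDyadic_locPL hf.1).2 hv) hv' hfv
    ⟨h2', h3'⟩
  refine ⟨g * f, mul_mem (suppPL_mono h1'.le le_rfl hg) hf, ?_, hgv⟩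
  rw [RelIso.mul_apply, hfu, hg.2 u' (by simp)]

/-! ### Perfectness of the group of compactly supported maps -/

/-- Induction along the affine pieces of a dyadic piecewise linear map. -/
theorem locPL_induction {f : ℝ ≃o ℝ} (hf : f ∈ locPL) {a b : ℝ} (ha : IsDyadic a) (hb : IsDyadic b)
    (hab : a ≤ b) {Q : ℝ → Prop} (h0 : Q a)
    (step : ∀ s s', IsDyadic s → IsDyadic s' → a ≤ s → s < s' →
      (∃ (m : ℤ) (β : ℝ), IsDyadic β ∧ ∀ t ∈ Set.Icc s s', f t = (2 : ℝ) ^ m * t + β) → Q s → Q s') :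
    Q b := by
  by_contra hQb
  -- The set of points lying below some good dyadic point. Its supremum `c` belongs to it: a good
  -- point just below `c` leads by one affine piece to `c` itself when `c` is dyadic, and beyond `c`
  -- otherwise, because then `c` is not a breakpoint. A good point `s ≥ c` other than `b` could be
  -- passed by the affine piece on its right, which is absurd.
  set A : Set ℝ := {t | ∃ s, t ≤ s ∧ a ≤ s ∧ s ≤ b ∧ IsDyadic s ∧ Q s} with hA
  have hbdd : BddAbove A := ⟨b, fun t ⟨s, h1, _, h2, _⟩ => h1.trans h2⟩
  have haA : a ∈ A := ⟨a, le_rfl, le_rfl, hab, ha, h0⟩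
  set c := sSup A
  have hac : a ≤ c := le_csSup hbdd haA
  have hcb : c ≤ b := csSup_le ⟨a, haA⟩ fun t ⟨s, h1, _, h2, _⟩ => h1.trans h2
  have hcA : c ∈ A := by
    by_contra hcA
    by_cases hcd : IsDyadic c
    · obtain ⟨m, β, hβ, h⟩ := (hf c).2.1
      obtain ⟨l, hl, hlc⟩ := (mem_nhdsLE_iff_exists_Ioc_subset' (sub_one_lt c)).1 h
      obtain ⟨t, ht, hlt⟩ := exists_lt_of_lt_csSup ⟨a, haA⟩ (show l < sSup A from hl)
      obtain ⟨s, hts, has, hsb, hsd, hsQ⟩ := ht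
      have hsc : s < c := by
        by_contra h2
        exact hcA ⟨s, not_lt.1 h2, has, hsb, hsd, hsQ⟩
      exact hcA ⟨c, le_rfl, hac, hcb, hcd, step s c hsd hcd has hsc
        ⟨m, β, hβ, fun r hr => hlc ⟨(hlt.trans_le hts).trans_le hr.1, hr.2⟩⟩ hsQ⟩
    · obtain ⟨m, β, hβ, h⟩ := (hf c).2.2 hcd
      obtain ⟨l, u, ⟨hl, hu⟩, hlu⟩ := mem_nhds_iff_exists_Ioo_subset.1 h
      obtain ⟨t, ht, hlt⟩ := exists_lt_of_lt_csSup ⟨a, haA⟩ (show l < sSup A from hl)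
      obtain ⟨s, hts, has, hsb, hsd, hsQ⟩ := ht
      have hsc : s < c := by
        by_contra h2
        exact hcA ⟨s, not_lt.1 h2, has, hsb, hsd, hsQ⟩
      have hcb' : c < b := lt_of_le_of_ne hcb fun h2 => hcd (h2 ▸ hb)
      obtain ⟨s', hs'd, hcs', hs'⟩ := exists_isDyadic_between (lt_min hu hcb')
      exact hcA ⟨s', hcs'.le, hac.trans hcs'.le, (hs'.trans_le (min_le_right _ _)).le, hs'd,
        step s s' hsd hs'd has (hsc.trans hcs') ⟨m, β, hβ, fun r hr =>
          hlu ⟨(hlt.trans_le hts).trans_le hr.1, hr.2.trans_lt (hs'.trans_le (min_le_left _ _))⟩⟩ hsQ⟩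
  obtain ⟨s, hcs, has, hsb, hsd, hsQ⟩ := hcA
  have hsb' : s < b := lt_of_le_of_ne hsb fun h => hQb (h ▸ hsQ)
  obtain ⟨m, β, hβ, h⟩ := (hf s).1
  obtain ⟨u, hu, hsu⟩ := (mem_nhdsGE_iff_exists_Ico_subset' (lt_add_one s)).1 h
  obtain ⟨s', hs'd, hss', hs'⟩ := exists_isDyadic_between (lt_min hu hsb')
  have : s' ∈ A := ⟨s', le_rfl, has.trans hss'.le, (hs'.trans_le (min_le_right _ _)).le, hs'd,
    step s s' hsd hs'd has hss' ⟨m, β, hβ, fun r hr =>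
      hsu ⟨hr.1, hr.2.trans_lt (hs'.trans_le (min_le_left _ _))⟩⟩ hsQ⟩
  exact absurd (le_csSup hbdd this) (not_le.2 (hcs.trans_lt hss'))

/-- Stretching a long interval amounts to stretching its adjacent parts, the right one first so that
the left one has not moved it. Hence elementary maps of a coarse scale are words in those of every
finer scale. -/
theorem stretch_add {p L L' : ℝ} (hL : 0 ≤ L) (hL' : 0 ≤ L') :
    stretch p (L + L') (add_nonneg hL hL') = stretch p L hL * stretch (p + L) L' hL' := by
  ext t
  rw [RelIso.mul_apply]
  rcases le_total t (p + L) with h | h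
  · rw [stretch_of_le hL' h]
    rcases le_total t p with h2 | h2
    · rw [stretch_of_le _ h2, stretch_of_le _ h2]
    · rw [stretch_of_mem _ h2 (by linarith), stretch_of_mem _ h2 h]
  · rcases le_total t (p + L + L') with h2 | h2
    · rw [stretch_of_mem hL' h h2, stretch_of_mem _ (by linarith) (by linarith),
        stretch_of_ge _ (by linarith)]
      ring
    · rw [stretch_of_ge hL' h2, stretch_of_ge _ (by linarith), stretch_of_ge _ (by linarith)]
      ring

theorem inv_two_pow_nonneg (k : ℕ) : (0 : ℝ) ≤ ((2 : ℝ) ^ k)⁻¹ := by positivity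

/-- The group generated by the elementary maps at scale `2 ^ (-k)`. -/
noncomputable def stretchWords (k : ℕ) : Subgroup (ℝ ≃o ℝ) :=
  Subgroup.closure (Set.range fun j : ℤ =>
    stretch (j * ((2 : ℝ) ^ k)⁻¹) ((2 : ℝ) ^ k)⁻¹ (inv_two_pow_nonneg k))

/-- The maps generated by elementary maps at all sufficiently small scales. -/
def smallWords : Subgroup (ℝ ≃o ℝ) where
  carrier := {f | ∀ᶠ k in atTop, f ∈ stretchWords k}
  one_mem' := Eventually.of_forall fun _ => one_mem _
  mul_mem' := fun hf hg => by filter_upwards [hf, hg] with k h1 h2 using mul_mem h1 h2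
  inv_mem' := fun hf => by filter_upwards [hf] with k h1 using inv_mem h1

theorem stretch_mem_smallWords {p L : ℝ} (hL : 0 ≤ L) (hp : IsDyadic p) (hLd : IsDyadic L) :
    stretch p L hL ∈ smallWords := by
  obtain ⟨N, hN⟩ := hp.exists_nat
  obtain ⟨M, hM⟩ := hLd.exists_nat
  filter_upwards [eventually_ge_atTop N, eventually_ge_atTop M] with k h1 h2
  obtain ⟨i, hi⟩ := hN k h1
  obtain ⟨n, hn⟩ := hM k h2
  have hn0 : 0 ≤ n := by
    rw [hn] at hL
    have : (0 : ℝ) ≤ n := by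
      by_contra h
      exact absurd hL (not_le.2 (div_neg_of_neg_of_pos (not_le.1 h) (by positivity)))
    exact_mod_cast this
  lift n to ℕ using hn0
  rw [div_eq_mul_inv] at hi hn
  clear hp hLd hM hN
  induction n generalizing p i L with
  | zero =>
    have : stretch p L hL = 1 := by
      ext t
      have hL0 : L = 0 := by simpa using hn
      rcases le_total t p with h | h
      · rw [stretch_of_le _ h]; rfl
      · rw [stretch_of_ge _ (by linarith), hL0, add_zero]; rfl
    rw [this]
    exact one_mem _
  | succ n ih =>
    have hL' : (0 : ℝ) ≤ ((n : ℕ) : ℤ) * ((2 : ℝ) ^ k)⁻¹ := by positivity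
    have h3 := stretch_add (p := p) (inv_two_pow_nonneg k) hL'
    have h4 : L = ((2 : ℝ) ^ k)⁻¹ + ((n : ℕ) : ℤ) * ((2 : ℝ) ^ k)⁻¹ := by
      rw [hn]; push_cast; ring
    subst h4
    rw [h3]
    refine mul_mem (Subgroup.subset_closure ⟨i, by simp only [hi]⟩) (ih hL' (i + 1) ?_ rfl)
    rw [hi]; push_cast; ring

/-- Doubling is iterated: after `n` steps `[p, p + L]` has become an interval of length `2 ^ n * L`,
which is stretched next. Negative exponents are obtained from inverses, starting from the shorter
interval. -/
theorem exists_smallWords_slope (m : ℤ) {p L : ℝ} (hp : IsDyadic p) (hL : IsDyadic L)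
    (h : 0 ≤ L) : ∃ u ∈ smallWords, (∀ t ≤ p, u t = t) ∧
      (∀ t ∈ Set.Icc p (p + L), u t = (2 : ℝ) ^ m * (t - p) + p) ∧
      (∀ t, p + L ≤ t → u t = t - L + (2 : ℝ) ^ m * L) := by
  have key : ∀ n : ℕ, ∀ L, IsDyadic L → 0 ≤ L → ∃ u ∈ smallWords, (∀ t ≤ p, u t = t) ∧
      (∀ t ∈ Set.Icc p (p + L), u t = (2 : ℝ) ^ n * (t - p) + p) ∧
      (∀ t, p + L ≤ t → u t = t - L + (2 : ℝ) ^ n * L) := by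
    intro n L hL h
    induction n with
    | zero =>
      exact ⟨1, one_mem _, fun _ _ => rfl, fun t _ => by simp, fun t _ => by simp⟩
    | succ n ih =>
      obtain ⟨u, hu, h1, h2, h3⟩ := ih
      have hnL : IsDyadic ((2 : ℝ) ^ n * L) := by simpa using hL.zpow_mul n
      have hn0 : (0 : ℝ) ≤ (2 : ℝ) ^ n * L := by positivity
      have h2n : (0 : ℝ) < (2 : ℝ) ^ n := by positivity
      refine ⟨stretch p _ hn0 * u, mul_mem (stretch_mem_smallWords _ hp hnL) hu, fun t ht => ?_,
        fun t ht => ?_, fun t ht => ?_⟩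
      · rw [RelIso.mul_apply, h1 t ht, stretch_of_le _ ht]
      · rw [RelIso.mul_apply, h2 t ht, stretch_of_mem _ (by nlinarith [ht.1]) (by nlinarith [ht.2])]
        ring
      · rw [RelIso.mul_apply, h3 t ht, stretch_of_ge _ (by linarith)]
        ring
  obtain ⟨n, rfl | rfl⟩ := m.eq_nat_or_neg
  · simpa using key n L hL h
  · have hL' : IsDyadic ((2 : ℝ) ^ (-(n : ℤ)) * L) := hL.zpow_mul _
    have h2n : (0 : ℝ) < (2 : ℝ) ^ n := by positivity
    have hinv : (2 : ℝ) ^ (-(n : ℤ)) = ((2 : ℝ) ^ n)⁻¹ := by simp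
    rw [hinv] at hL' ⊢
    obtain ⟨u, hu, h1, h2, h3⟩ := key n _ hL' (by positivity)
    have hinv2 : ∀ s t, u s = t → u⁻¹ t = s := fun s t hst => by
      rw [← hst, RelIso.inv_apply_self]
    refine ⟨u⁻¹, inv_mem hu, fun t ht => hinv2 _ _ (h1 t ht), fun t ht => hinv2 _ _ ?_,
      fun t ht => hinv2 _ _ ?_⟩
    · rw [h2]
      · field_simp; ring
      · have h5 : 0 ≤ ((2 : ℝ) ^ n)⁻¹ := by positivity
        constructor
        · nlinarith [ht.1]
        · nlinarith [ht.2]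
    · rw [h3 _ (by linarith)]
      field_simp; ring

/-- A compactly supported map is built up piece by piece from the left, by words that follow it up
to a point and continue as a translation. All words have to live at one common scale, because the
comparison modulo commutators in `exists_zpow_of_mem_stretchWords` is made scale by scale. -/
theorem suppPL_le_smallWords {a b : ℝ} (ha : IsDyadic a) (hb : IsDyadic b) :
    suppPL a b ≤ smallWords := by
  intro f hf
  rcases le_or_gt b a with hab | hab
  · have : f = 1 := by
      ext t
      exact hf.2 t (by simp [Set.Ioo_eq_empty (not_lt.2 hab)])
    rw [this]
    exact one_mem _
  have key : ∃ u ∈ smallWords, (∀ t ≤ b, u t = f t) ∧ ∀ t, b ≤ t → u t = t - b + f b := by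
    refine locPL_induction hf.1 ha hb hab.le
      (Q := fun s => ∃ u ∈ smallWords, (∀ t ≤ s, u t = f t) ∧ ∀ t, s ≤ t → u t = t - s + f s)
      ⟨1, one_mem _, fun t ht => ?_, fun t ht => ?_⟩ ?_
    · exact (hf.2 t fun h => absurd h.1 (not_lt.2 ht)).symm
    · rw [hf.2 a (by simp)]
      simp
    -- Beyond `s` the word `u` has slope one, so composing with a map of slope `2 ^ m` based at `f
    -- s` produces the next piece without disturbing the earlier ones.
    · rintro s s' hs hs' - hss' ⟨m, β, hβ, h⟩ ⟨u, hu, h1, h2⟩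
      obtain ⟨w, hw, hw1, hw2, hw3⟩ := exists_smallWords_slope m ((isDyadic_locPL hf.1).2 hs)
        (hs'.sub hs) (sub_nonneg.2 hss'.le)
      have hfs := h s ⟨le_rfl, hss'.le⟩
      have hfs' := h s' ⟨hss'.le, le_rfl⟩
      refine ⟨w * u, mul_mem hw hu, fun t ht => ?_, fun t ht => ?_⟩
      · rw [RelIso.mul_apply]
        rcases le_total t s with hts | hts
        · rw [h1 t hts, hw1 _ (f.monotone hts)]
        · rw [h2 t hts, hw2 _ ⟨by linarith, by linarith⟩, h t ⟨hts, ht⟩, hfs]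
          ring
      · rw [RelIso.mul_apply, h2 t (by linarith), hw3 _ (by linarith), hfs', hfs]
        ring
  obtain ⟨u, hu, h1, h2⟩ := key
  have : f = u := by
    ext t
    rcases le_total t b with h | h
    · exact (h1 t h).symm
    · rw [h2 t h, hf.2 b (by simp), hf.2 t fun h' => absurd h'.2 (not_lt.2 h)]
      ring
  rwa [this]

theorem conj_mem_suppPL {g h : ℝ ≃o ℝ} (hg : g ∈ locPL) {p q : ℝ} (hh : h ∈ suppPL p q) :
    g * h * g⁻¹ ∈ suppPL (g p) (g q) := by
  refine ⟨mul_mem (mul_mem hg hh.1) (inv_mem hg), fun t ht => ?_⟩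
  rw [RelIso.mul_apply, RelIso.mul_apply, hh.2, RelIso.apply_inv_self]
  intro h
  refine ht ⟨?_, ?_⟩
  · rw [← RelIso.apply_inv_self g t]; exact g.strictMono h.1
  · rw [← RelIso.apply_inv_self g t]; exact g.strictMono h.2

/-- The map `w` fixes the interval pointwise, hence preserves its complement, where `h` is trivial.
-/
theorem commute_of_fixes {w h : ℝ ≃o ℝ} {a b : ℝ} (hw : ∀ t ∈ Set.Ioo a b, w t = t)
    (hh : h ∈ suppPL a b) : w * h = h * w := by
  ext t
  rw [RelIso.mul_apply, RelIso.mul_apply]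
  by_cases ht : t ∈ Set.Ioo a b
  · rw [hw t ht, hw _ (suppPL_apply_mem hh ht)]
  · rw [hh.2 t ht, hh.2]
    intro h1
    have h2 := w.injective (hw _ h1)
    rw [h2] at h1
    exact ht h1

/-- The group of compactly supported dyadic piecewise linear maps. -/
def cptPL : Subgroup (ℝ ≃o ℝ) where
  carrier := {f | ∃ K : ℕ, f ∈ suppPL (-K) K}
  one_mem' := ⟨0, one_mem _⟩
  mul_mem' := by
    rintro f g ⟨K, hK⟩ ⟨M, hM⟩
    have h1 : (K : ℝ) ≤ (max K M : ℕ) := by exact_mod_cast le_max_left _ _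
    have h2 : (M : ℝ) ≤ (max K M : ℕ) := by exact_mod_cast le_max_right _ _
    exact ⟨max K M, mul_mem (suppPL_mono (neg_le_neg h1) h1 hK) (suppPL_mono (neg_le_neg h2) h2 hM)⟩
  inv_mem' := fun ⟨K, hK⟩ => ⟨K, inv_mem hK⟩

theorem suppPL_le_cptPL (a b : ℝ) : suppPL a b ≤ cptPL := by
  intro f hf
  obtain ⟨K, hK⟩ := exists_nat_ge (max |a| |b|)
  refine ⟨K, suppPL_mono ?_ ?_ hf⟩
  · linarith [neg_abs_le a, le_max_left |a| |b|]
  · linarith [le_abs_self b, le_max_right |a| |b|]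

/-- Take `M` beyond `K` and beyond the images of `±K`. The gaps between these images and `±M` are
filled by transitivity on dyadic intervals. -/
theorem exists_cptPL_eqOn {g : ℝ ≃o ℝ} (hg : g ∈ locPL) (K : ℕ) :
    ∃ k ∈ cptPL, ∀ t ∈ Set.Icc (-K : ℝ) K, k t = g t := by
  obtain ⟨M, hM⟩ := exists_nat_gt (max (K : ℝ) (max |g (-K)| |g K|))
  have h1 : (K : ℝ) < M := (le_max_left _ _).trans_lt hM
  have h2 : |g (-K)| < M := ((le_max_left _ _).trans (le_max_right _ _)).trans_lt hM
  have h3 : |g K| < M := ((le_max_right _ _).trans (le_max_right _ _)).trans_lt hM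
  rw [abs_lt] at h2 h3
  have hKd : IsDyadic (K : ℝ) := by simpa using IsDyadic.intCast K
  have hMd : IsDyadic (M : ℝ) := by simpa using IsDyadic.intCast M
  have hK0 : -(K : ℝ) ≤ K := by linarith [K.cast_nonneg (α := ℝ)]
  obtain ⟨f1, hf1, h4, h5⟩ := exists_locPL_interval hMd.neg hKd.neg hMd.neg
    ((isDyadic_locPL hg).2 hKd.neg) (by linarith) h2.1
  obtain ⟨f2, hf2, h6, h7⟩ := exists_locPL_interval hKd hMd
    ((isDyadic_locPL hg).2 hKd) hMd (by linarith) h3.2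
  have h8 : f1 (-K) = glue g f2 K h6.symm (-K) := by
    rw [glue_apply_of_le _ hK0, h5]
  obtain ⟨k, hk, hkt⟩ := exists_glue_suppPL hMd.neg hMd (by linarith)
    (glue_mem h8 hf1 (glue_mem h6.symm hg hf2 hKd) hKd.neg)
    (by rw [glue_apply_of_le _ (by linarith), h4])
    (by rw [glue_apply_of_ge _ (by linarith), glue_apply_of_ge _ (by linarith), h7])
  refine ⟨k, ⟨M, hk⟩, fun t ht => ?_⟩
  rw [hkt t ⟨by linarith [ht.1], by linarith [ht.2]⟩, glue_apply_of_ge _ ht.1,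
    glue_apply_of_le _ ht.2]

/-- The commutator subgroup of `cptPL`. -/
def cptComm : Subgroup (ℝ ≃o ℝ) := ⁅cptPL, cptPL⁆

theorem cptComm_le : cptComm ≤ cptPL :=
  Subgroup.commutator_le.2 fun _ h _ h' =>
    mul_mem (mul_mem (mul_mem h h') (inv_mem h)) (inv_mem h')

/-- Compactly supported maps are central modulo their commutators. -/
theorem comm_mem_cptComm {g h : ℝ ≃o ℝ} (hg : g ∈ locPL) (hh : h ∈ cptPL) :
    g * h * g⁻¹ * h⁻¹ ∈ cptComm := by
  have hh' := hh
  obtain ⟨K, hK⟩ := hh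
  obtain ⟨k, hk, hkt⟩ := exists_cptPL_eqOn hg K
  -- The cut-off `k` agrees with `g` on the support of `h`, so both conjugate `h` in the same way.
  have h1 := commute_of_fixes (w := k⁻¹ * g) (h := h) (a := -K) (b := K) (fun t ht => by
    rw [RelIso.mul_apply, ← hkt t ⟨ht.1.le, ht.2.le⟩, RelIso.inv_apply_self]) hK
  have h2 : g * h * g⁻¹ * h⁻¹ = ⁅k, h⁆ := by
    have h3 : g * h * g⁻¹ = k * h * k⁻¹ := by
      calc g * h * g⁻¹ = k * (k⁻¹ * g * h) * g⁻¹ := by group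
        _ = k * (h * (k⁻¹ * g)) * g⁻¹ := by rw [h1]
        _ = k * h * k⁻¹ := by group
    rw [h3, commutatorElement_def]
  rw [h2]
  exact Subgroup.commutator_mem_commutator hk hh'

theorem conj_mem_cptComm {g h : ℝ ≃o ℝ} (hg : g ∈ locPL) (hh : h ∈ cptComm) :
    g * h * g⁻¹ ∈ cptComm := by
  have := mul_mem (comm_mem_cptComm hg (cptComm_le hh)) hh
  rwa [inv_mul_cancel_right] at this

theorem transl_conj_stretch {p c L : ℝ} (hL : 0 ≤ L) :
    transl c * stretch p L hL * (transl c)⁻¹ = stretch (p + c) L hL := by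
  ext t
  rw [RelIso.mul_apply, RelIso.mul_apply, transl_inv_apply, transl_apply]
  rcases le_total (t - c) p with h | h
  · rw [stretch_of_le _ h, stretch_of_le _ (by linarith)]; ring
  · rcases le_total (t - c) (p + L) with h' | h'
    · rw [stretch_of_mem _ h h', stretch_of_mem _ (by linarith) (by linarith)]; ring
    · rw [stretch_of_ge _ h', stretch_of_ge _ (by linarith)]; ring

/-- The relation of Thompson's group `F` between the elementary maps. -/
theorem stretch_conj_stretch {p L : ℝ} (hL : 0 ≤ L) :
    stretch p L hL * stretch (p + L) L hL * (stretch p L hL)⁻¹ = stretch (p + L + L) L hL := by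
  rw [mul_inv_eq_iff_eq_mul]
  ext t
  rw [RelIso.mul_apply, RelIso.mul_apply]
  rcases le_total t (p + L) with h | h
  · rw [stretch_of_le _ h]
    rw [stretch_of_le (p := p + L + L)]
    rcases le_total t p with h' | h'
    · rw [stretch_of_le _ h']; linarith
    · rw [stretch_of_mem _ h' h]; linarith
  · rw [stretch_of_ge (p := p) _ h]
    rcases le_total t (p + L + L) with h' | h'
    · rw [stretch_of_mem _ h h', stretch_of_ge _ (by linarith),
        stretch_of_mem _ (by linarith) (by linarith)]
      ring
    · rw [stretch_of_ge _ h', stretch_of_ge _ (by linarith), stretch_of_ge _ (by linarith)]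

/-- Both factors are the same translation near `+∞`, so `e = x₀ x₁⁻¹` is compactly supported and
conjugation does not change it modulo `cptComm`. Translating by `L` turns `e` into `x₁ x₂⁻¹`. By the
relation `x₀ x₁ x₀⁻¹ = x₂`, the latter is also the commutator of `x₁` with `e`. So `e` is congruent
to a trivial element. -/
theorem stretch_mul_inv_mem_cptComm {p L : ℝ} (hL : 0 ≤ L) (hp : IsDyadic p) (hLd : IsDyadic L) :
    stretch p L hL * (stretch (p + L) L hL)⁻¹ ∈ cptComm := by
  set x₀ := stretch p L hL
  set x₁ := stretch (p + L) L hL with hx₁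
  set x₂ := stretch (p + L + L) L hL with hx₂
  have hx₀m : x₀ ∈ locPL := stretch_mem hL hp hLd
  have hx₁m : x₁ ∈ locPL := stretch_mem hL (hp.add hLd) hLd
  have he : x₀ * x₁⁻¹ ∈ cptPL := by
    refine suppPL_le_cptPL p (p + L + 2 * L) ⟨mul_mem hx₀m (inv_mem hx₁m), fun t ht => ?_⟩
    rw [RelIso.mul_apply]
    rcases le_or_gt t p with h | h
    · rw [stretch_inv_of_le _ (by linarith), stretch_of_le _ h]
    · have h' : p + L + 2 * L ≤ t := by
        by_contra h2
        exact ht ⟨h, not_le.1 h2⟩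
      rw [stretch_inv_of_ge _ h', stretch_of_ge _ (by linarith)]
      ring
  have h1 := comm_mem_cptComm hx₁m he
  have h2 := comm_mem_cptComm (transl_mem hLd) he
  have h3 : transl L * (x₀ * x₁⁻¹) * (transl L)⁻¹ = x₁ * x₂⁻¹ := by
    have e1 : transl L * x₀ * (transl L)⁻¹ = x₁ := transl_conj_stretch hL
    have e2 : transl L * x₁ * (transl L)⁻¹ = x₂ := transl_conj_stretch hL
    rw [← e2]
    nth_rw 2 [← e1]
    group
  have h4 : x₁ * x₂⁻¹ = x₁ * (x₀ * x₁⁻¹) * x₁⁻¹ * (x₀ * x₁⁻¹)⁻¹ := by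
    have e3 : x₀ * x₁ * x₀⁻¹ = x₂ := stretch_conj_stretch hL
    rw [← e3]
    group
  rw [h3] at h2
  rw [← h4] at h1
  have := mul_mem (inv_mem h2) h1
  simpa [mul_assoc] using this

theorem stretch_mul_inv_mem_cptComm' {p L : ℝ} (hL : 0 ≤ L) (hp : IsDyadic p) (hLd : IsDyadic L)
    (j : ℤ) : stretch (p + j * L) L hL * (stretch p L hL)⁻¹ ∈ cptComm := by
  have hd : ∀ j : ℤ, IsDyadic (p + j * L) := fun j => hp.add ((IsDyadic.intCast j).mul hLd)
  induction j using Int.induction_on with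
  | zero => simp [one_mem]
  | succ i ih =>
    have := mul_mem (inv_mem (stretch_mul_inv_mem_cptComm hL (hd i) hLd)) ih
    have h : p + ((i : ℤ) : ℝ) * L + L = p + ((i : ℤ) + 1 : ℤ) * L := by push_cast; ring
    rw [h] at this
    simpa [mul_assoc] using this
  | pred i ih =>
    have := mul_mem (stretch_mul_inv_mem_cptComm hL (hd (-(i : ℤ) - 1)) hLd) ih
    have h : p + ((-(i : ℤ) - 1 : ℤ) : ℝ) * L + L = p + (-(i : ℤ) : ℤ) * L := by push_cast; ring
    rw [h] at this
    simpa [mul_assoc] using this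

/-- Modulo `cptComm` all generators of this scale equal the one based at `0`, so a word becomes a
power of it. Each generator translates by the scale near `+∞`, hence the germ at `+∞` records the
exponent. -/
theorem exists_zpow_of_mem_stretchWords {k : ℕ} {f : ℝ ≃o ℝ} (hf : f ∈ stretchWords k) :
    ∃ n : ℤ, f * (stretch 0 ((2 : ℝ) ^ k)⁻¹ (inv_two_pow_nonneg k) ^ n)⁻¹ ∈ cptComm ∧
      ∀ᶠ t in atTop, f t = t + n * ((2 : ℝ) ^ k)⁻¹ := by
  set δ := ((2 : ℝ) ^ k)⁻¹ with hδ
  set x := stretch 0 δ (inv_two_pow_nonneg k) with hx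
  have hxm : ∀ n : ℤ, x ^ n ∈ locPL := fun n =>
    zpow_mem (stretch_mem _ IsDyadic.zero (IsDyadic.inv_two_pow k)) n
  induction hf using Subgroup.closure_induction with
  | mem f hf =>
    obtain ⟨j, rfl⟩ := hf
    refine ⟨1, ?_, ?_⟩
    · have := stretch_mul_inv_mem_cptComm' (inv_two_pow_nonneg k) IsDyadic.zero
        (IsDyadic.inv_two_pow k) j
      simpa using this
    · filter_upwards [eventually_ge_atTop (j * δ + δ)] with t ht
      rw [stretch_of_ge _ ht]
      simp [hδ]
  | one => exact ⟨0, by simp [one_mem], Eventually.of_forall fun t => by simp⟩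
  | mul f g _ _ ihf ihg =>
    obtain ⟨n, h1, h2⟩ := ihf
    obtain ⟨m, h3, h4⟩ := ihg
    refine ⟨n + m, ?_, ?_⟩
    · have := mul_mem h1 (conj_mem_cptComm (hxm n) h3)
      have h5 : f * g * (x ^ (n + m))⁻¹ = f * (x ^ n)⁻¹ * (x ^ n * (g * (x ^ m)⁻¹) * (x ^ n)⁻¹) := by
        group
      rwa [h5]
    · filter_upwards [h4, (g.tendsto_atTop).eventually h2] with t h5 h6
      rw [RelIso.mul_apply, h6, h5]
      push_cast; ring
  | inv f _ ih =>
    obtain ⟨n, h1, h2⟩ := ih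
    refine ⟨-n, ?_, ?_⟩
    · have := conj_mem_cptComm (hxm (-n)) (inv_mem h1)
      have h5 : f⁻¹ * (x ^ (-n))⁻¹ = x ^ (-n) * (f * (x ^ n)⁻¹)⁻¹ * (x ^ (-n))⁻¹ := by
        group
      rwa [h5]
    · filter_upwards [((f⁻¹).tendsto_atTop).eventually h2] with t h5
      rw [RelIso.apply_inv_self] at h5
      push_cast
      linarith

theorem suppPL_le_cptComm {a b : ℝ} (ha : IsDyadic a) (hb : IsDyadic b) : suppPL a b ≤ cptComm := by
  intro f hf
  obtain ⟨k, hk⟩ := (show ∀ᶠ k in atTop, f ∈ stretchWords k from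
    suppPL_le_smallWords ha hb hf).exists
  obtain ⟨n, h1, h2⟩ := exists_zpow_of_mem_stretchWords hk
  obtain ⟨t, h3, h4⟩ := (h2.and (eventually_ge_atTop b)).exists
  rw [hf.2 t fun h => absurd h.2 (not_lt.2 h4)] at h3
  have h5 : (0 : ℝ) < ((2 : ℝ) ^ k)⁻¹ := by positivity
  -- The map `f` is trivial near `+∞`, so the total translation there vanishes.
  have h6 : n = 0 := by
    have : (n : ℝ) = 0 := by
      rcases mul_eq_zero.1 (by linarith : (n : ℝ) * ((2 : ℝ) ^ k)⁻¹ = 0) with h | h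
      · exact h
      · exact absurd h h5.ne'
    exact_mod_cast this
  simpa [h6] using h1

/-- A map supported in `(a, b)` is a product of commutators of maps supported in any larger
interval. -/
theorem suppPL_le_commutator {a b α β : ℝ} (ha : IsDyadic a) (hb : IsDyadic b) (hα : IsDyadic α)
    (hβ : IsDyadic β) (h1 : α < a) (h2 : a ≤ b) (h3 : b < β) :
    suppPL a b ≤ ⁅suppPL α β, suppPL α β⁆ := by
  intro f hf
  have hmono : ∀ K M : ℕ, K ≤ M → ⁅suppPL (-K) K, suppPL (-K) K⁆ ≤ ⁅suppPL (-M) M, suppPL (-M) M⁆ := by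
    intro K M h
    have h : (K : ℝ) ≤ M := by exact_mod_cast h
    exact Subgroup.commutator_mono (suppPL_mono (neg_le_neg h) h) (suppPL_mono (neg_le_neg h) h)
  -- A product of commutators involves finitely many maps, so one interval `(-K, K)` contains all
  -- their supports.
  have h4 : cptComm ≤ ⨆ K : ℕ, ⁅suppPL (-K) K, suppPL (-K) K⁆ := by
    refine Subgroup.commutator_le.2 fun g ⟨K, hK⟩ h ⟨M, hM⟩ => ?_
    have h5 : (K : ℝ) ≤ (max K M : ℕ) := by exact_mod_cast le_max_left _ _
    have h6 : (M : ℝ) ≤ (max K M : ℕ) := by exact_mod_cast le_max_right _ _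
    exact Subgroup.mem_iSup_of_mem (max K M) (Subgroup.commutator_mem_commutator
      (suppPL_mono (neg_le_neg h5) h5 hK) (suppPL_mono (neg_le_neg h6) h6 hM))
  obtain ⟨K, hK⟩ := (Subgroup.mem_iSup_of_directed
    (directed_of_isDirected_le hmono)).1 (h4 (suppPL_le_cptComm ha hb hf))
  obtain ⟨M, hM⟩ := exists_nat_gt (max (K : ℝ) (max |a| |b|))
  have h5 : (K : ℝ) < M := (le_max_left _ _).trans_lt hM
  have h6 : |a| < M := ((le_max_left _ _).trans (le_max_right _ _)).trans_lt hM
  have h7 : |b| < M := ((le_max_right _ _).trans (le_max_right _ _)).trans_lt hM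
  rw [abs_lt] at h6 h7
  have hM' := hmono K M (by exact_mod_cast h5.le) hK
  have hMd : IsDyadic (M : ℝ) := by simpa using IsDyadic.intCast M
  obtain ⟨f1, hf1, h8, h9⟩ := exists_locPL_interval hMd.neg ha hα ha h6.1 h1
  obtain ⟨f2, hf2, h10, h11⟩ := exists_locPL_interval hb hMd hb hβ h7.2 h3
  have h12 : (1 : ℝ ≃o ℝ) b = f2 b := h10.symm
  have h13 : f1 a = glue 1 f2 b h12 a := by rw [glue_apply_of_le _ h2, h9]; rfl
  -- The map `g` is the identity on `[a, b]`, hence commutes with `f`, and it squeezes `[-M, M]`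
  -- onto `[α, β]`. Conjugating the expression of `f` by `g` moves all its factors into `(α, β)`.
  set g := glue f1 (glue 1 f2 b h12) a h13 with hg
  have hgm : g ∈ locPL := glue_mem _ hf1 (glue_mem _ (one_mem _) hf2 hb) ha
  have hgf : g * f * g⁻¹ = f := by
    rw [commute_of_fixes (w := g) (a := a) (b := b) _ hf, mul_inv_cancel_right]
    intro t ht
    rw [hg, glue_apply_of_ge _ ht.1.le, glue_apply_of_le _ ht.2.le]; rfl
  have h14 : (suppPL (-M) M).map (MulAut.conj g).toMonoidHom ≤ suppPL α β := by
    rintro _ ⟨h, hh, rfl⟩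
    have := conj_mem_suppPL hgm hh
    rwa [hg, glue_apply_of_le _ h6.1.le, h8, glue_apply_of_ge _ (by linarith),
      glue_apply_of_ge _ (by linarith), h11] at this
  have h15 : f ∈ (⁅suppPL (-M) M, suppPL (-M) M⁆).map (MulAut.conj g).toMonoidHom :=
    ⟨f, hM', hgf⟩
  rw [Subgroup.map_commutator] at h15
  exact Subgroup.commutator_mono h14 h14 h15

/-! ### Lifts of homeomorphisms of the suspension to `X × ℝ` -/

section Lifts

variable {X : Type*} [TopologicalSpace X]

theorem Homeomorph.zpow_add_apply (φ : X ≃ₜ X) (m n : ℤ) (x : X) :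
    (φ ^ (m + n)) x = (φ ^ m) ((φ ^ n) x) := by
  rw [zpow_add, Homeomorph.mul_apply]

theorem IsClopen.eventually_mem_iff {C : Set X} (hC : IsClopen C) (x₀ : X) :
    ∀ᶠ x in 𝓝 x₀, x ∈ C ↔ x₀ ∈ C := by
  by_cases h : x₀ ∈ C
  · filter_upwards [hC.isOpen.mem_nhds h] with x hx using iff_of_true hx h
  · filter_upwards [hC.compl.isOpen.mem_nhds h] with x hx using iff_of_false hx h

theorem exists_icc_image_subset (f : ℝ ≃o ℝ) (K : ℝ) :
    ∃ M, ∀ t ∈ Set.Icc (-K) K, f t ∈ Set.Icc (-M) M := by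
  refine ⟨max |f (-K)| |f K|, fun t ht => ⟨?_, ?_⟩⟩
  · have := f.monotone ht.1
    linarith [neg_abs_le (f (-K)), le_max_left |f (-K)| |f K|]
  · have := f.monotone ht.2
    linarith [le_abs_self (f K), le_max_right |f (-K)| |f K|]

/-- Families of increasing bijections of the line, indexed by `X`, that are equivariant for the
`ℤ`-action on `X × ℝ` and locally constant on compact intervals. -/
def liftTop (φ : X ≃ₜ X) : Subgroup (X → (ℝ ≃o ℝ)) where
  carrier := {G | (∀ x t (n : ℤ), G ((φ ^ n) x) (t - n) = G x t - n) ∧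
    ∀ x₀ (K : ℝ), ∀ᶠ x in 𝓝 x₀, ∀ t ∈ Set.Icc (-K) K, G x t = G x₀ t}
  one_mem' := ⟨fun _ _ _ => rfl, fun _ _ => Eventually.of_forall fun _ _ _ => rfl⟩
  mul_mem' := by
    intro G H hG hH
    refine ⟨fun x t n => ?_, fun x₀ K => ?_⟩
    · simp only [Pi.mul_apply, RelIso.mul_apply]
      rw [hH.1, hG.1]
    · obtain ⟨M, hM⟩ := exists_icc_image_subset (H x₀) K
      filter_upwards [hH.2 x₀ K, hG.2 x₀ M] with x h1 h2 t ht
      simp only [Pi.mul_apply, RelIso.mul_apply]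
      rw [h1 t ht, h2 _ (hM t ht)]
  inv_mem' := by
    intro G hG
    refine ⟨fun x t n => ?_, fun x₀ K => ?_⟩
    · simp only [Pi.inv_apply]
      have h := hG.1 x ((G x)⁻¹ t) n
      rw [RelIso.apply_inv_self] at h
      rw [← h, RelIso.inv_apply_self]
    · obtain ⟨M, hM⟩ := exists_icc_image_subset (G x₀)⁻¹ K
      filter_upwards [hG.2 x₀ M] with x h t ht
      simp only [Pi.inv_apply]
      have := h _ (hM t ht)
      rw [RelIso.apply_inv_self] at this
      conv_lhs => rw [← this]
      rw [RelIso.inv_apply_self]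

/-- The equivariant families of dyadic piecewise linear maps. -/
def liftPL (φ : X ≃ₜ X) : Subgroup (X → (ℝ ≃o ℝ)) :=
  liftTop φ ⊓ Subgroup.pi Set.univ fun _ => locPL

theorem mem_liftPL {φ : X ≃ₜ X} {G : X → (ℝ ≃o ℝ)} :
    G ∈ liftPL φ ↔ G ∈ liftTop φ ∧ ∀ x, G x ∈ locPL := by
  simp [liftPL, Subgroup.mem_inf, Subgroup.mem_pi]

/-- Locally constant families of dyadic piecewise linear maps supported in `(c, c + 1)`. -/
def windowMaps (X : Type*) [TopologicalSpace X] (c : ℝ) : Subgroup (X → (ℝ ≃o ℝ)) where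
  carrier := {v | (∀ x, v x ∈ suppPL c (c + 1)) ∧ ∀ x₀, ∀ᶠ x in 𝓝 x₀, v x = v x₀}
  one_mem' := ⟨fun _ => one_mem _, fun _ => Eventually.of_forall fun _ => rfl⟩
  mul_mem' := fun hv hw => ⟨fun x => mul_mem (hv.1 x) (hw.1 x), fun x₀ => by
    filter_upwards [hv.2 x₀, hw.2 x₀] with x h1 h2
    simp only [Pi.mul_apply, h1, h2]⟩
  inv_mem' := fun hv => ⟨fun x => inv_mem (hv.1 x), fun x₀ => by
    filter_upwards [hv.2 x₀] with x h1
    simp only [Pi.inv_apply, h1]⟩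

theorem suppPL_apply_mem_Icc {a b : ℝ} {f : ℝ ≃o ℝ} (hf : f ∈ suppPL a b) {t : ℝ}
    (ht : t ∈ Set.Icc a b) : f t ∈ Set.Icc a b := by
  constructor
  · rw [← hf.2 a (by simp)]; exact f.monotone ht.1
  · rw [← hf.2 b (by simp)]; exact f.monotone ht.2

/-- The equivariant extension of a family of maps supported in `(c, c + 1)`. -/
noncomputable def windowFun (φ : X ≃ₜ X) (c : ℝ) (v : X → (ℝ ≃o ℝ)) (x : X) (t : ℝ) : ℝ :=
  v ((φ ^ ⌊t - c⌋) x) (t - ⌊t - c⌋) + ⌊t - c⌋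

/-! ### Equivariant extension from a window of length one -/

section window
variable {φ : X ≃ₜ X} {c : ℝ} {v : X → (ℝ ≃o ℝ)}

theorem sub_floor_mem (t c : ℝ) : t - ⌊t - c⌋ ∈ Set.Icc c (c + 1) := by
  have h1 := Int.floor_le (t - c)
  have h2 := Int.lt_floor_add_one (t - c)
  constructor <;> linarith

/-- The right end of a window belongs, for the floor function, to the next window. Both formulas
agree there because the maps fix `c` and `c + 1`. -/
theorem windowFun_eq (hv : v ∈ windowMaps X c) (x : X) {t : ℝ} {n : ℤ}
    (h : t - n ∈ Set.Icc c (c + 1)) : windowFun φ c v x t = v ((φ ^ n) x) (t - n) + n := by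
  have h1 := h.1
  rcases h.2.lt_or_eq with h2 | h2
  · have : ⌊t - c⌋ = n := by
      rw [Int.floor_eq_iff]
      constructor <;> linarith
    rw [windowFun, this]
  · have : ⌊t - c⌋ = n + 1 := by
      rw [Int.floor_eq_iff]
      push_cast
      constructor <;> linarith
    rw [windowFun, this, h2, (hv.1 _).2 (c + 1) (by simp), (hv.1 _).2]
    · push_cast; linarith
    · push_cast
      intro h; linarith [h.1]

/-- Inside a window the map is a translated copy of an increasing map. Distinct windows keep their
order because each is preserved. -/
theorem windowFun_strictMono (hv : v ∈ windowMaps X c) (x : X) :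
    StrictMono (windowFun φ c v x) := by
  intro s t hst
  have hle : ⌊s - c⌋ ≤ ⌊t - c⌋ := Int.floor_le_floor (by linarith)
  rcases hle.eq_or_lt with h | h
  · rw [windowFun, windowFun, h]
    have := (v ((φ ^ ⌊t - c⌋) x)).strictMono (show s - ⌊t - c⌋ < t - ⌊t - c⌋ by linarith)
    linarith
  · have h1 := (suppPL_apply_mem_Icc (hv.1 ((φ ^ ⌊t - c⌋) x)) (sub_floor_mem t c)).1
    have h3 : v ((φ ^ ⌊s - c⌋) x) (s - ⌊s - c⌋) < c + 1 := by
      rw [← (hv.1 ((φ ^ ⌊s - c⌋) x)).2 (c + 1) (by simp)]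
      refine OrderIso.strictMono _ ?_
      have := Int.lt_floor_add_one (s - c)
      linarith
    have h4 : (⌊s - c⌋ : ℝ) + 1 ≤ ⌊t - c⌋ := by exact_mod_cast h
    rw [windowFun, windowFun]
    linarith

theorem windowFun_mul {w : X → (ℝ ≃o ℝ)} (hv : v ∈ windowMaps X c) (hw : w ∈ windowMaps X c)
    (x : X) (t : ℝ) : windowFun φ c (v * w) x t = windowFun φ c v x (windowFun φ c w x t) := by
  have h := suppPL_apply_mem_Icc (hw.1 ((φ ^ ⌊t - c⌋) x)) (sub_floor_mem t c)
  have h1 : windowFun φ c w x t - ⌊t - c⌋ = w ((φ ^ ⌊t - c⌋) x) (t - ⌊t - c⌋) := by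
    rw [windowFun]; ring
  rw [windowFun_eq (v := v) (n := ⌊t - c⌋) hv x (by rwa [h1]), h1]
  rfl

theorem windowFun_one (x : X) (t : ℝ) : windowFun φ c (1 : X → (ℝ ≃o ℝ)) x t = t := by
  rw [windowFun]
  simp

/-- The group homomorphism that extends a family of maps supported in `(c, c + 1)`
equivariantly. -/
noncomputable def windowHom (φ : X ≃ₜ X) (c : ℝ) : windowMaps X c →* (X → (ℝ ≃o ℝ)) where
  toFun v x := StrictMono.orderIsoOfRightInverse (windowFun φ c v x) (windowFun_strictMono v.2 x)
    (windowFun φ c (v⁻¹ : X → (ℝ ≃o ℝ)) x) (fun t => by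
      rw [← windowFun_mul v.2 (inv_mem v.2), mul_inv_cancel, windowFun_one])
  map_one' := by
    ext x t
    exact windowFun_one x t
  map_mul' v w := by
    ext x t
    exact windowFun_mul v.2 w.2 x t

theorem windowHom_apply (v : windowMaps X c) (x : X) {t : ℝ} (n : ℤ)
    (h : t - n ∈ Set.Icc c (c + 1)) :
    windowHom φ c v x t = (v : X → (ℝ ≃o ℝ)) ((φ ^ n) x) (t - n) + n :=
  windowFun_eq v.2 x h

theorem windowHom_apply_zero (v : windowMaps X c) (x : X) {t : ℝ} (h : t ∈ Set.Icc c (c + 1)) :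
    windowHom φ c v x t = (v : X → (ℝ ≃o ℝ)) x t := by
  simpa using windowHom_apply (φ := φ) v x 0 (by simpa using h)

theorem windowHom_fix (v : windowMaps X c) (x : X) {t : ℝ}
    (h : ∀ n : ℤ, (v : X → (ℝ ≃o ℝ)) ((φ ^ n) x) (t - n) = t - n) : windowHom φ c v x t = t := by
  rw [windowHom_apply v x ⌊t - c⌋ (sub_floor_mem t c), h]
  ring

theorem windowHom_mem (hc : IsDyadic c) (v : windowMaps X c) : windowHom φ c v ∈ liftPL φ := by
  rw [mem_liftPL]
  refine ⟨⟨fun x t n => ?_, fun x₀ K => ?_⟩, fun x => IsLocDyadicPL.of_local fun t => ?_⟩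
  · have h := sub_floor_mem t c
    rw [windowHom_apply v _ (⌊t - c⌋ - n) (by push_cast; convert h using 1; ring),
      windowHom_apply v x _ h, ← Homeomorph.zpow_add_apply]
    push_cast
    rw [sub_add_cancel, sub_sub_sub_cancel_right]
    ring
  -- A compact interval meets finitely many windows, so finitely many conditions of local constancy
  -- are intersected.
  · obtain ⟨M, hM⟩ := exists_nat_gt (K + |c| + 1)
    have h1 : ∀ᶠ x in 𝓝 x₀, ∀ n ∈ Set.Icc (-M : ℤ) M,
        (v : X → (ℝ ≃o ℝ)) ((φ ^ n) x) = (v : X → (ℝ ≃o ℝ)) ((φ ^ n) x₀) := by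
      rw [eventually_all_finite (Set.finite_Icc _ _)]
      intro n _
      exact (φ ^ n).continuous.continuousAt.eventually (v.2.2 ((φ ^ n) x₀))
    filter_upwards [h1] with x hx t ht
    have h2 := sub_floor_mem t c
    rw [windowHom_apply v _ _ h2, windowHom_apply v _ _ h2, hx]
    have h3 := neg_abs_le c
    have h4 := le_abs_self c
    constructor
    · have : (-(M : ℝ)) ≤ ⌊t - c⌋ := by linarith [h2.1, h2.2, ht.1, ht.2]
      exact_mod_cast this
    · have : (⌊t - c⌋ : ℝ) ≤ M := by linarith [h2.1, h2.2, ht.1, ht.2]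
      exact_mod_cast this
  · have hmem : ∀ n : ℤ, transl n * (v : X → (ℝ ≃o ℝ)) ((φ ^ n) x) * (transl n)⁻¹ ∈ locPL := fun n =>
      mul_mem (mul_mem (transl_mem (IsDyadic.intCast n)) (v.2.1 _).1)
        (inv_mem (transl_mem (IsDyadic.intCast n)))
    have heq : ∀ (n : ℤ) (s : ℝ), s - n ∈ Set.Icc c (c + 1) → windowHom φ c v x s =
        (transl n * (v : X → (ℝ ≃o ℝ)) ((φ ^ n) x) * (transl n)⁻¹) s := fun n s hs => by
      rw [windowHom_apply v x n hs, RelIso.mul_apply, RelIso.mul_apply, transl_inv_apply,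
        transl_apply]
    have h1 := Int.floor_le (t - c)
    have h2 := Int.lt_floor_add_one (t - c)
    -- At a common endpoint of two windows the two one-sided germs come from different maps; such a
    -- point is dyadic since `c` is.
    rcases h1.eq_or_lt with h | h
    · refine Or.inr ⟨?_, ⟨_, hmem ⌊t - c⌋, ?_⟩, _, hmem (⌊t - c⌋ - 1), ?_⟩
      · have : t = c + ⌊t - c⌋ := by linarith
        rw [this]
        exact hc.add (IsDyadic.intCast _)
      · filter_upwards [Ico_mem_nhdsGE (show t < t + 1 by linarith)] with s hs
        exact heq _ _ ⟨by linarith [hs.1], by linarith [hs.2]⟩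
      · filter_upwards [Ioc_mem_nhdsLE (show t - 1 < t by linarith)] with s hs
        refine heq _ _ ⟨?_, ?_⟩ <;> push_cast <;> linarith [hs.1, hs.2]
    · refine Or.inl ⟨_, hmem ⌊t - c⌋, ?_⟩
      filter_upwards [Ioo_mem_nhds (show c + ⌊t - c⌋ < t by linarith)
        (show t < c + ⌊t - c⌋ + 1 by linarith)] with s hs
      exact heq _ _ ⟨by linarith [hs.1], by linarith [hs.2]⟩

/-- The restriction of a family of maps to a clopen set, extended by the identity. -/
noncomputable def windowRestrict {C : Set X} (hC : IsClopen C) (v : windowMaps X c) :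
    windowMaps X c :=
  ⟨C.mulIndicator v, fun x => by
    by_cases h : x ∈ C
    · rw [Set.mulIndicator_of_mem h]; exact v.2.1 x
    · rw [Set.mulIndicator_of_notMem h]; exact one_mem _, fun x₀ => by
    filter_upwards [v.2.2 x₀, hC.eventually_mem_iff x₀] with x h1 h2
    by_cases h : x₀ ∈ C
    · rw [Set.mulIndicator_of_mem h, Set.mulIndicator_of_mem (h2.2 h), h1]
    · rw [Set.mulIndicator_of_notMem h, Set.mulIndicator_of_notMem fun h' => h (h2.1 h')]⟩

theorem coe_windowRestrict {C : Set X} (hC : IsClopen C) (v : windowMaps X c) :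
    (windowRestrict hC v : X → (ℝ ≃o ℝ)) = C.mulIndicator v := rfl

/-- A constant family of maps. -/
def windowConst (X : Type*) [TopologicalSpace X] {f : ℝ ≃o ℝ} (hf : f ∈ suppPL c (c + 1)) :
    windowMaps X c :=
  ⟨fun _ => f, fun _ => hf, fun _ => Eventually.of_forall fun _ => rfl⟩

theorem windowRestrict_mul {C : Set X} (hC : IsClopen C) (v w : windowMaps X c) :
    windowRestrict hC (v * w) = windowRestrict hC v * windowRestrict hC w :=
  Subtype.ext (Set.mulIndicator_mul' C _ _)

theorem windowRestrict_union {C D : Set X} (hC : IsClopen C) (hD : IsClopen D)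
    (h : Disjoint C D) (v : windowMaps X c) :
    windowRestrict (hC.union hD) v = windowRestrict hC v * windowRestrict hD v :=
  Subtype.ext (Set.mulIndicator_union_of_disjoint h _)

/-- The equivariant extension of `f`, supported in `(c, c + 1)`, restricted to the clopen set
`C`. -/
noncomputable def cylMap (φ : X ≃ₜ X) {C : Set X} (hC : IsClopen C) {f : ℝ ≃o ℝ}
    (hf : f ∈ suppPL c (c + 1)) : X → (ℝ ≃o ℝ) :=
  windowHom φ c (windowRestrict hC (windowConst X hf))

section cyl
variable {C : Set X} (hC : IsClopen C) {f g : ℝ ≃o ℝ} (hf : f ∈ suppPL c (c + 1))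
  (hg : g ∈ suppPL c (c + 1))

theorem cylMap_mem (hc : IsDyadic c) : cylMap φ hC hf ∈ liftPL φ := windowHom_mem hc _

theorem cylMap_apply_of_mem {x : X} (n : ℤ) (hx : (φ ^ n) x ∈ C) {t : ℝ}
    (ht : t - n ∈ Set.Icc c (c + 1)) : cylMap φ hC hf x t = f (t - n) + n := by
  rw [cylMap, windowHom_apply _ x n ht, coe_windowRestrict, Set.mulIndicator_of_mem hx]
  rfl

theorem cylMap_apply_of_mem_zero {x : X} (hx : x ∈ C) {t : ℝ}
    (ht : t ∈ Set.Icc c (c + 1)) : cylMap φ hC hf x t = f t := by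
  simpa using cylMap_apply_of_mem (φ := φ) hC hf (x := x) 0 (by simpa using hx) (by simpa using ht)

theorem cylMap_apply_of_notMem {x : X} (n : ℤ) (hx : (φ ^ n) x ∉ C) {t : ℝ}
    (ht : t - n ∈ Set.Icc c (c + 1)) : cylMap φ hC hf x t = t := by
  rw [cylMap, windowHom_apply _ x n ht, coe_windowRestrict, Set.mulIndicator_of_notMem hx]
  exact sub_add_cancel t _

theorem cylMap_fix {x : X} {t : ℝ} (h : ∀ n : ℤ, (φ ^ n) x ∈ C → f (t - n) = t - n) :
    cylMap φ hC hf x t = t := by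
  refine windowHom_fix _ x fun n => ?_
  rw [coe_windowRestrict]
  by_cases hn : (φ ^ n) x ∈ C
  · rw [Set.mulIndicator_of_mem hn]; exact h n hn
  · rw [Set.mulIndicator_of_notMem hn]; rfl

theorem cylMap_mul : cylMap φ hC (mul_mem hf hg) = cylMap φ hC hf * cylMap φ hC hg := by
  rw [cylMap, cylMap, cylMap, ← map_mul, ← windowRestrict_mul]
  rfl

theorem cylMap_one : cylMap φ hC (one_mem (suppPL c (c + 1))) = 1 := by
  ext x t
  exact cylMap_fix hC _ fun _ _ => rfl

theorem cylMap_inv : cylMap φ hC (inv_mem hf) = (cylMap φ hC hf)⁻¹ := by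
  have key : ∀ k (hk : k ∈ suppPL c (c + 1)), k = 1 → cylMap φ hC hk = 1 := by
    rintro _ _ rfl
    exact cylMap_one hC
  rw [eq_inv_iff_mul_eq_one, ← cylMap_mul hC (inv_mem hf) hf]
  exact key _ _ (inv_mul_cancel f)

theorem cylMap_union {D : Set X} (hD : IsClopen D) (h : Disjoint C D) :
    cylMap φ (hC.union hD) hf = cylMap φ hC hf * cylMap φ hD hf := by
  rw [cylMap, cylMap, cylMap, ← map_mul, windowRestrict_union hC hD h]

end cyl

end window

end Lifts

/-! ### Fragmentation into maps supported in cylinders -/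

section Fragmentation

variable {X : Type*} [TopologicalSpace X]

/-- By compactness finitely many local neighbourhoods suffice. The local hypothesis covers all
clopen subsets, so a set covered by `D ∪ E` can be cut into the disjoint parts `C ∩ D` and `C \ D`.
-/
theorem clopen_induction [CompactSpace X] {Q : Set X → Prop} (hempty : Q ∅)
    (hloc : ∀ x, ∃ D, IsClopen D ∧ x ∈ D ∧ ∀ C, IsClopen C → C ⊆ D → Q C)
    (hunion : ∀ C D, IsClopen C → IsClopen D → Disjoint C D → Q C → Q D → Q (C ∪ D))
    {C : Set X} (hC : IsClopen C) : Q C := by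
  have key : ∃ D, IsClopen D ∧ Set.univ ⊆ D ∧ ∀ C, IsClopen C → C ⊆ D → Q C := by
    refine isCompact_univ.induction_on
      (p := fun s => ∃ D, IsClopen D ∧ s ⊆ D ∧ ∀ C, IsClopen C → C ⊆ D → Q C) ?_ ?_ ?_ ?_
    · refine ⟨∅, isClopen_empty, le_rfl, fun C _ h => ?_⟩
      rwa [Set.subset_empty_iff.1 h]
    · rintro s t hst ⟨D, hD, htD, h⟩
      exact ⟨D, hD, hst.trans htD, h⟩
    · rintro s t ⟨D, hD, hsD, h⟩ ⟨E, hE, htE, h'⟩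
      refine ⟨D ∪ E, hD.union hE, Set.union_subset_union hsD htE, fun C hC hCDE => ?_⟩
      rw [← Set.inter_union_sdiff C D]
      refine hunion _ _ (hC.inter hD) (hC.diff hD) ?_ (h _ (hC.inter hD) Set.inter_subset_right)
        (h' _ (hC.diff hD) fun x hx => (hCDE hx.1).resolve_left hx.2)
      exact Set.disjoint_left.2 fun x hx hx' => hx'.2 hx.2
    · intro x _
      obtain ⟨D, hD, hxD, h⟩ := hloc x
      exact ⟨D, mem_nhdsWithin_of_mem_nhds (hD.isOpen.mem_nhds hxD), D, hD, le_rfl, h⟩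
  obtain ⟨D, -, hD, h⟩ := key
  exact h C hC ((Set.subset_univ C).trans hD)

theorem exists_isClopen_of_eventually [CompactSpace X] [T2Space X] [TotallyDisconnectedSpace X]
    {p : X → Prop} {x : X} (h : ∀ᶠ y in 𝓝 x, p y) : ∃ D, IsClopen D ∧ x ∈ D ∧ ∀ y ∈ D, p y := by
  obtain ⟨U, hU, hUo, hxU⟩ := eventually_nhds_iff.1 h
  obtain ⟨D, hD, hxD, hDU⟩ := compact_exists_isClopen_in_isOpen hUo hxU
  exact ⟨D, hD, hxD, fun y hy => hU y (hDU hy)⟩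

theorem continuous_of_eventually_eq {Y : Type*} [TopologicalSpace Y] {c : X → Y}
    (h : ∀ x₀, ∀ᶠ x in 𝓝 x₀, c x = c x₀) : Continuous c :=
  continuous_iff_continuousAt.2 fun x₀ =>
    (continuousAt_const (y := c x₀)).congr (by filter_upwards [h x₀] with x hx using hx.symm)

/-- The maps supported in a cylinder over a clopen set. -/
def cylGens (φ : X ≃ₜ X) : Set (X → (ℝ ≃o ℝ)) :=
  {g | ∃ (c a b : ℝ) (C : Set X) (hC : IsClopen C) (f : ℝ ≃o ℝ) (hf : f ∈ suppPL c (c + 1)),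
    IsDyadic c ∧ IsDyadic a ∧ IsDyadic b ∧ c < a ∧ a < b ∧ b < c + 1 ∧ f ∈ suppPL a b ∧
    g = cylMap φ hC hf}

theorem cylGens_subset (φ : X ≃ₜ X) : cylGens φ ⊆ liftPL φ := by
  rintro _ ⟨c, a, b, C, hC, f, hf, hc, -, -, -, -, -, -, rfl⟩
  exact cylMap_mem hC hf hc

variable [CompactSpace X] [T2Space X] [TotallyDisconnectedSpace X] {φ : X ≃ₜ X}
  {S : Subgroup (X → (ℝ ≃o ℝ))}

/-- A locally constant family on a compact space is a finite product of families that are constant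
on a clopen set and trivial off it. -/
theorem windowHom_mem_of_cylGens (hS : cylGens φ ⊆ S) {c : ℝ} (hc : IsDyadic c)
    (v : windowMaps X c) (hv : ∀ x, ∃ a b, IsDyadic a ∧ IsDyadic b ∧ c < a ∧ a < b ∧ b < c + 1 ∧
      (v : X → (ℝ ≃o ℝ)) x ∈ suppPL a b) : windowHom φ c v ∈ S := by
  have key := clopen_induction (Q := fun C => ∀ hC : IsClopen C,
    windowHom φ c (windowRestrict hC v) ∈ S) ?_ ?_ ?_ (isClopen_univ (X := X)) isClopen_univ
  · have : windowRestrict isClopen_univ v = v := Subtype.ext (Set.mulIndicator_univ _)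
    rwa [this] at key
  · intro h
    have : windowRestrict h v = 1 := Subtype.ext (Set.mulIndicator_empty _)
    rw [this, map_one]
    exact one_mem _
  · intro x
    obtain ⟨D, hD, hxD, h⟩ := exists_isClopen_of_eventually (v.2.2 x)
    refine ⟨D, hD, hxD, fun C _ hCD hC => hS ?_⟩
    obtain ⟨a, b, ha, hb, h1, h2, h3, h4⟩ := hv x
    refine ⟨c, a, b, C, hC, _, v.2.1 x, hc, ha, hb, h1, h2, h3, h4, ?_⟩
    rw [cylMap]
    congr 1
    ext1
    funext y
    rw [coe_windowRestrict, coe_windowRestrict]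
    by_cases hy : y ∈ C
    · rw [Set.mulIndicator_of_mem hy, Set.mulIndicator_of_mem hy, h y (hCD hy)]
      rfl
    · rw [Set.mulIndicator_of_notMem hy, Set.mulIndicator_of_notMem hy]
  · intro C D hC hD hCD h1 h2 h
    rw [windowRestrict_union hC hD hCD, map_mul]
    exact mul_mem (h1 hC) (h2 hD)

omit [CompactSpace X] [T2Space X] [TotallyDisconnectedSpace X] in
-- In the suspension, `(x, c x)` is also `(φ ^ n x, c x - n)`. Summing the gaps along an orbit shows
-- that the different sheets of the lifted section stay at distance at least `γ`, so a local push of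
-- one sheet leaves the others alone.
theorem section_gap {c : X → ℝ} {γ : ℝ} (hγ : 0 < γ) (hgap : ∀ x, c x + γ ≤ c (φ x) + 1)
    (x : X) {n : ℤ} (hn : n ≠ 0) : γ ≤ |c x - n - c ((φ ^ n) x)| := by
  have key : ∀ (n : ℕ) x, c x + n * γ ≤ c ((φ ^ n) x) + n := by
    intro n
    induction n with
    | zero => intro x; simp
    | succ n ih =>
      intro x
      have h1 := ih x
      have h2 := hgap ((φ ^ n) x)
      rw [← Homeomorph.mul_apply, ← pow_succ'] at h2
      push_cast
      linarith
  obtain ⟨m, rfl | rfl⟩ := n.eq_nat_or_neg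
  · have h1 := key m x
    have h2 : (1 : ℝ) ≤ m := by
      exact_mod_cast Nat.one_le_iff_ne_zero.2 fun h => hn (by simp [h])
    rw [abs_sub_comm]
    refine le_trans ?_ (le_abs_self _)
    rw [zpow_natCast]
    push_cast
    nlinarith
  · have h1 := key m ((φ ^ (-(m : ℤ))) x)
    rw [← zpow_natCast, ← Homeomorph.zpow_add_apply, add_neg_cancel, zpow_zero] at h1
    simp only [Homeomorph.one_apply] at h1
    have h2 : (1 : ℝ) ≤ m := by
      exact_mod_cast Nat.one_le_iff_ne_zero.2 fun h => hn (by simp [h])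
    refine le_trans ?_ (le_abs_self _)
    push_cast
    nlinarith

/-- A section can be moved to any sufficiently close section. -/
theorem exists_move_section (hS : cylGens φ ⊆ S) {c c' : X → ℝ} {γ η : ℝ}
    (hc : ∀ x₀, ∀ᶠ x in 𝓝 x₀, c x = c x₀) (hc' : ∀ x₀, ∀ᶠ x in 𝓝 x₀, c' x = c' x₀)
    (hcd : ∀ x, IsDyadic (c x)) (hcd' : ∀ x, IsDyadic (c' x)) (hη : 0 < η) (hηd : IsDyadic η)
    (h2 : 2 * η ≤ γ) (h4 : 4 * η ≤ 1) (hgap : ∀ x, c x + γ ≤ c (φ x) + 1)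
    (hcc : ∀ x, |c' x - c x| < η) : ∃ h ∈ S, ∀ x, h x (c x) = c' x := by
  -- Fixing both the old and the new section off `C` allows the maps for disjoint clopen sets to be
  -- composed.
  have key := clopen_induction (Q := fun C => ∃ h ∈ S, (∀ x ∈ C, h x (c x) = c' x) ∧
    ∀ x ∉ C, h x (c x) = c x ∧ h x (c' x) = c' x) ?_ ?_ ?_ (isClopen_univ (X := X))
  · obtain ⟨h, hh, h1, -⟩ := key
    exact ⟨h, hh, fun x => h1 x (Set.mem_univ x)⟩
  · exact ⟨1, one_mem _, by simp, fun x _ => ⟨rfl, rfl⟩⟩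
  · intro x₀
    obtain ⟨D, hD, hxD, h⟩ := exists_isClopen_of_eventually ((hc x₀).and (hc' x₀))
    refine ⟨D, hD, hxD, fun C hC hCD => ?_⟩
    set u := c x₀ with hu
    have hcu := abs_lt.1 (hcc x₀)
    obtain ⟨k, hk, hku⟩ := exists_suppPL_apply_eq ((hcd x₀).sub hηd) ((hcd x₀).add hηd)
      (hcd x₀) (hcd' x₀) ⟨by linarith, by linarith⟩ ⟨by linarith, by linarith⟩
    -- The push is supported in `(u - η, u + η)`, strictly inside the window `(w, w + 1)` because `4
    -- * η ≤ 1`.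
    set w := u - 2 * η with hw
    have hkw : k ∈ suppPL w (w + 1) := suppPL_mono (by linarith) (by linarith) hk
    have hwd : IsDyadic w := by
      rw [hw, two_mul]; exact (hcd x₀).sub (hηd.add hηd)
    have hfix : ∀ x ∉ C, ∀ t, |t - c x| < η → cylMap φ hC hkw x t = t := by
      intro x hx t ht
      refine cylMap_fix hC hkw fun n hn => hk.2 _ fun hmem => ?_
      have hn0 : n ≠ 0 := by
        rintro rfl
        exact hx (by simpa using hn)
      -- A point within `η` of its own sheet and within `η` of another sheet contradicts the
      -- separation `γ ≥ 2 * η`.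
      have h5 := section_gap (by linarith) hgap x hn0
      rw [(h _ (hCD hn)).1] at h5
      have h6 : |t - n - u| < η := abs_lt.2 ⟨by linarith [hmem.1], by linarith [hmem.2]⟩
      have h7 : c x - n - u = (t - n - u) - (t - c x) := by ring
      rw [h7] at h5
      linarith [abs_sub (t - n - u) (t - c x)]
    refine ⟨cylMap φ hC hkw, hS ⟨w, u - η, u + η, C, hC, k, hkw, hwd, (hcd x₀).sub hηd,
      (hcd x₀).add hηd, by linarith, by linarith, by linarith, hk, rfl⟩, fun x hx => ?_,
      fun x hx => ⟨hfix x hx _ (by simpa using hη), hfix x hx _ (hcc x)⟩⟩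
    rw [cylMap_apply_of_mem_zero hC hkw hx, (h x (hCD hx)).1, (h x (hCD hx)).2, hku]
    rw [(h x (hCD hx)).1]
    constructor <;> linarith
  · rintro C D - - hCD ⟨h, hh, h1, h2⟩ ⟨k, hk, h3, h4⟩
    refine ⟨k * h, mul_mem hk hh, fun x hx => ?_, fun x hx => ?_⟩
    · simp only [Pi.mul_apply, RelIso.mul_apply]
      rcases hx with hx | hx
      · rw [h1 x hx, (h4 x (Set.disjoint_left.1 hCD hx)).2]
      · rw [(h2 x (Set.disjoint_right.1 hCD hx)).1, h3 x hx]
    · simp only [Pi.mul_apply, RelIso.mul_apply]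
      rw [Set.mem_union, not_or] at hx
      rw [(h2 x hx.1).1, (h2 x hx.1).2]
      exact h4 x hx.2

omit [CompactSpace X] [T2Space X] [TotallyDisconnectedSpace X] in
theorem liftTop_eventually_apply {G : X → (ℝ ≃o ℝ)} (hG : G ∈ liftTop φ) (t : ℝ) (x₀ : X) :
    ∀ᶠ x in 𝓝 x₀, G x t = G x₀ t := by
  filter_upwards [hG.2 x₀ |t|] with x h
  exact h t ⟨neg_abs_le t, le_abs_self t⟩

/-- The zero section is moved to its image under `G` through convex combinations, in steps short
enough for `exists_move_section`. The gap condition is convex, so it holds all along the way. -/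
theorem exists_section_eq [Nonempty X] (hS : cylGens φ ⊆ S) {G : X → (ℝ ≃o ℝ)}
    (hG : G ∈ liftPL φ) : ∃ h ∈ S, ∀ x, h x 0 = G x 0 := by
  rw [mem_liftPL] at hG
  have hloc := liftTop_eventually_apply hG.1 0
  have hcont : Continuous fun x => G x 0 := continuous_of_eventually_eq hloc
  have hgap : ∀ x, G (φ x) 0 + 1 = G x 1 := by
    intro x
    have := hG.1.1 x 1 1
    simp only [zpow_one, Int.cast_one, sub_self] at this
    linarith
  obtain ⟨y, -, hy⟩ := isCompact_univ.exists_isMinOn (Set.univ_nonempty (α := X))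
    (show ContinuousOn (fun x => G (φ x) 0 + 1 - G x 0) Set.univ from
      (((hcont.comp φ.continuous).add continuous_const).sub hcont).continuousOn)
  set γ₀ := G (φ y) 0 + 1 - G y 0 with hγ₀
  have hγ₀pos : 0 < γ₀ := by
    have := (G y).strictMono (zero_lt_one' ℝ)
    rw [hγ₀, hgap]
    linarith
  have hγ₀le : ∀ x, γ₀ ≤ G (φ x) 0 + 1 - G x 0 := fun x => hy (Set.mem_univ x)
  obtain ⟨z, -, hz⟩ := isCompact_univ.exists_isMaxOn (Set.univ_nonempty (α := X))
    (show ContinuousOn (fun x => |G x 0|) Set.univ from hcont.abs.continuousOn)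
  set M := |G z 0|
  have hM : ∀ x, |G x 0| ≤ M := fun x => hz (Set.mem_univ x)
  set γ := min 1 γ₀
  have hγ : 0 < γ := lt_min one_pos hγ₀pos
  obtain ⟨η, hηd, hη, hη'⟩ := exists_isDyadic_between (show 0 < γ / 4 by linarith)
  have hγ1 : γ ≤ 1 := min_le_left _ _
  -- Taking a power of two as the number of steps keeps the intermediate sections dyadic.
  obtain ⟨k, hk⟩ := pow_unbounded_of_one_lt (M / η) (one_lt_two (α := ℝ))
  have h2k : (0 : ℝ) < 2 ^ k := by positivity
  set cs : ℕ → X → ℝ := fun i x => i * ((2 : ℝ) ^ k)⁻¹ * G x 0 with hcs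
  have hd : ∀ i x, IsDyadic (cs i x) := fun i x =>
    ((by simpa using IsDyadic.intCast i : IsDyadic (i : ℝ)).mul (IsDyadic.inv_two_pow k)).mul
      ((isDyadic_locPL (hG.2 x)).2 IsDyadic.zero)
  have key : ∀ i : ℕ, i ≤ 2 ^ k → ∃ h ∈ S, ∀ x, h x 0 = cs i x := by
    intro i
    induction i with
    | zero => exact fun _ => ⟨1, one_mem _, fun x => by simp [cs]⟩
    | succ i ih =>
      intro hi
      obtain ⟨h, hh, hx⟩ := ih (by omega)
      have hl : ∀ j x₀, ∀ᶠ x in 𝓝 x₀, cs j x = cs j x₀ := fun j x₀ => by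
        filter_upwards [hloc x₀] with x hx
        simp only [cs, hx]
      obtain ⟨h', hh', hx'⟩ := exists_move_section hS (hl i) (hl (i + 1)) (hd i) (hd (i + 1))
        hη hηd (γ := γ) (by linarith) (by linarith) (fun x => by
          have h1 : (i : ℝ) * ((2 : ℝ) ^ k)⁻¹ ≤ 1 := by
            rw [← div_eq_mul_inv, div_le_one h2k]
            exact_mod_cast (by omega : i ≤ 2 ^ k)
          have h0 : 0 ≤ (i : ℝ) * ((2 : ℝ) ^ k)⁻¹ := by positivity
          have h3 := hγ₀le x
          have h5 : γ ≤ γ₀ := min_le_right _ _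
          simp only [cs]
          set lam := (i : ℝ) * ((2 : ℝ) ^ k)⁻¹
          nlinarith) (fun x => by
          have h1 : cs (i + 1) x - cs i x = ((2 : ℝ) ^ k)⁻¹ * G x 0 := by
            simp only [cs]; push_cast; ring
          rw [h1, abs_mul, abs_of_pos (inv_pos.2 h2k)]
          calc ((2 : ℝ) ^ k)⁻¹ * |G x 0| ≤ ((2 : ℝ) ^ k)⁻¹ * M := by gcongr; exact hM x
            _ < η := by
              rw [inv_mul_lt_iff₀ h2k]
              rwa [div_lt_iff₀ hη] at hk)
      refine ⟨h' * h, mul_mem hh' hh, fun x => ?_⟩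
      simp only [Pi.mul_apply, RelIso.mul_apply]
      rw [hx, hx']
  obtain ⟨h, hh, hx⟩ := key (2 ^ k) le_rfl
  refine ⟨h, hh, fun x => ?_⟩
  rw [hx]
  simp only [cs]
  push_cast
  field_simp

omit [CompactSpace X] [T2Space X] [TotallyDisconnectedSpace X] in
theorem liftTop_ext {G H : X → (ℝ ≃o ℝ)} (hG : G ∈ liftTop φ) (hH : H ∈ liftTop φ)
    (h : ∀ x, ∀ t ∈ Set.Icc (0 : ℝ) 1, G x t = H x t) : G = H := by
  ext x t
  have h1 := hG.1 x t ⌊t⌋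
  have h2 := hH.1 x t ⌊t⌋
  have h3 := h ((φ ^ ⌊t⌋) x) (t - ⌊t⌋)
    ⟨by linarith [Int.floor_le t], by linarith [Int.lt_floor_add_one t]⟩
  linarith

omit [CompactSpace X] [T2Space X] [TotallyDisconnectedSpace X] in
/-- Restriction of a family of maps preserving `[a, b]` to this interval. -/
theorem exists_windowMaps_restrict {G : X → (ℝ ≃o ℝ)} (hG : G ∈ liftPL φ) {a b c : ℝ}
    (ha : IsDyadic a) (hb : IsDyadic b) (hab : a ≤ b) (hca : c ≤ a) (hbc : b ≤ c + 1)
    (h1 : ∀ x, G x a = a) (h2 : ∀ x, G x b = b) :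
    ∃ v : windowMaps X c, ∀ x, (v : X → (ℝ ≃o ℝ)) x ∈ suppPL a b ∧
      ∀ t ∈ Set.Icc a b, (v : X → (ℝ ≃o ℝ)) x t = G x t := by
  rw [mem_liftPL] at hG
  choose v hv hvt using fun x => exists_glue_suppPL ha hb hab (hG.2 x) (h1 x) (h2 x)
  refine ⟨⟨v, fun x => suppPL_mono hca hbc (hv x), fun x₀ => ?_⟩, fun x => ⟨hv x, hvt x⟩⟩
  filter_upwards [hG.1.2 x₀ (max |a| |b|)] with x hx
  ext t
  by_cases ht : t ∈ Set.Icc a b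
  · rw [hvt x t ht, hvt x₀ t ht, hx]
    constructor
    · linarith [neg_abs_le a, le_max_left |a| |b|, ht.1]
    · linarith [le_abs_self b, le_max_right |a| |b|, ht.2]
  · rw [(hv x).2 t fun h => ht ⟨h.1.le, h.2.le⟩, (hv x₀).2 t fun h => ht ⟨h.1.le, h.2.le⟩]

/-- The equivariant families of dyadic piecewise linear maps are generated by those supported in
cylinders. -/
theorem liftPL_le_of_cylGens [Nonempty X] (hS : cylGens φ ⊆ S) : liftPL φ ≤ S := by
  -- Intersecting with `liftPL φ` ensures that the factors split off below leave a quotient in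
  -- `liftPL φ`.
  have hS' : cylGens φ ⊆ (S ⊓ liftPL φ : Subgroup _) := fun g hg => ⟨hS hg, cylGens_subset φ hg⟩
  suffices h : liftPL φ ≤ S ⊓ liftPL φ from h.trans inf_le_left
  set S' := S ⊓ liftPL φ
  have hS'L : S' ≤ liftPL φ := inf_le_right
  intro G hG
  have hd2 : IsDyadic (1 / 2) := ⟨1, 1, by simp⟩
  have hd4 : IsDyadic (1 / 4) := ⟨1, 2, by norm_num⟩
  obtain ⟨h₁, hh₁, h₁0⟩ := exists_section_eq hS' hG
  set G₁ := h₁⁻¹ * G with hG₁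
  have hG₁m : G₁ ∈ liftPL φ := mul_mem (inv_mem (hS'L hh₁)) hG
  have hone : ∀ H ∈ liftPL φ, (∀ x, H x 0 = 0) → ∀ x, H x 1 = 1 := by
    intro H hH h0 x
    have := (mem_liftPL.1 hH).1.1 x 1 1
    simp only [zpow_one, Int.cast_one, sub_self, h0] at this
    linarith
  have hG₁0 : ∀ x, G₁ x 0 = 0 := fun x => by
    simp only [hG₁, Pi.mul_apply, Pi.inv_apply, RelIso.mul_apply]
    rw [← h₁0, RelIso.inv_apply_self]
  have hG₁1 := hone G₁ hG₁m hG₁0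
  have hhalf : ∀ x, ∃ a b, IsDyadic a ∧ IsDyadic b ∧ 0 < a ∧ a < b ∧ b < 1 ∧
      ∃ f ∈ suppPL a b, f (1 / 2) = G₁ x (1 / 2) := by
    intro x
    have h1 : 0 < G₁ x (1 / 2) := by
      rw [← hG₁0 x]; exact (G₁ x).strictMono (by norm_num)
    have h2 : G₁ x (1 / 2) < 1 := by
      conv_rhs => rw [← hG₁1 x]
      exact (G₁ x).strictMono (by norm_num)
    obtain ⟨a, ha, ha0, ha1⟩ := exists_isDyadic_between (lt_min h1 (by norm_num : (0 : ℝ) < 1 / 2))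
    obtain ⟨b, hb, hb0, hb1⟩ := exists_isDyadic_between (max_lt h2 (by norm_num : (1 : ℝ) / 2 < 1))
    rw [lt_min_iff] at ha1
    rw [max_lt_iff] at hb0
    exact ⟨a, b, ha, hb, ha0, ha1.2.trans hb0.2, hb1, exists_suppPL_apply_eq ha hb hd2
      ((isDyadic_locPL ((mem_liftPL.1 hG₁m).2 x)).2 hd2) ⟨ha1.2, hb0.2⟩ ⟨ha1.1, hb0.1⟩⟩
  -- The map is chosen as a function of the value `d`, not of `x`: the resulting family then
  -- inherits local constancy from `x ↦ G₁ x (1 / 2)`.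
  have hhalf' : ∀ d : ℝ, ∃ f : ℝ ≃o ℝ, (∃ x, G₁ x (1 / 2) = d) → f (1 / 2) = d ∧
      ∃ a b, IsDyadic a ∧ IsDyadic b ∧ 0 < a ∧ a < b ∧ b < 1 ∧ f ∈ suppPL a b := by
    intro d
    by_cases hd : ∃ x, G₁ x (1 / 2) = d
    · obtain ⟨x, rfl⟩ := hd
      obtain ⟨a, b, ha, hb, h0, h1, h2, f, hf, hf2⟩ := hhalf x
      exact ⟨f, fun _ => ⟨hf2, a, b, ha, hb, h0, h1, h2, hf⟩⟩
    · exact ⟨1, fun h => absurd h hd⟩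
  choose F hF using hhalf'
  have hFx : ∀ x, _ := fun x => hF (G₁ x (1 / 2)) ⟨x, rfl⟩
  set v : windowMaps X 0 := ⟨fun x => F (G₁ x (1 / 2)), fun x => by
    obtain ⟨-, a, b, -, -, h0, -, h2, h⟩ := hFx x
    exact suppPL_mono h0.le (by linarith) h, fun x₀ => by
    filter_upwards [liftTop_eventually_apply (mem_liftPL.1 hG₁m).1 (1 / 2) x₀] with x hx
    rw [hx]⟩ with hv
  have hvS : windowHom φ 0 v ∈ S' := windowHom_mem_of_cylGens hS' IsDyadic.zero v fun x => by
    obtain ⟨-, a, b, ha, hb, h0, h1, h2, h⟩ := hFx x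
    exact ⟨a, b, ha, hb, h0, h1, by linarith, h⟩
  set G₂ := (windowHom φ 0 v)⁻¹ * G₁ with hG₂
  have hG₂m : G₂ ∈ liftPL φ := mul_mem (inv_mem (hS'L hvS)) hG₁m
  have hG₂0 : ∀ x, G₂ x 0 = 0 := fun x => by
    simp only [hG₂, Pi.mul_apply, Pi.inv_apply, RelIso.mul_apply]
    have h0 : windowHom φ 0 v x 0 = 0 := by
      rw [windowHom_apply_zero v x (by simp), (v.2.1 x).2 0 (by simp)]
    rw [hG₁0]
    conv_lhs => arg 2; rw [← h0]
    rw [RelIso.inv_apply_self]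
  have hG₂2 : ∀ x, G₂ x (1 / 2) = 1 / 2 := fun x => by
    simp only [hG₂, Pi.mul_apply, Pi.inv_apply, RelIso.mul_apply]
    have h0 : windowHom φ 0 v x (1 / 2) = G₁ x (1 / 2) := by
      rw [windowHom_apply_zero v x (by constructor <;> norm_num)]
      exact (hFx x).1
    rw [← h0, RelIso.inv_apply_self]
  have hG₂1 := hone G₂ hG₂m hG₂0
  -- The windows starting at `-1/4` and `1/4` contain `[0, 1/2]` and `[1/2, 1]` in their interiors,
  -- as `cylGens` requires.
  obtain ⟨v₁, hv₁⟩ := exists_windowMaps_restrict (c := -(1 / 4)) hG₂m IsDyadic.zero hd2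
    (by norm_num) (by norm_num) (by norm_num) hG₂0 hG₂2
  obtain ⟨v₂, hv₂⟩ := exists_windowMaps_restrict (c := 1 / 4) hG₂m hd2 IsDyadic.one
    (by norm_num) (by norm_num) (by norm_num) hG₂2 hG₂1
  have hw₁ : windowHom φ _ v₁ ∈ S' := windowHom_mem_of_cylGens hS' hd4.neg v₁ fun x =>
    ⟨0, 1 / 2, IsDyadic.zero, hd2, by norm_num, by norm_num, by norm_num, (hv₁ x).1⟩
  have hw₂ : windowHom φ _ v₂ ∈ S' := windowHom_mem_of_cylGens hS' hd4 v₂ fun x =>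
    ⟨1 / 2, 1, hd2, IsDyadic.one, by norm_num, by norm_num, by norm_num, (hv₂ x).1⟩
  have hnot : ∀ (n : ℤ), (n : ℝ) < 1 → -1 < (n : ℝ) → n = 0 := by
    intro n h1 h2
    have h1 : n < 1 := by exact_mod_cast h1
    have h2 : -1 < n := by exact_mod_cast h2
    omega
  have heq : G₂ = windowHom φ _ v₁ * windowHom φ _ v₂ := by
    refine liftTop_ext (mem_liftPL.1 hG₂m).1
      (mem_liftPL.1 (hS'L (mul_mem hw₁ hw₂))).1 fun x t ht => ?_
    simp only [Pi.mul_apply, RelIso.mul_apply]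
    rcases le_total t (1 / 2) with h | h
    · rw [windowHom_fix v₂ x, windowHom_apply_zero v₁ x, (hv₁ x).2 t ⟨ht.1, h⟩]
      · constructor <;> linarith [ht.1]
      · refine fun n => (hv₂ _).1.2 _ fun hm => ?_
        have := hnot n (by linarith [ht.1, hm.1]) (by linarith [ht.1, hm.2])
        subst this
        norm_num at hm
        linarith [hm.1]
    · have h3 : windowHom φ _ v₂ x t = G₂ x t := by
        rw [windowHom_apply_zero v₂ x ⟨by linarith, by linarith [ht.2]⟩, (hv₂ x).2 t ⟨h, ht.2⟩]
      have h4 : 1 / 2 ≤ G₂ x t := by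
        rw [← hG₂2 x]; exact (G₂ x).monotone h
      have h5 : G₂ x t ≤ 1 := by
        rw [← hG₂1 x]; exact (G₂ x).monotone ht.2
      rw [h3, windowHom_fix v₁ x]
      refine fun n => (hv₁ _).1.2 _ fun hm => ?_
      have := hnot n (by linarith [hm.1]) (by linarith [hm.2])
      subst this
      norm_num at hm
      linarith [hm.2]
  have hfin : G = h₁ * (windowHom φ 0 v * (windowHom φ _ v₁ * windowHom φ _ v₂)) := by
    rw [← heq, hG₂, hG₁]
    group
  rw [hfin]
  exact mul_mem hh₁ (mul_mem hvS (mul_mem hw₁ hw₂))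

end Fragmentation

/-! ### Normal subgroups and the commutator trick -/

section NormalSubgroups

variable {X : Type*} [TopologicalSpace X] {φ : X ≃ₜ X}

theorem OrderIso.mul_comm_of_disjoint {z r : ℝ ≃o ℝ} (h : ∀ t, z t = t ∨ r t = t) :
    z * r = r * z := by
  ext t
  rw [RelIso.mul_apply, RelIso.mul_apply]
  rcases h t with h1 | h1
  · rw [h1]
    rcases h (r t) with h2 | h2
    · exact h2
    · rw [r.injective h2, h1]
  · rw [h1]
    rcases h (z t) with h2 | h2
    · rw [z.injective h2, h1]
    · exact h2.symm

/-- The integers are discrete: only `δ` itself, if integral, is an integer near `δ`. This leaves a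
single possible return time for a small cylinder. -/
theorem exists_isolating_radius (δ : ℝ) :
    ∃ ε > 0, ∀ n : ℤ, |(n : ℝ) - δ| < 2 * ε → (n : ℝ) = δ := by
  have h0 := Int.floor_le δ
  have h1 := Int.lt_floor_add_one δ
  rcases h0.eq_or_lt with h | h
  · refine ⟨1 / 4, by norm_num, fun n hn => ?_⟩
    rw [← h] at hn ⊢
    have h2 := abs_lt.1 hn
    have h3 : ((n - ⌊δ⌋ : ℤ) : ℝ) < 1 := by push_cast; linarith
    have h4 : (-1 : ℝ) < ((n - ⌊δ⌋ : ℤ) : ℝ) := by push_cast; linarith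
    have h3 : n - ⌊δ⌋ < 1 := by exact_mod_cast h3
    have h4 : -1 < n - ⌊δ⌋ := by exact_mod_cast h4
    have : n = ⌊δ⌋ := by omega
    rw [this]
  · refine ⟨min (δ - ⌊δ⌋) (⌊δ⌋ + 1 - δ) / 2, half_pos (lt_min (by linarith) (by linarith)),
      fun n hn => ?_⟩
    rw [mul_div_cancel₀ _ two_ne_zero, lt_min_iff, abs_lt, abs_lt] at hn
    have h3 : (n : ℝ) < ⌊δ⌋ + 1 := by linarith [hn.2.2]
    have h4 : (⌊δ⌋ : ℝ) < n := by linarith [hn.1.1]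
    have h3 : n < ⌊δ⌋ + 1 := by exact_mod_cast h3
    have h4 : ⌊δ⌋ < n := by exact_mod_cast h4
    omega

/-- A family that moves a point of the suspension moves a cylinder off itself. -/
theorem exists_wandering_cylinder [CompactSpace X] [T2Space X] [TotallyDisconnectedSpace X]
    {G : X → (ℝ ≃o ℝ)} (hG : G ∈ liftTop φ) {x₀ : X} {t₀ : ℝ}
    (h : ∀ n : ℤ, (φ ^ n) x₀ = x₀ → G x₀ t₀ ≠ t₀ + n) :
    ∃ (C : Set X) (a b : ℝ), IsClopen C ∧ x₀ ∈ C ∧ IsDyadic a ∧ IsDyadic b ∧ a < b ∧ b ≤ a + 1 ∧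
      ∀ x ∈ C, ∀ t ∈ Set.Ioo a b, ∀ n : ℤ, (φ ^ n) x ∈ C → G x t - n ∉ Set.Ioo a b := by
  set δ := G x₀ t₀ - t₀ with hδ
  obtain ⟨ε, hε, hεn⟩ := exists_isolating_radius δ
  have hV : IsOpen (Set.Ioo (t₀ - min ε (1 / 4)) (t₀ + min ε (1 / 4)) ∩
      G x₀ ⁻¹' Set.Ioo (G x₀ t₀ - ε) (G x₀ t₀ + ε)) :=
    isOpen_Ioo.inter (isOpen_Ioo.preimage (G x₀).continuous)
  have hε' : 0 < min ε (1 / 4) := lt_min hε (by norm_num)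
  have hεl : min ε (1 / 4) ≤ ε := min_le_left _ _
  have hεr : min ε (1 / 4) ≤ 1 / 4 := min_le_right _ _
  obtain ⟨a, b, ha, hb, hat, htb, hab⟩ := exists_isDyadic_Icc_subset hV (t := t₀)
    ⟨⟨by linarith, by linarith⟩, ⟨by linarith, by linarith⟩⟩
  have ha' := (hab ⟨le_rfl, (hat.trans htb).le⟩).1
  have hb' := (hab ⟨(hat.trans htb).le, le_rfl⟩).1
  -- If the displacement is an integer `m`, the hypothesis forces `φ ^ m x₀ ≠ x₀`, and a clopen set
  -- separates the two points. Otherwise the real coordinate alone prevents a return.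
  have hE : ∃ E : Set X, IsClopen E ∧ x₀ ∈ E ∧ ∀ n : ℤ, (n : ℝ) = δ → (φ ^ n) x₀ ∉ E := by
    by_cases hm : ∃ m : ℤ, (m : ℝ) = δ
    · obtain ⟨m, hm⟩ := hm
      have hne : x₀ ≠ (φ ^ m) x₀ := fun h' => h m h'.symm (by rw [hm, hδ]; ring)
      obtain ⟨E, hE, hx, hEsub⟩ := exists_isClopen_of_eventually (isOpen_ne.mem_nhds hne)
      refine ⟨E, hE, hx, fun n hn hmem => ?_⟩
      have : n = m := by exact_mod_cast hn.trans hm.symm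
      subst this
      exact hEsub _ hmem rfl
    · exact ⟨Set.univ, isClopen_univ, Set.mem_univ _, fun n hn => absurd ⟨n, hn⟩ hm⟩
  obtain ⟨E, hE, hxE, hEn⟩ := hE
  have hev : ∀ᶠ x in 𝓝 x₀, x ∈ E ∧ (∀ n : ℤ, (n : ℝ) = δ → (φ ^ n) x ∉ E) ∧
      ∀ t ∈ Set.Icc (-(|t₀| + 1)) (|t₀| + 1), G x t = G x₀ t := by
    refine Eventually.and (hE.isOpen.mem_nhds hxE) (Eventually.and ?_ (hG.2 x₀ _))
    by_cases hm : ∃ m : ℤ, (m : ℝ) = δ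
    · obtain ⟨m, hm⟩ := hm
      filter_upwards [(φ ^ m).continuous.continuousAt.eventually
        (hE.compl.isOpen.mem_nhds (hEn m hm))] with x hx n hn
      have : n = m := by exact_mod_cast hn.trans hm.symm
      subst this
      exact hx
    · exact Eventually.of_forall fun x n hn => absurd ⟨n, hn⟩ hm
  obtain ⟨C, hC, hxC, hCsub⟩ := exists_isClopen_of_eventually hev
  refine ⟨C, a, b, hC, hxC, ha, hb, hat.trans htb, by linarith [ha'.1, hb'.2],
    fun x hx t ht n hn hmem => ?_⟩
  obtain ⟨-, h2, h3⟩ := hCsub x hx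
  have ht1 := hab ⟨ht.1.le, ht.2.le⟩
  rw [h3 t ⟨by linarith [neg_abs_le t₀, ht1.1.1], by linarith [le_abs_self t₀, ht1.1.2]⟩] at hmem
  -- A return would put `n` within `2 * ε` of the displacement, hence `n = δ`, which `E` excludes.
  refine h2 n (hεn n (abs_lt.2 ?_)) (hCsub _ hn).1
  constructor <;> linarith [hmem.1, hmem.2, ht1.2.1, ht1.2.2, ha'.1, hb'.2]

theorem exists_mem_of_cylMap_ne {C : Set X} (hC : IsClopen C) {c a b : ℝ} {f : ℝ ≃o ℝ}
    (hf : f ∈ suppPL c (c + 1)) (hfab : f ∈ suppPL a b) {x : X} {t : ℝ}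
    (h : cylMap φ hC hf x t ≠ t) : ∃ n : ℤ, (φ ^ n) x ∈ C ∧ t - n ∈ Set.Ioo a b := by
  by_contra! h'
  exact h (cylMap_fix hC hf fun n hn => hfab.2 _ (h' n hn))

variable {N : Subgroup (X → (ℝ ≃o ℝ))}

/-- If a normal subgroup contains a family displacing a cylinder, then it contains the commutators
of the maps supported in this cylinder. -/
theorem commutator_cylMap_mem (hN : ∀ g ∈ liftPL φ, ∀ h ∈ N, g * h * g⁻¹ ∈ N)
    {G : X → (ℝ ≃o ℝ)} (hGN : G ∈ N) (hG : G ∈ liftTop φ) {C₀ C : Set X} {a b : ℝ}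
    (ha : IsDyadic a)
    (hdisj : ∀ x ∈ C₀, ∀ t ∈ Set.Ioo a b, ∀ n : ℤ, (φ ^ n) x ∈ C₀ → G x t - n ∉ Set.Ioo a b)
    (hC : IsClopen C) (hCC : C ⊆ C₀) {f₁ f₂ : ℝ ≃o ℝ} (hf₁ : f₁ ∈ suppPL a (a + 1))
    (hf₂ : f₂ ∈ suppPL a (a + 1)) (hf₁' : f₁ ∈ suppPL a b) (hf₂' : f₂ ∈ suppPL a b) :
    ⁅cylMap φ hC hf₁, cylMap φ hC hf₂⁆ ∈ N := by
  set R₁ := cylMap φ hC hf₁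
  set R₂ := cylMap φ hC hf₂ with hR₂
  have hR₁m : R₁ ∈ liftPL φ := cylMap_mem hC hf₁ ha
  have hR₂m : R₂ ∈ liftPL φ := cylMap_mem hC hf₂ ha
  -- The conjugate lives on the image of the cylinder under `G`, which is disjoint from the support
  -- of `R₂`.
  have hcomm : G * R₁⁻¹ * G⁻¹ * R₂ = R₂ * (G * R₁⁻¹ * G⁻¹) := by
    funext x
    refine OrderIso.mul_comm_of_disjoint fun t => ?_
    by_contra! hcon
    obtain ⟨h1, h2⟩ := hcon
    obtain ⟨n, hn, hnt⟩ := exists_mem_of_cylMap_ne hC hf₂ hf₂' h2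
    have h3 : (R₁⁻¹) x ((G x)⁻¹ t) ≠ (G x)⁻¹ t := by
      intro h3
      refine h1 ?_
      simp only [Pi.mul_apply, Pi.inv_apply, RelIso.mul_apply] at h3 ⊢
      rw [h3, RelIso.apply_inv_self]
    have hinv : R₁⁻¹ = cylMap φ hC (inv_mem hf₁) := (cylMap_inv hC hf₁).symm
    rw [hinv] at h3
    obtain ⟨m, hm, hmt⟩ := exists_mem_of_cylMap_ne hC _ (inv_mem hf₁') h3
    have h4 := hG.1 x ((G x)⁻¹ t) m
    rw [RelIso.apply_inv_self] at h4
    refine hdisj _ (hCC hm) _ hmt (n - m) ?_ ?_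
    · rw [← Homeomorph.zpow_add_apply, sub_add_cancel]; exact hCC hn
    · rw [h4]; push_cast; rwa [sub_sub_sub_cancel_right]
  -- This is `⁅R₁, G⁆`. Its commutator with `R₂` lies in `N` and collapses to `⁅R₁, R₂⁆`, since `R₂`
  -- does not see the second factor.
  have hK : R₁ * (G * R₁⁻¹ * G⁻¹) ∈ N := by
    have := mul_mem (hN R₁ hR₁m G hGN) (inv_mem hGN)
    simpa [mul_assoc] using this
  have h5 := mul_mem hK (hN R₂ hR₂m _ (inv_mem hK))
  have h6 : R₁ * (G * R₁⁻¹ * G⁻¹) * (R₂ * (R₁ * (G * R₁⁻¹ * G⁻¹))⁻¹ * R₂⁻¹) = ⁅R₁, R₂⁆ := by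
    rw [commutatorElement_def]
    calc R₁ * (G * R₁⁻¹ * G⁻¹) * (R₂ * (R₁ * (G * R₁⁻¹ * G⁻¹))⁻¹ * R₂⁻¹)
        = R₁ * (G * R₁⁻¹ * G⁻¹ * R₂) * (G * R₁⁻¹ * G⁻¹)⁻¹ * R₁⁻¹ * R₂⁻¹ := by group
      _ = R₁ * (R₂ * (G * R₁⁻¹ * G⁻¹)) * (G * R₁⁻¹ * G⁻¹)⁻¹ * R₁⁻¹ * R₂⁻¹ := by rw [hcomm]
      _ = R₁ * R₂ * R₁⁻¹ * R₂⁻¹ := by group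
  rwa [h6] at h5

/-- Over a fixed base, passing from `f` to its cylinder map is multiplicative, so the maps `f` that
land in `N` form a subgroup. It suffices to check commutators, which generate. -/
theorem cylMap_mem_of_mem_commutator {C : Set X} (hC : IsClopen C) {a b : ℝ} (hab : b ≤ a + 1)
    (h : ∀ f₁ f₂ : ℝ ≃o ℝ, ∀ (hf₁ : f₁ ∈ suppPL a (a + 1)) (hf₂ : f₂ ∈ suppPL a (a + 1)),
      f₁ ∈ suppPL a b → f₂ ∈ suppPL a b → ⁅cylMap φ hC hf₁, cylMap φ hC hf₂⁆ ∈ N)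
    {f : ℝ ≃o ℝ} (hf : f ∈ suppPL a (a + 1)) (hfc : f ∈ ⁅suppPL a b, suppPL a b⁆) :
    cylMap φ hC hf ∈ N := by
  let H : Subgroup (ℝ ≃o ℝ) :=
    { carrier := {f | ∃ hf : f ∈ suppPL a (a + 1), cylMap φ hC hf ∈ N}
      one_mem' := ⟨one_mem _, by rw [cylMap_one]; exact one_mem _⟩
      mul_mem' := fun ⟨h1, h2⟩ ⟨h3, h4⟩ =>
        ⟨mul_mem h1 h3, by rw [cylMap_mul hC h1 h3]; exact mul_mem h2 h4⟩
      inv_mem' := fun ⟨h1, h2⟩ => ⟨inv_mem h1, by rw [cylMap_inv hC h1]; exact inv_mem h2⟩ }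
  have hH : ⁅suppPL a b, suppPL a b⁆ ≤ H := by
    refine Subgroup.commutator_le.2 fun f₁ hf₁ f₂ hf₂ => ?_
    have h1 := suppPL_mono le_rfl hab hf₁
    have h2 := suppPL_mono le_rfl hab hf₂
    have h3 := h f₁ f₂ h1 h2 hf₁ hf₂
    have h4 : ⁅f₁, f₂⁆ ∈ suppPL a (a + 1) :=
      mul_mem (mul_mem (mul_mem h1 h2) (inv_mem h1)) (inv_mem h2)
    refine ⟨h4, ?_⟩
    have h5 : cylMap φ hC h4 = ⁅cylMap φ hC h1, cylMap φ hC h2⁆ := by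
      rw [commutatorElement_def (cylMap φ hC h1), ← cylMap_inv, ← cylMap_inv, ← cylMap_mul, ← cylMap_mul,
        ← cylMap_mul]
    rwa [h5]
  obtain ⟨_, h1⟩ := hH hfc
  exact h1

/-- The translation flow at time `s`. -/
noncomputable def flowLift (X : Type*) (s : ℝ) : X → (ℝ ≃o ℝ) := fun _ => transl s

theorem flowLift_mem {s : ℝ} (hs : IsDyadic s) : flowLift X s ∈ liftPL φ := by
  rw [mem_liftPL]
  refine ⟨⟨fun x t n => ?_, fun _ _ => Eventually.of_forall fun _ _ _ => rfl⟩,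
    fun _ => transl_mem hs⟩
  simp only [flowLift, transl_apply]
  ring

/-- Conjugation by the flow, combined with the change of cross-section by `φ ^ n`. -/
theorem flowLift_conj_cylMap {C : Set X} (hC : IsClopen C) {c r s : ℝ} (n : ℤ) (hr : r = s - n)
    {f : ℝ ≃o ℝ} (hf : f ∈ suppPL c (c + 1))
    (hf' : transl r * f * (transl r)⁻¹ ∈ suppPL (c + r) (c + r + 1)) :
    flowLift X s * cylMap φ hC hf * (flowLift X s)⁻¹ =
      cylMap φ (hC.preimage (φ ^ (-n)).continuous) hf' := by
  ext x t
  simp only [Pi.mul_apply, Pi.inv_apply, RelIso.mul_apply, flowLift, transl_inv_apply,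
    transl_apply]
  have h1 := sub_floor_mem t (c + r)
  set j := ⌊t - (c + r)⌋
  have h2 : t - s - (j - n : ℤ) ∈ Set.Icc c (c + 1) := by
    push_cast
    constructor <;> linarith [h1.1, h1.2]
  have h3 : (φ ^ (j - n)) x = (φ ^ (-n)) ((φ ^ j) x) := by
    rw [← Homeomorph.zpow_add_apply, neg_add_eq_sub]
  by_cases h : (φ ^ (j - n)) x ∈ C
  · rw [cylMap_apply_of_mem hC hf _ h h2, cylMap_apply_of_mem _ hf' j (by
      rw [Set.mem_preimage, ← h3]; exact h) h1]
    simp only [RelIso.mul_apply, transl_inv_apply, transl_apply]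
    have h4 : t - s - (j - n : ℤ) = t - j - r := by rw [hr]; push_cast; ring
    rw [h4, hr]
    push_cast
    ring
  · rw [cylMap_apply_of_notMem hC hf _ h h2, cylMap_apply_of_notMem _ hf' j (by
      rw [Set.mem_preimage, ← h3]; exact h) h1]
    ring

theorem mem_of_conj_mem (hN : ∀ g ∈ liftPL φ, ∀ h ∈ N, g * h * g⁻¹ ∈ N) {g h : X → (ℝ ≃o ℝ)}
    (hg : g ∈ liftPL φ) (h1 : g * h * g⁻¹ ∈ N) : h ∈ N := by
  have := hN g⁻¹ (inv_mem hg) _ h1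
  simpa [mul_assoc] using this

variable [CompactSpace X] [T2Space X] [TotallyDisconnectedSpace X]

/-- For a minimal system, a normal subgroup of the lifted group that acts non-trivially on the
suspension is everything. -/
theorem liftPL_le_of_normal (hφ : IsMinimalSystem φ)
    (hN : ∀ g ∈ liftPL φ, ∀ h ∈ N, g * h * g⁻¹ ∈ N)
    {G : X → (ℝ ≃o ℝ)} (hGN : G ∈ N) (hG : G ∈ liftPL φ) {x₀ : X} {t₀ : ℝ}
    (h : ∀ n : ℤ, (φ ^ n) x₀ = x₀ → G x₀ t₀ ≠ t₀ + n) : liftPL φ ≤ N := by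
  have : Nonempty X := ⟨x₀⟩
  have hGt := (mem_liftPL.1 hG).1
  obtain ⟨C₀, a₀, b₀, hC₀, hx₀, ha₀, hb₀, hab, hab1, hdisj⟩ := exists_wandering_cylinder hGt h
  refine liftPL_le_of_cylGens ?_
  rintro _ ⟨c, a, b, C, hC, f, hf, hc, ha, hb, hca, hlt, hbc, hfab, rfl⟩
  refine clopen_induction (Q := fun C => ∀ hC : IsClopen C, cylMap φ hC hf ∈ N) ?_ ?_ ?_ hC hC
  · intro hC
    have : cylMap φ hC hf = 1 := by
      ext x t
      exact cylMap_fix hC hf fun n hn => absurd hn (Set.notMem_empty _)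
    rw [this]
    exact one_mem _
  · intro x
    -- The only use of minimality: some power of `φ` brings `x` into `C₀`.
    obtain ⟨_, hn, ⟨n, rfl⟩⟩ := (hφ x).inter_open_nonempty C₀ hC₀.isOpen ⟨x₀, hx₀⟩
    refine ⟨(φ ^ n) ⁻¹' C₀, hC₀.preimage (φ ^ n).continuous, hn, fun D hD hDC hD' => ?_⟩
    set r := a₀ - c with hr
    have hrd : IsDyadic r := ha₀.sub hc
    have hsd : IsDyadic (r + n) := hrd.add (IsDyadic.intCast n)
    have hcr : c + r = a₀ := by rw [hr]; ring
    -- Flowing for time `r + n` carries the window at `c` to the window at `a₀`, while the integral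
    -- part `n` moves the base into `C₀`.
    refine mem_of_conj_mem hN (flowLift_mem hsd) ?_
    have hf₁ : transl r * f * (transl r)⁻¹ ∈ suppPL (a + r) (b + r) :=
      conj_mem_suppPL (transl_mem hrd) hfab
    have hf₁' : transl r * f * (transl r)⁻¹ ∈ suppPL (c + r) (c + r + 1) :=
      suppPL_mono (by linarith) (by linarith) hf₁
    rw [flowLift_conj_cylMap hD' n (by ring : r = r + n - n) hf hf₁']
    generalize hf₂ : transl r * f * (transl r)⁻¹ = f₂ at *
    rw [hcr] at hf₁'
    obtain ⟨u, hu, hu1, hu2⟩ := exists_isDyadic_between hab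
    obtain ⟨v, hv, hv1, hv2⟩ := exists_isDyadic_between hu2
    -- The support may be too long for `(a₀, b₀)`. The map `k` of the window compresses it to `(u,
    -- v)`, which leaves the room inside `(a₀, b₀)` that perfectness needs.
    obtain ⟨k, hk, hku, hkv⟩ := exists_suppPL_apply_eq₂ ha₀ (ha₀.add IsDyadic.one)
      (ha.add hrd) hu (hb.add hrd) hv (by linarith) (by linarith) (by linarith) hu1 hv1
      (by linarith)
    have hD₂ := hD'.preimage (φ ^ (-n)).continuous
    have hD₂C : (φ ^ (-n)) ⁻¹' D ⊆ C₀ := by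
      intro y hy
      have := hDC hy
      rwa [Set.mem_preimage, ← Homeomorph.zpow_add_apply, add_neg_cancel, zpow_zero] at this
    have hconj : k * f₂ * k⁻¹ ∈ suppPL u v := by
      have := conj_mem_suppPL hk.1 hf₁
      rwa [hku, hkv] at this
    have hmem : k * f₂ * k⁻¹ ∈ ⁅suppPL a₀ b₀, suppPL a₀ b₀⁆ :=
      suppPL_le_commutator hu hv ha₀ hb₀ hu1 hv1.le hv2 hconj
    have h1 := cylMap_mem_of_mem_commutator hD₂ hab1 (fun f₁ f₂ hf₁ hf₂ hf₁' hf₂' =>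
      commutator_cylMap_mem hN hGN hGt ha₀ hdisj hD₂ hD₂C hf₁ hf₂ hf₁' hf₂')
      (mul_mem (mul_mem hk hf₁') (inv_mem hk)) hmem
    rw [cylMap_mul hD₂ (mul_mem hk hf₁') (inv_mem hk), cylMap_mul hD₂ hk hf₁', cylMap_inv hD₂ hk] at h1
    have h2 := mem_of_conj_mem hN (cylMap_mem hD₂ hk ha₀) h1
    convert h2 using 2
  · intro C D hC hD hCD h1 h2 h
    rw [cylMap_union hC hf hD hCD]
    exact mul_mem (h1 hC) (h2 hD)

end NormalSubgroups

/-! ### From equivariant families to homeomorphisms of the suspension -/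

section SuspensionMaps

variable {X : Type*} [TopologicalSpace X] {φ : X ≃ₜ X}

/-- The `ℤ`-action on `X × ℝ` whose quotient is the suspension. -/
@[reducible] def suspensionAction (φ : X ≃ₜ X) : AddAction ℤ (X × ℝ) where
  vadd n p := ((φ ^ n) p.1, p.2 - n)
  zero_vadd p := by
    change ((φ ^ (0 : ℤ)) p.1, p.2 - ((0 : ℤ) : ℝ)) = p
    simp
  add_vadd m n p := by
    change ((φ ^ (m + n)) p.1, p.2 - ((m + n : ℤ) : ℝ)) = ((φ ^ m) ((φ ^ n) p.1), p.2 - n - m)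
    rw [Homeomorph.zpow_add_apply]
    push_cast
    congr 1
    ring

/-- The group `ℤ` acts by integer translations on the real coordinate, so strips of width `1/2` are
disjoint from their nontrivial translates, even over periodic points of `φ`. -/
theorem Suspension.isCoveringMap_mk (φ : X ≃ₜ X) :
    IsCoveringMap (fun p : X × ℝ => Suspension.mk φ p.1 p.2) := by
  let := suspensionAction φ
  refine IsAddQuotientCoveringMap.isCoveringMap _ ℤ
    { isQuotientMap_quotient_mk' (s := suspensionSetoid φ) with
      continuous_const_vadd := fun n =>
        ((φ ^ n).continuous.comp continuous_fst).prodMk (continuous_snd.sub continuous_const)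
      apply_eq_iff_mem_orbit := ?_
      disjoint := ?_ }
  · intro p q
    rw [eq_comm, Suspension.mk_eq_mk, AddAction.mem_orbit_iff]
    exact exists_congr fun n => ⟨fun h => Prod.ext h.1.symm h.2.symm,
      fun h => ⟨(congrArg Prod.fst h).symm, (congrArg Prod.snd h).symm⟩⟩
  · intro p
    refine ⟨Prod.snd ⁻¹' Set.Ioo (p.2 - 1 / 4) (p.2 + 1 / 4),
      continuous_snd.continuousAt.preimage_mem_nhds
        (Ioo_mem_nhds (by linarith) (by linarith)), ?_⟩
    rintro n ⟨_, ⟨q, hq, rfl⟩, hq'⟩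
    have h1 : q.2 - n ∈ Set.Ioo (p.2 - 1 / 4) (p.2 + 1 / 4) := hq'
    have h2 : q.2 ∈ Set.Ioo (p.2 - 1 / 4) (p.2 + 1 / 4) := hq
    have h3 : (n : ℝ) < 1 := by linarith [h1.1, h2.2]
    have h4 : (-1 : ℝ) < n := by linarith [h1.2, h2.1]
    have h3 : n < 1 := by exact_mod_cast h3
    have h4 : -1 < n := by exact_mod_cast h4
    omega

theorem Suspension.isOpenQuotientMap_mk (φ : X ≃ₜ X) :
    IsOpenQuotientMap (fun p : X × ℝ => Suspension.mk φ p.1 p.2) :=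
  ⟨fun y => by
    obtain ⟨x, t, h⟩ := Suspension.exists_mk φ y
    exact ⟨(x, t), h.symm⟩, (Suspension.isCoveringMap_mk φ).continuous,
    (Suspension.isCoveringMap_mk φ).isOpenMap⟩

theorem Suspension.continuous_mk (φ : X ≃ₜ X) :
    Continuous (fun p : X × ℝ => Suspension.mk φ p.1 p.2) :=
  (Suspension.isCoveringMap_mk φ).continuous

theorem liftTop_eventually_prod {G : X → (ℝ ≃o ℝ)} (hG : G ∈ liftTop φ) (x₀ : X) (t₀ : ℝ) :
    ∀ᶠ p in 𝓝 (x₀, t₀), G p.1 p.2 = G x₀ p.2 := by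
  rw [nhds_prod_eq]
  have h1 := hG.2 x₀ (|t₀| + 1)
  have h2 : Set.Icc (-(|t₀| + 1)) (|t₀| + 1) ∈ 𝓝 t₀ :=
    Icc_mem_nhds (by linarith [neg_abs_le t₀]) (by linarith [le_abs_self t₀])
  filter_upwards [h1.prod_mk h2] with p hp
  exact hp.1 _ hp.2

theorem continuous_liftTop {G : X → (ℝ ≃o ℝ)} (hG : G ∈ liftTop φ) :
    Continuous fun p : X × ℝ => G p.1 p.2 := by
  refine continuous_iff_continuousAt.2 fun p => ?_
  refine ContinuousAt.congr (f := fun q : X × ℝ => G p.1 q.2)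
    ((G p.1).continuous.comp continuous_snd).continuousAt ?_
  filter_upwards [liftTop_eventually_prod hG p.1 p.2] with q hq using hq.symm

/-- The self-map of the suspension induced by an equivariant family. -/
def suspMap (G : liftTop φ) : Suspension φ → Suspension φ :=
  Quotient.lift (fun p : X × ℝ => Suspension.mk φ p.1 ((G : X → (ℝ ≃o ℝ)) p.1 p.2)) (by
    rintro p _ ⟨n, rfl⟩
    exact (Suspension.mk_eq_mk φ _ _ _ _).2 ⟨n, rfl, G.2.1 _ _ _⟩)

theorem continuous_suspMap (G : liftTop φ) : Continuous (suspMap G) := by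
  rw [(Suspension.isOpenQuotientMap_mk φ).isQuotientMap.continuous_iff]
  exact (Suspension.continuous_mk φ).comp (continuous_fst.prodMk (continuous_liftTop G.2))

theorem suspMap_mul (G H : liftTop φ) (y : Suspension φ) :
    suspMap (G * H) y = suspMap G (suspMap H y) := by
  obtain ⟨x, t, rfl⟩ := Suspension.exists_mk φ y
  rfl

theorem suspMap_one (y : Suspension φ) : suspMap (1 : liftTop φ) y = y := by
  obtain ⟨x, t, rfl⟩ := Suspension.exists_mk φ y
  rfl

/-- The action of the lifted group on the suspension. -/
def suspHom (φ : X ≃ₜ X) : liftTop φ →* (Suspension φ ≃ₜ Suspension φ) where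
  toFun G :=
    { toFun := suspMap G
      invFun := suspMap G⁻¹
      left_inv := fun y => by rw [← suspMap_mul, inv_mul_cancel, suspMap_one]
      right_inv := fun y => by rw [← suspMap_mul, mul_inv_cancel, suspMap_one]
      continuous_toFun := continuous_suspMap G
      continuous_invFun := continuous_suspMap G⁻¹ }
  map_one' := by
    ext y
    exact suspMap_one y
  map_mul' G H := by
    ext y
    exact suspMap_mul G H y

theorem suspHom_mk (G : liftTop φ) (x : X) (t : ℝ) :
    suspHom φ G (Suspension.mk φ x t) = Suspension.mk φ x ((G : X → (ℝ ≃o ℝ)) x t) := rfl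

/-! ### Isotopies -/

/-- Linear interpolation between the identity and an increasing bijection of the line. -/
noncomputable def interp (s : unitInterval) (f : ℝ ≃o ℝ) : ℝ ≃o ℝ :=
  StrictMono.orderIsoOfSurjective (fun t : ℝ => (1 - (s : ℝ)) * t + s * f t)
    (fun t t' h => by
      have h1 := f.strictMono h
      have h2 := s.2.1
      have h3 := s.2.2
      simp only
      rcases h2.eq_or_lt with h4 | h4
      · rw [← h4]; linarith
      · nlinarith)
    (fun y => by
      have hc : Continuous (fun t : ℝ => (1 - (s : ℝ)) * t + s * f t) :=
        (continuous_const.mul continuous_id).add (continuous_const.mul f.continuous)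
      have h2 := s.2.1
      have h3 := s.2.2
      -- At the minimum of `y` and `f.symm y` both interpolated terms are at most `y`, at the
      -- maximum both are at least `y`; the intermediate value theorem applies in between.
      have h5 : f (min y (f.symm y)) ≤ y := by
        simp
      have h6 : y ≤ f (max y (f.symm y)) := by
        simp
      exact mem_range_of_exists_le_of_exists_ge hc
        ⟨min y (f.symm y), by nlinarith [min_le_left y (f.symm y)]⟩
        ⟨max y (f.symm y), by nlinarith [le_max_left y (f.symm y)]⟩)

theorem interp_apply (s : unitInterval) (f : ℝ ≃o ℝ) (t : ℝ) :
    interp s f t = (1 - (s : ℝ)) * t + s * f t := rfl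

theorem interp_mem (s : unitInterval) {G : X → (ℝ ≃o ℝ)} (hG : G ∈ liftTop φ) :
    (fun x => interp s (G x)) ∈ liftTop φ := by
  refine ⟨fun x t n => ?_, fun x₀ K => ?_⟩
  · rw [interp_apply, interp_apply, hG.1]
    ring
  · filter_upwards [hG.2 x₀ K] with x hx t ht
    rw [interp_apply, interp_apply, hx t ht]

theorem suspHom_mem_isotopicToId (G : liftTop φ) : suspHom φ G ∈ isotopicToId (Suspension φ) := by
  refine ⟨fun s => suspHom φ ⟨_, interp_mem s G.2⟩, ?_, ?_, ?_⟩
  · rw [((IsOpenQuotientMap.id (X := unitInterval)).prodMap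
      (Suspension.isOpenQuotientMap_mk φ)).isQuotientMap.continuous_iff]
    have h1 : Continuous fun p : unitInterval × (X × ℝ) => (p.1 : ℝ) :=
      continuous_subtype_val.comp continuous_fst
    have h2 : Continuous fun p : unitInterval × (X × ℝ) => (G : X → (ℝ ≃o ℝ)) p.2.1 p.2.2 :=
      (continuous_liftTop G.2).comp continuous_snd
    have h3 : Continuous fun p : unitInterval × (X × ℝ) =>
        (1 - (p.1 : ℝ)) * p.2.2 + p.1 * (G : X → (ℝ ≃o ℝ)) p.2.1 p.2.2 :=
      ((continuous_const.sub h1).mul (continuous_snd.comp continuous_snd)).add (h1.mul h2)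
    have h4 : Continuous fun p : unitInterval × (X × ℝ) => p.2.1 :=
      continuous_fst.comp continuous_snd
    exact (Suspension.continuous_mk φ).comp (h4.prodMk h3)
  · ext y
    obtain ⟨x, t, rfl⟩ := Suspension.exists_mk φ y
    rw [suspHom_mk, Homeomorph.one_apply]
    simp [interp_apply]
  · ext y
    obtain ⟨x, t, rfl⟩ := Suspension.exists_mk φ y
    rw [suspHom_mk, suspHom_mk]
    simp [interp_apply]

/-! ### Local dyadic charts of lifted families -/

/-- The passage from one-sided germs to the finitely many breakpoints of `IsDyadicPL`: each affine
piece adds at most its left end. -/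
theorem exists_pieces_of_locPL {f : ℝ ≃o ℝ} (hf : f ∈ locPL) {a b : ℝ} (ha : IsDyadic a)
    (hb : IsDyadic b) (hab : a ≤ b) : ∃ S : Finset ℝ, (∀ s ∈ S, IsDyadic s) ∧
    ∀ u v : ℝ, Set.Ioo u v ⊆ Set.Ioo a b \ (S : Set ℝ) →
      ∃ (m : ℤ) (β : ℝ), IsDyadic β ∧ ∀ t ∈ Set.Ioo u v, f t = (2 : ℝ) ^ m * t + β := by
  classical
  refine locPL_induction hf ha hb hab (Q := fun b => ∃ S : Finset ℝ, (∀ s ∈ S, IsDyadic s) ∧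
    ∀ u v : ℝ, Set.Ioo u v ⊆ Set.Ioo a b \ (S : Set ℝ) →
      ∃ (m : ℤ) (β : ℝ), IsDyadic β ∧ ∀ t ∈ Set.Ioo u v, f t = (2 : ℝ) ^ m * t + β) ?_ ?_
  · refine ⟨∅, by simp, fun u v h => ⟨0, 0, IsDyadic.zero, fun t ht => ?_⟩⟩
    have := (h ht).1
    simp at this
  · rintro s s' hs - - hss' ⟨m, β, hβ, h⟩ ⟨S, hS, hSp⟩
    refine ⟨insert s S, fun r hr => ?_, fun u v huv => ?_⟩
    · rcases Finset.mem_insert.1 hr with rfl | hr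
      · exact hs
      · exact hS r hr
    · by_cases hvs : v ≤ s
      · refine hSp u v fun t ht => ⟨⟨(huv ht).1.1, ht.2.trans_le hvs⟩, fun htS => (huv ht).2 ?_⟩
        exact Finset.mem_coe.2 (Finset.mem_insert_of_mem htS)
      · by_cases hus : s ≤ u
        · exact ⟨m, β, hβ, fun t ht => h t ⟨hus.trans ht.1.le, (huv ht).1.2.le⟩⟩
        · exact absurd (Finset.mem_coe.2 (Finset.mem_insert_self s S))
            (huv ⟨not_le.1 hus, not_le.1 hvs⟩).2

/-- The restriction of an increasing bijection of the line to an open interval. -/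
def restrIoo (f : ℝ ≃o ℝ) (a b : ℝ) : OpenPartialHomeomorph ℝ ℝ :=
  f.toHomeomorph.toOpenPartialHomeomorph.restrOpen (Set.Ioo a b) isOpen_Ioo

theorem isDyadicPL_restrIoo {f : ℝ ≃o ℝ} (hf : f ∈ locPL) {a b : ℝ} (ha : IsDyadic a)
    (hb : IsDyadic b) (hab : a ≤ b) : IsDyadicPL (restrIoo f a b) a b (f a) (f b) where
  source_eq := by
    rw [restrIoo, OpenPartialHomeomorph.restrOpen_source]
    simp
  target_eq := by
    have : (restrIoo f a b).target = Set.univ ∩ f.symm ⁻¹' Set.Ioo a b := rfl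
    rw [this]
    ext s
    simp only [Set.univ_inter, Set.mem_preimage, Set.mem_Ioo]
    rw [OrderIso.lt_symm_apply, OrderIso.symm_apply_lt]
  dyadic_a := ha
  dyadic_b := hb
  dyadic_c := (isDyadic_locPL hf).2 ha
  dyadic_d := (isDyadic_locPL hf).2 hb
  pieces := exists_pieces_of_locPL hf ha hb hab

theorem isDyadicChart_of_lt_one {C : Set X} (hC : IsClopen C) {a b : ℝ} (ha : IsDyadic a)
    (hb : IsDyadic b) (h : b - a < 1) : IsDyadicChart φ C a b :=
  ⟨hC, ha, hb, fun n hn _ => h.trans_le (by exact_mod_cast hn)⟩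

variable [CompactSpace X] [T2Space X] [TotallyDisconnectedSpace X]

theorem isLocallyDyadicPL_suspHom {G : X → (ℝ ≃o ℝ)} (hG : G ∈ liftPL φ) :
    IsLocallyDyadicPL φ (suspHom φ ⟨G, (mem_liftPL.1 hG).1⟩) := by
  intro y
  obtain ⟨x₀, t₀, rfl⟩ := Suspension.exists_mk φ y
  have hG' := mem_liftPL.1 hG
  have hV : IsOpen (Set.Ioo (t₀ - 1 / 4) (t₀ + 1 / 4) ∩
      G x₀ ⁻¹' Set.Ioo (G x₀ t₀ - 1 / 4) (G x₀ t₀ + 1 / 4)) :=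
    isOpen_Ioo.inter (isOpen_Ioo.preimage (G x₀).continuous)
  obtain ⟨a, b, ha, hb, hat, htb, hab⟩ := exists_isDyadic_Icc_subset hV (t := t₀)
    ⟨⟨by linarith, by linarith⟩, ⟨by linarith, by linarith⟩⟩
  have hle := (hat.trans htb).le
  have ha' := hab ⟨le_rfl, hle⟩
  have hb' := hab ⟨hle, le_rfl⟩
  obtain ⟨C, hC, hxC, hCsub⟩ := exists_isClopen_of_eventually (hG'.1.2 x₀ (|t₀| + 1))
  have hPL := isDyadicPL_restrIoo (hG'.2 x₀) ha hb hle
  refine ⟨C, a, b, _, _, restrIoo (G x₀) a b, isDyadicChart_of_lt_one hC ha hb ?_,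
    isDyadicChart_of_lt_one hC hPL.dyadic_c hPL.dyadic_d ?_, hPL,
    ⟨x₀, hxC, t₀, ⟨hat, htb⟩, rfl⟩, fun x hx t ht => ?_⟩
  · linarith [ha'.1.1, hb'.1.2]
  · linarith [ha'.2.1, hb'.2.2]
  · rw [suspHom_mk]
    change Suspension.mk φ x (G x t) = Suspension.mk φ x (G x₀ t)
    rw [hCsub x hx t]
    constructor
    · linarith [neg_abs_le t₀, ha'.1.1, ht.1]
    · linarith [le_abs_self t₀, hb'.1.2, ht.2]

end SuspensionMaps

/-! ### Lifting elements of the group to equivariant families -/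

section Lifting

variable {X : Type*} [TopologicalSpace X] {φ : X ≃ₜ X}

theorem IsDyadicPL.exists_right {f : OpenPartialHomeomorph ℝ ℝ} {a b c d : ℝ}
    (hf : IsDyadicPL f a b c d) {t : ℝ} (ht : t ∈ Set.Ioo a b) :
    ∃ v > t, ∃ (m : ℤ) (β : ℝ), IsDyadic β ∧ ∀ s ∈ Set.Ico t v, f s = (2 : ℝ) ^ m * s + β := by
  obtain ⟨S, -, hS⟩ := hf.pieces
  have h1 : Set.Ioo a b \ ((S : Set ℝ) \ {t}) ∈ 𝓝 t := by
    refine IsOpen.mem_nhds ?_ ⟨ht, by simp⟩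
    exact isOpen_Ioo.sdiff (S.finite_toSet.subset Set.sdiff_subset).isClosed
  obtain ⟨u, v, ⟨hu, hv⟩, huv⟩ := mem_nhds_iff_exists_Ioo_subset.1 h1
  obtain ⟨m, β, hβ, h⟩ := hS t v (fun s hs => by
    have h2 := huv ⟨hu.trans hs.1, hs.2⟩
    exact ⟨h2.1, fun h3 => h2.2 ⟨h3, hs.1.ne'⟩⟩)
  refine ⟨v, hv, m, β, hβ, fun s hs => ?_⟩
  rcases hs.1.eq_or_lt with rfl | hst
  · have hc : Tendsto f (𝓝[>] t) (𝓝 (f t)) :=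
      (f.continuousAt (by rw [hf.source_eq]; exact ht)).tendsto.mono_left nhdsWithin_le_nhds
    have hc' : Tendsto (fun r : ℝ => (2 : ℝ) ^ m * r + β) (𝓝[>] t) (𝓝 ((2 : ℝ) ^ m * t + β)) :=
      (Continuous.tendsto (by fun_prop) t).mono_left nhdsWithin_le_nhds
    refine tendsto_nhds_unique hc (hc'.congr' ?_)
    filter_upwards [Ioo_mem_nhdsGT hs.2] with r hr
    exact (h r hr).symm
  · exact h s ⟨hst, hs.2⟩

theorem IsDyadicPL.isDyadicAffineAlong {f : OpenPartialHomeomorph ℝ ℝ} {a b c d : ℝ}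
    (hf : IsDyadicPL f a b c d) {t : ℝ} (ht : t ∈ Set.Ioo a b) :
    IsDyadicAffineAlong f (𝓝[≥] t) ∧ IsDyadicAffineAlong f (𝓝[≤] t) ∧
      (¬ IsDyadic t → IsDyadicAffineAlong f (𝓝 t)) := by
  refine ⟨?_, ?_, fun htd => ?_⟩
  · obtain ⟨v, hv, m, β, hβ, h⟩ := hf.exists_right ht
    exact ⟨m, β, hβ, by filter_upwards [Ico_mem_nhdsGE hv] with s hs using h s hs⟩
  · obtain ⟨v, hv, m, β, hβ, h⟩ := hf.exists_left ht
    exact ⟨m, β, hβ, by filter_upwards [Ioc_mem_nhdsLE hv] with s hs using h s hs⟩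
  · obtain ⟨S, hSd, hS⟩ := hf.pieces
    have h1 : Set.Ioo a b \ (S : Set ℝ) ∈ 𝓝 t :=
      (isOpen_Ioo.sdiff S.finite_toSet.isClosed).mem_nhds ⟨ht, fun h => htd (hSd t h)⟩
    obtain ⟨u, v, huv, hsub⟩ := mem_nhds_iff_exists_Ioo_subset.1 h1
    obtain ⟨m, β, hβ, h⟩ := hS u v hsub
    exact ⟨m, β, hβ, by filter_upwards [Ioo_mem_nhds huv.1 huv.2] with s hs using h s hs⟩

theorem eq_of_continuous_of_forall_int {α : Type*} [TopologicalSpace α] [PreconnectedSpace α]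
    {b : α → ℝ} (hb : Continuous b) (h : ∀ s, ∃ m : ℤ, b s = m) (s s' : α) : b s = b s' := by
  choose m hm using h
  have hm' : Continuous m := by
    rw [Int.isClosedEmbedding_coe_real.isEmbedding.continuous_iff]
    convert hb using 1
    funext s
    exact (hm s).symm
  rw [hm, hm, PreconnectedSpace.constant inferInstance hm' (x := s) (y := s')]

/-- A homeomorphism of the suspension isotopic to the identity moves points along the flow, by a
continuous displacement. -/
theorem exists_lift_of_isotopicToId [TotallyDisconnectedSpace X]
    {g : Suspension φ ≃ₜ Suspension φ} (hg : g ∈ isotopicToId (Suspension φ)) :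
    ∃ γ : X → ℝ → ℝ, (Continuous fun p : X × ℝ => γ p.1 p.2) ∧
      (∀ x t, g (Suspension.mk φ x t) = Suspension.mk φ x (γ x t)) ∧
      ∀ x t (n : ℤ), γ ((φ ^ n) x) (t - n) = γ x t - n := by
  obtain ⟨H, hH, hH0, hH1⟩ := hg
  let cov := Suspension.isCoveringMap_mk φ
  let F : C(unitInterval × (X × ℝ), Suspension φ) :=
    ⟨fun p => H p.1 (Suspension.mk φ p.2.1 p.2.2),
      hH.comp (continuous_fst.prodMk ((Suspension.continuous_mk φ).comp continuous_snd))⟩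
  have hF0 : ∀ p : X × ℝ, F (0, p) = Suspension.mk φ p.1 p.2 := fun p => by
    change H 0 (Suspension.mk φ p.1 p.2) = _
    rw [hH0]; rfl
  let Λ := cov.liftHomotopy F (ContinuousMap.id _) hF0
  have hΛ : ∀ s p, Suspension.mk φ (Λ (s, p)).1 (Λ (s, p)).2 = H s (Suspension.mk φ p.1 p.2) :=
    fun s p => congrFun (cov.liftHomotopy_lifts F (ContinuousMap.id _) hF0) (s, p)
  have hΛ0 : ∀ p, Λ (0, p) = p := fun p => cov.liftHomotopy_zero F (ContinuousMap.id _) hF0 p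
  have hcont : ∀ p, Continuous fun s => Λ (s, p) := fun p =>
    Λ.continuous.comp (continuous_id.prodMk continuous_const)
  -- The `X`-coordinate of a lifted path has connected image in a totally disconnected space.
  have hfst : ∀ s p, (Λ (s, p)).1 = p.1 := by
    intro s p
    have h1 := (isPreconnected_range (continuous_fst.comp (hcont p))).subsingleton
      (Set.mem_range_self s) (Set.mem_range_self 0)
    simp only [Function.comp_apply, hΛ0] at h1
    exact h1
  have hmk : ∀ s x t, H s (Suspension.mk φ x t) = Suspension.mk φ x (Λ (s, (x, t))).2 := by
    intro s x t
    rw [← hΛ s (x, t), hfst]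
  -- The two lifted paths start at equivalent points and stay equivalent, so their difference is
  -- integral and continuous in `s`; its value is found at `s = 0`.
  have hequiv : ∀ s x t (n : ℤ),
      (Λ (s, ((φ ^ n) x, t - n))).2 - (Λ (s, (x, t))).2 = -n := by
    intro s x t n
    have h1 : Continuous fun s => (Λ (s, ((φ ^ n) x, t - n))).2 - (Λ (s, (x, t))).2 :=
      (continuous_snd.comp (hcont _)).sub (continuous_snd.comp (hcont _))
    have h2 : ∀ s, ∃ m : ℤ, (Λ (s, ((φ ^ n) x, t - n))).2 - (Λ (s, (x, t))).2 = m := by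
      intro s
      have h3 : Suspension.mk φ x t = Suspension.mk φ ((φ ^ n) x) (t - n) :=
        (Suspension.mk_eq_mk φ _ _ _ _).2 ⟨n, rfl, rfl⟩
      have h4 := hmk s x t
      rw [h3, hmk, eq_comm, Suspension.mk_eq_mk] at h4
      obtain ⟨m, -, hm⟩ := h4
      exact ⟨-m, by rw [hm]; push_cast; ring⟩
    have h5 := eq_of_continuous_of_forall_int h1 h2 s 0
    rw [h5, hΛ0, hΛ0]
    ring
  refine ⟨fun x t => (Λ (1, (x, t))).2, ?_, fun x t => ?_, fun x t n => ?_⟩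
  · exact continuous_snd.comp (Λ.continuous.comp (continuous_const.prodMk continuous_id))
  · rw [← hmk, hH1]
  · have := hequiv 1 x t n
    simp only
    linarith

/-- The local form of a lift of a locally dyadic piecewise linear homeomorphism. -/
theorem exists_local_form {g : Suspension φ ≃ₜ Suspension φ} (hg : IsLocallyDyadicPL φ g)
    {γ : X → ℝ → ℝ} (hγ : Continuous fun p : X × ℝ => γ p.1 p.2)
    (hgγ : ∀ x t, g (Suspension.mk φ x t) = Suspension.mk φ x (γ x t)) (x₀ : X) (t₀ : ℝ) :
    ∃ (a b c d : ℝ) (f : OpenPartialHomeomorph ℝ ℝ) (n k : ℤ), IsDyadicPL f a b c d ∧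
      t₀ - n ∈ Set.Ioo a b ∧ ∀ᶠ p in 𝓝 (x₀, t₀), γ p.1 p.2 = f (p.2 - n) + k := by
  obtain ⟨C, a, b, c, d, f, hC, -, hf, ⟨x₁, hx₁, t₁, ht₁, hy⟩, h⟩ := hg (Suspension.mk φ x₀ t₀)
  obtain ⟨n, rfl, rfl⟩ := (Suspension.mk_eq_mk φ _ _ _ _).1 hy
  have hev : ∀ᶠ p : X × ℝ in 𝓝 (x₀, t₀), ∃ k : ℤ, γ p.1 p.2 - f (p.2 - n) = k := by
    have h1 : ∀ᶠ p : X × ℝ in 𝓝 (x₀, t₀), (φ ^ n) p.1 ∈ C :=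
      ((φ ^ n).continuous.comp continuous_fst).continuousAt.eventually
        (hC.isClopen.isOpen.mem_nhds hx₁)
    have h2 : ∀ᶠ p : X × ℝ in 𝓝 (x₀, t₀), p.2 - n ∈ Set.Ioo a b :=
      (continuous_snd.sub continuous_const).continuousAt.eventually (isOpen_Ioo.mem_nhds ht₁)
    filter_upwards [h1, h2] with p hp1 hp2
    have h3 := h _ hp1 _ hp2
    have h4 : Suspension.mk φ p.1 p.2 = Suspension.mk φ ((φ ^ n) p.1) (p.2 - n) :=
      (Suspension.mk_eq_mk φ _ _ _ _).2 ⟨n, rfl, rfl⟩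
    rw [← h4, hgγ, Suspension.mk_eq_mk] at h3
    obtain ⟨m, -, hm⟩ := h3
    exact ⟨m, by rw [hm]; ring⟩
  have hc : ContinuousAt (fun p : X × ℝ => γ p.1 p.2 - f (p.2 - n)) (x₀, t₀) := by
    refine hγ.continuousAt.sub (ContinuousAt.comp (f := fun p : X × ℝ => p.2 - n) ?_
      (continuous_snd.sub continuous_const).continuousAt)
    exact f.continuousAt (by rw [hf.source_eq]; exact ht₁)
  obtain ⟨k, hk⟩ := hev.self_of_nhds
  refine ⟨a, b, c, d, f, n, k, hf, ht₁, ?_⟩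
  -- The difference between the lift and the chart formula is integer-valued and continuous at the
  -- base point, hence constant near it.
  filter_upwards [hev, hc.eventually (Metric.ball_mem_nhds _ one_pos)] with p ⟨m, hm⟩ hp
  have hk' : γ x₀ t₀ - f (t₀ - n) = k := hk
  have hp : dist (γ p.1 p.2 - f (p.2 - n)) (γ x₀ t₀ - f (t₀ - n)) < 1 := hp
  rw [hm, hk', Int.dist_cast_real] at hp
  have hmk : m = k := by
    rw [Int.dist_eq] at hp
    have : |m - k| < 1 := by exact_mod_cast hp
    have := abs_lt.1 this
    omega
  rw [hmk] at hm
  linarith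

/-- Every element of `T(φ)` is induced by an equivariant family of dyadic piecewise linear maps. -/
theorem exists_liftPL_of_mem_groupT [CompactSpace X] [T2Space X] [TotallyDisconnectedSpace X]
    {g : Suspension φ ≃ₜ Suspension φ} (hg : g ∈ groupT φ) :
    ∃ (G : X → (ℝ ≃o ℝ)) (hG : G ∈ liftPL φ), suspHom φ ⟨G, (mem_liftPL.1 hG).1⟩ = g := by
  obtain ⟨γ, hγ, hgγ, hequiv⟩ := exists_lift_of_isotopicToId hg.1
  have hform := exists_local_form hg.2 hγ hgγ
  have hγx : ∀ x, Continuous (γ x) := fun x =>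
    hγ.comp (continuous_const.prodMk continuous_id)
  have hgerm : ∀ x t, IsDyadicAffineAlong (γ x) (𝓝[≥] t) ∧ IsDyadicAffineAlong (γ x) (𝓝[≤] t) ∧
      (¬ IsDyadic t → IsDyadicAffineAlong (γ x) (𝓝 t)) := by
    intro x t
    obtain ⟨a, b, c, d, f, n, k, hf, ht, h⟩ := hform x t
    have h1 : ∀ᶠ s in 𝓝 t, γ x s = f (s - n) + k :=
      (continuous_const.prodMk continuous_id : Continuous fun s : ℝ => (x, s)).continuousAt.eventually h
    have htr : ∀ (m : ℤ) (l : Filter ℝ), IsDyadicAffineAlong (transl (m : ℝ)) l := fun m l =>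
      ⟨0, m, IsDyadic.intCast m, Eventually.of_forall fun s => by simp [transl_apply]⟩
    have key : ∀ l l' : Filter ℝ, l ≤ 𝓝 t → Tendsto (transl ((-n : ℤ) : ℝ)) l l' →
        IsDyadicAffineAlong f l' → IsDyadicAffineAlong (γ x) l := by
      intro l l' hl ht hf
      have h2 := (htr k ⊤).comp (hf.comp (htr (-n) l) ht) tendsto_top
      refine h2.congr ?_
      filter_upwards [hl h1] with s hs
      rw [hs]
      simp [transl_apply, sub_eq_add_neg]
    have htn : transl ((-n : ℤ) : ℝ) t = t - n := by
      simp [transl_apply, sub_eq_add_neg]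
    obtain ⟨h3, h4, h5⟩ := hf.isDyadicAffineAlong ht
    refine ⟨key _ _ nhdsWithin_le_nhds ((transl _).tendsto_nhdsGE t) (by rwa [htn]),
      key _ _ nhdsWithin_le_nhds ((transl _).tendsto_nhdsLE t) (by rwa [htn]), fun htd =>
      key _ (𝓝 (t - n)) le_rfl (htn ▸ (transl _).continuous.continuousAt) (h5 fun h6 => htd ?_)⟩
    simpa using h6.add (IsDyadic.intCast n)
  have hinj : ∀ x, Function.Injective (γ x) := by
    intro x t t' h
    have h1 : g (Suspension.mk φ x t) = g (Suspension.mk φ x t') := by rw [hgγ, hgγ, h]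
    -- The two times may differ by a period `n` of `x`. Equivariance then shifts the values by `n`
    -- as well, so `n = 0`.
    obtain ⟨n, hn, rfl⟩ := (Suspension.mk_eq_mk φ _ _ _ _).1 (g.injective h1)
    have h2 := hequiv x t n
    rw [← hn, ← h] at h2
    linarith
  have hmono : ∀ x, StrictMono (γ x) := by
    intro x
    rcases (hγx x).strictMono_of_inj (hinj x) with h | h
    · exact h
    -- A decreasing lift is impossible because every slope is a positive power of two.
    · exfalso
      obtain ⟨m, β, -, h1⟩ := (hgerm x 0).1
      obtain ⟨u, hu, h2⟩ := (mem_nhdsGE_iff_exists_Ico_subset' (zero_lt_one' ℝ)).1 h1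
      have hu : 0 < u := hu
      have h3 := h (half_pos hu)
      rw [h2 ⟨le_rfl, hu⟩, h2 ⟨(half_pos hu).le, half_lt_self hu⟩] at h3
      have : (0 : ℝ) < (2 : ℝ) ^ m := by positivity
      nlinarith
  -- The displacement is invariant under the `ℤ`-action and continuous on the compact set `X × [0,
  -- 1]`; its boundedness gives surjectivity.
  have hbdd : ∃ B, ∀ x t, |γ x t - t| ≤ B := by
    have hcont : Continuous fun p : X × ℝ => γ p.1 p.2 - p.2 := hγ.sub continuous_snd
    obtain ⟨B, hB⟩ := (isCompact_univ.prod (isCompact_Icc (a := (0 : ℝ)) (b := 1))).exists_bound_of_continuousOn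
      (f := fun p : X × ℝ => γ p.1 p.2 - p.2) hcont.continuousOn
    refine ⟨B, fun x t => ?_⟩
    have h1 := hB ((φ ^ ⌊t⌋) x, t - ⌊t⌋) ⟨Set.mem_univ _,
      ⟨by simp only; linarith [Int.floor_le t], by simp only; linarith [Int.lt_floor_add_one t]⟩⟩
    simp only [hequiv, Real.norm_eq_abs, sub_sub_sub_cancel_right] at h1
    exact h1
  obtain ⟨B, hB⟩ := hbdd
  have hsurj : ∀ x, Function.Surjective (γ x) := by
    intro x
    refine (hγx x).surjective ?_ ?_
    · refine tendsto_atTop_mono (fun t => ?_) (tendsto_atTop_add_const_right atTop (-B) tendsto_id)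
      have := (abs_le.1 (hB x t)).1
      simp only [id]
      linarith
    · refine tendsto_atBot_mono (fun t => ?_) (tendsto_atBot_add_const_right atBot B tendsto_id)
      have := (abs_le.1 (hB x t)).2
      simp only [id]
      linarith
  let G : X → (ℝ ≃o ℝ) := fun x => StrictMono.orderIsoOfSurjective (γ x) (hmono x) (hsurj x)
  have hG : G ∈ liftPL φ := by
    refine mem_liftPL.2 ⟨⟨hequiv, fun x₀ K => ?_⟩, hgerm⟩
    -- Near each point of the fibre over `x₀` the local form does not involve `x`; compactness of
    -- the interval makes the neighbourhood of `x₀` uniform.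
    refine isCompact_Icc.eventually_forall_of_forall_eventually (P := fun x t => γ x t = γ x₀ t)
      fun t _ => ?_
    obtain ⟨a, b, c, d, f, n, k, hf, ht, h⟩ := hform x₀ t
    have hc : Tendsto (fun p : X × ℝ => (x₀, p.2)) (𝓝 (x₀, t)) (𝓝 (x₀, t)) :=
      (continuous_const.prodMk continuous_snd).tendsto' _ _ rfl
    have h1 : ∀ᶠ p : X × ℝ in 𝓝 (x₀, t), γ x₀ p.2 = f (p.2 - n) + k := hc.eventually h
    filter_upwards [h, h1] with p h2 h3
    rw [h2, h3]
  refine ⟨G, hG, ?_⟩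
  ext y
  obtain ⟨x, t, rfl⟩ := Suspension.exists_mk φ y
  rw [suspHom_mk, hgγ]
  rfl

end Lifting

/-! ### Simplicity -/

section Simplicity

variable {X : Type*} [TopologicalSpace X] [CompactSpace X] [T2Space X]
  [TotallyDisconnectedSpace X] {φ : X ≃ₜ X}

/-- The lifted group maps to `T(φ)`. -/
def liftPLHom (φ : X ≃ₜ X) : liftPL φ →* groupT φ :=
  ((suspHom φ).comp (Subgroup.inclusion inf_le_left)).codRestrict (groupT φ) fun G =>
    ⟨suspHom_mem_isotopicToId _, isLocallyDyadicPL_suspHom G.2⟩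

theorem liftPLHom_mk (G : liftPL φ) (x : X) (t : ℝ) :
    (liftPLHom φ G : Suspension φ ≃ₜ Suspension φ) (Suspension.mk φ x t) =
      Suspension.mk φ x ((G : X → (ℝ ≃o ℝ)) x t) := rfl

theorem liftPLHom_surjective (φ : X ≃ₜ X) : Function.Surjective (liftPLHom φ) := by
  intro g
  obtain ⟨G, hG, h⟩ := exists_liftPL_of_mem_groupT g.2
  exact ⟨⟨G, hG⟩, Subtype.ext h⟩

theorem nontrivial_groupT [Nonempty X] (φ : X ≃ₜ X) : Nontrivial (groupT φ) := by
  have hd : IsDyadic (1 / 4) := ⟨1, 2, by norm_num⟩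
  have hd' : IsDyadic (1 / 2) := ⟨1, 1, by norm_num⟩
  -- Moving `1/4` to `1/2` is visible in the suspension because the displacement is not an integer.
  obtain ⟨f, hf, hfu⟩ := exists_suppPL_apply_eq (a := 0) (b := 0 + 1) IsDyadic.zero
    (by simpa using IsDyadic.one) hd hd' ⟨by norm_num, by norm_num⟩ ⟨by norm_num, by norm_num⟩
  let G : liftPL φ := ⟨_, cylMap_mem (isClopen_univ (X := X)) hf IsDyadic.zero⟩
  refine ⟨liftPLHom φ G, 1, fun h => ?_⟩
  obtain ⟨x⟩ := ‹Nonempty X›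
  have h1 := liftPLHom_mk G x (1 / 4)
  rw [h] at h1
  change Suspension.mk φ x (1 / 4) = Suspension.mk φ x (cylMap φ isClopen_univ hf x (1 / 4)) at h1
  rw [cylMap_apply_of_mem_zero _ hf (Set.mem_univ x) ⟨by norm_num, by norm_num⟩, hfu,
    Suspension.mk_eq_mk] at h1
  obtain ⟨n, -, hn⟩ := h1
  have h2 : (n : ℝ) = -(1 / 4) := by linarith
  have h3 : ((4 * n : ℤ) : ℝ) = ((-1 : ℤ) : ℝ) := by push_cast; linarith
  have h4 : 4 * n = -1 := by exact_mod_cast h3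
  omega

end Simplicity

/-- If a Stone system `(X, φ)` is minimal, then the group `T(φ)` is simple. -/
theorem mainTheorem1 {X : Type*} [TopologicalSpace X] [CompactSpace X] [T2Space X]
    [TotallyDisconnectedSpace X] [Nonempty X] (φ : X ≃ₜ X) (hφ : IsMinimalSystem φ) :
    IsSimpleGroup (groupT φ) := by
  have := nontrivial_groupT φ
  refine ⟨fun N hN => or_iff_not_imp_left.2 fun hbot => ?_⟩
  obtain ⟨g, hgN, hg1⟩ := N.bot_or_exists_ne_one.resolve_left hbot
  obtain ⟨G, rfl⟩ := liftPLHom_surjective φ g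
  obtain ⟨x, t, hxt⟩ : ∃ x t, Suspension.mk φ x ((G : X → (ℝ ≃o ℝ)) x t) ≠ Suspension.mk φ x t := by
    by_contra! h
    refine hg1 (Subtype.ext (Homeomorph.ext fun y => ?_))
    obtain ⟨x, t, rfl⟩ := Suspension.exists_mk φ y
    exact h x t
  -- The preimage of `N` is viewed inside the group of all families, where it is normalised by
  -- `liftPL φ`. Since it contains all of `liftPL φ`, surjectivity of `liftPLHom` gives that `N` is
  -- everything.
  have hle := liftPL_le_of_normal (N := (N.comap (liftPLHom φ)).map (liftPL φ).subtype) hφ ?_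
    ⟨G, hgN, rfl⟩ G.2 (x₀ := x) (t₀ := t) ?_
  · refine eq_top_iff.2 fun k _ => ?_
    obtain ⟨K, rfl⟩ := liftPLHom_surjective φ k
    obtain ⟨K', hK', hKK⟩ := hle K.2
    rwa [← Subtype.ext (show (K' : X → (ℝ ≃o ℝ)) = K from hKK)]
  · rintro k hk _ ⟨h, hh, rfl⟩
    obtain ⟨k, rfl⟩ : ∃ k' : liftPL φ, (liftPL φ).subtype k' = k := ⟨⟨k, hk⟩, rfl⟩
    have h1 := (hN.comap (liftPLHom φ)).conj_mem h hh k
    rw [← map_inv, ← map_mul, ← map_mul]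
    exact Subgroup.mem_map_of_mem _ h1
  · intro n hn hGn
    refine hxt ((Suspension.mk_eq_mk φ _ _ _ _).2 ⟨n, hn.symm, ?_⟩)
    have hGn : (G : X → (ℝ ≃o ℝ)) x t = t + n := hGn
    linarith
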